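/- Throughout, $d\ge 2$ and $P_c(z)=z^d+c$. A *disk* is a simply connected open subset of $\mathbb C$. For a disk $U$ and a connected set $X\subset U$, $\operatorname{mod}(U\setminus X)$ is the supremum of $m>0$ such that $U\setminus X$ contains a domain that separates $X$ from $\partial U$ (i.e. $X$ lies in a bounded part of its complement) and is conformally equivalent to $\{1<|z|<e^{2\pi m}\}$; this is the usual modulus when $U\setminus X$ is an annulus. A unicritical polynomial-like map of degree $d$ is a proper holomorphic map $g:V\to U$ of degree $d$ between disks, $\overline V$ compact in $U$, whose only critical point is $0$, of local degree $d$; $K(g)$ is the set of points that never leave $V$. **Renormalizations.** Let $f$ be an infinitely renormalizable unicritical polynomial-like map of degree $d$ with $n$-th renormalizations $\mathcal R^nf=f^{t_n}:V_n\to U_n$ ($n\ge 0$, $t_0=1$), which are unicritical polynomial-like maps of degree $d$ with connected Julia sets; put $K_n=K(\mathcal R^nf)$ and $W_n=(\mathcal R^nf)^{-1}(V_n)$. Let $S_n:V_n\to\mathbb C$ be a $\kappa$-quasiconformal hybrid conjugacy (straightening), $S_n(0)=0$, from $\mathcal R^nf:W_n\to V_n$ to a restriction of $P_{c_n}$, and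 let $r>1$ be such that for every $n$ the domain $D_n(r)$ bounded by the equipotential of level $r$ of $P_{c_n}$ is contained in $S_n(W_n)$. Let $\alpha_n$ be the dividing fixed point of $P_{c_n}$ (the fixed point where at least two external rays land). Puzzle pieces of depth $0$ of $P_{c_n}$ are the closures of the components of $D_n(r)$ minus $\alpha_n$ and the rays landing there; those of depth $j$ are the closures of the components of the $j$-th preimages of their interiors; $Y^j_{0}$ denotes the piece of depth $j$ that contains $0$. $P_{c_n}$ is *satellite* renormalizable if $P_{c_n}^{lq}(0)\in Y_0^1$ for all $l\ge0$, where $q$ is the number of rays landing at $\alpha_n$; it is *primitively* renormalizable if its favorite nest of critical puzzle pieces $Q^1\supset P^1\supset Q^2\supset P^2\supset\cdots$ contains some $Q^i$ such that the critical orbit never leaves $P^i$ under the first return map to $Q^i$. Here $Q^1$ is the pullback along the critical orbit, under $P_{c_n}^{kq}$ with $k\geq 1$ minimal such that such a $Z$ exists, of the piece $Z\not\ni 0$ of depth $1$ that contains $P_{c_n}^{kq}(0)$ and has a point of $P_{c_n}^{-1}(\alpha_n)\setminus\{\alpha_n\}$ on its boundary; the first child $P^i$ of $Q^i$ is the pullback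 of $Q^i$ along the critical orbit under the first return of $0$ to $Q^i$; and the favorite child $Q^{i+1}$ is the pullback of $Q^i$ along the critical orbit under $P_{c_n}^b$, where $b$ is the first moment when the critical orbit is again in $P^i$ after its first visit to $Q^i\setminus P^i$. In these two cases the first renormalization of $P_{c_n}$ is the restriction of $P_{c_n}^{p}$, with $p=q$, resp. $p$ the first return time of $0$ to $Q^i$, and its filled Julia set is the set of points whose orbit under $P_{c_n}^p$ stays in $Y^1_0$, resp. in $P^i$. That $\mathcal R^{n+1}f$ is the first renormalization of $\mathcal R^nf$ means that $P_{c_n}$ is satellite or primitively renormalizable, that $t_{n+1}=p\,t_n$, and that $S_n(K_{n+1})$ is this filled Julia set. **Normalization.** For all $n\ge1$: $\ \varepsilon\le\operatorname{mod}(U_n\setminus V_n)\le\eta\ $ and $\ \operatorname{mod}(V_n\setminus K_n)\le 2\eta$. **The annuli.** Say that level $m$ belongs to case $\mathscr C$ if $P_{c_m}$ and $P_{c_{m+1}}$ are both satellite renormalizable. For $m\leq k$ let $\mathbf B_{m,k}$ be the component containing $0$ of $\bigcup_{0\le i<t_k/t_m}P_{c_m}^i(S_m(K_k))$ (a Julia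 bouquet). If level $n-1$ belongs to case $\mathscr C$, let $\mathbf L'_n\subset\mathbf L_n\subset \operatorname{int}Y^0_0$ be disks in the plane of $P_{c_{n-1}}$, with $\mathbf B_{n-1,n+1}\subset\mathbf L_n'$, such that the moduli of $Y_0^0\setminus\mathbf L_n$, $\mathbf L_n\setminus\mathbf L_n'$, $\mathbf L_n'\setminus\mathbf B_{n-1,n+1}$ are in $[1/C,C]$, and let $\mathbf E_n\supset\mathbf B_{n,n+1}$ be a disk in $D_n(r)\cap S_n\big(S_{n-1}^{-1}(\mathbf L_n')\cap V_n\big)$ with $\operatorname{mod}(\mathbf E_n\setminus\mathbf B_{n,n+1})\ge1/C$; put $$\mathbb V_{n,0}=S_{n-1}^{-1}(\mathbf L_n),\qquad \Delta_{n,0}=S_n^{-1}(\mathbf E_n).$$ If level $n-1$ does not belong to case $\mathscr C$, put $$\mathbb V_{n,0}=V_n,\qquad \Delta_{n,0}=S_n^{-1}(D_n(r)).$$ **Lemma.** Given $d\ge2$, $\varepsilon>0$, $\eta$, $\kappa$ and $C>0$ there is a constant $M'\geq 1$, depending only on these numbers, such that the following holds. Let $f$ and $\tilde f$ be two infinitely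 renormalizable unicritical polynomial-like maps of degree $d$ with choices of domains, straightenings, levels $r$, $\tilde r$ and disks as above (with the constants $\varepsilon,\eta,\kappa,C$), and mark the objects of $\tilde f$ with a tilde. Then, for every $n\ge1$, the moduli of $\mathbb V_{n,0}\setminus\Delta_{n,0}$ and $\widetilde{\mathbb V}_{n,0}\setminus\widetilde\Delta_{n,0}$ are positive and finite, and $$\frac1{M'}\le\frac{\operatorname{mod}(\widetilde{\mathbb V}_{n,0}\setminus\widetilde\Delta_{n,0})}{\operatorname{mod}(\mathbb V_{n,0}\setminus\Delta_{n,0})}\le M'.$$ (No relation between $f$ and $\tilde f$ is needed. In particular this applies when they are topologically conjugate, so that their cases coincide, and to the levels $n=n(k)$ that remain when those $l\ge1$ for which $P_{c_{l-1}}$ is satellite and $P_{c_l}$ primitively renormalizable are skipped. With $d,\eta,\kappa=\kappa(\varepsilon),C$ fixed beforehand, $M'$ depends only on $\varepsilon$.) -/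

import Mathlib

open Set Filter Topology

noncomputable section

namespace GlueSpace

/-! ### Ring domains, moduli of annuli, quasiconformal maps -/

/-- `A` is a ring domain of modulus `m`: it is conformally equivalent to the round annulus
`{1 < |z| < R}` with `m = (log R) / (2 π)`. -/
def IsRing (A : Set ℂ) (m : ℝ) : Prop :=
  0 < m ∧ ∃ φ : ℂ → ℂ,
    DifferentiableOn ℂ φ {z | 1 < ‖z‖ ∧ ‖z‖ < Real.exp (2 * Real.pi * m)} ∧
    InjOn φ {z | 1 < ‖z‖ ∧ ‖z‖ < Real.exp (2 * Real.pi * m)} ∧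
    φ '' {z | 1 < ‖z‖ ∧ ‖z‖ < Real.exp (2 * Real.pi * m)} = A

/-- The points surrounded by `A`: the union of the bounded components of the complement. -/
def surrounded (A : Set ℂ) : Set ℂ :=
  {x | x ∈ Aᶜ ∧ Bornology.IsBounded (connectedComponentIn Aᶜ x)}

/-- The modulus of the annulus `U \ X`, for a topological disk `U` and a connected set `X` inside:
the supremum of the moduli of the ring domains in `U \ X` that go around `X`.  If `U \ X` is itself
a ring domain, this is its modulus; adding or removing boundary points does not matter. -/
def annMod (U X : Set ℂ) : ENNReal :=
  ⨆ (A : Set ℂ) (m : ℝ) (_ : IsRing A m ∧ A ⊆ U \ X ∧ X ⊆ surrounded A), ENNReal.ofReal m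

/-- A (continuous injective) map preserves orientation on `D`: the image of every circle that bounds
a disk in `D` winds once, in the positive sense, around the image of the centre. -/
def OrientationPreservingOn (D : Set ℂ) (h : ℂ → ℂ) : Prop :=
  ∀ z : ℂ, ∀ r : ℝ, 0 < r → Metric.closedBall z r ⊆ D →
    ∃ θ : ℝ → ℝ, Continuous θ ∧ θ 1 - θ 0 = 2 * Real.pi ∧
      ∀ s : ℝ, h (circleMap z r (2 * Real.pi * s)) - h z =
        (‖h (circleMap z r (2 * Real.pi * s)) - h z‖ : ℂ) * Complex.exp (θ s * Complex.I)

/-- The (ring) definition of a `K`-quasiconformal embedding of the open set `D` in the plane: an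
orientation preserving homeomorphism onto its image that distorts the moduli of the ring domains
with closure in `D` by a factor at most `K`. -/
structure IsQC (K : ℝ) (D : Set ℂ) (h : ℂ → ℂ) : Prop where
  one_le : 1 ≤ K
  isOpen : IsOpen D
  continuousOn : ContinuousOn h D
  injOn : InjOn h D
  orientation : OrientationPreservingOn D h
  ring_iff : ∀ A : Set ℂ, IsCompact (closure A) → closure A ⊆ D →
    ((∃ m, IsRing A m) ↔ ∃ m, IsRing (h '' A) m)
  ring_le : ∀ A : Set ℂ, IsCompact (closure A) → closure A ⊆ D → ∀ m m' : ℝ,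
    IsRing A m → IsRing (h '' A) m' → m / K ≤ m' ∧ m' ≤ K * m

/-! ### Unicritical polynomials: Julia sets, rays, equipotentials -/

/-- The unicritical polynomial `z ^ d + c`. -/
def P (d : ℕ) (c : ℂ) : ℂ → ℂ := fun z => z ^ d + c

/-- The filled Julia set of `P d c`. -/
def filledJulia (d : ℕ) (c : ℂ) : Set ℂ :=
  {z | ¬ Tendsto (fun n : ℕ => (P d c)^[n] z) atTop (Bornology.cobounded ℂ)}

/-- `B` is the Böttcher coordinate of `P d c` on the complement of the (connected) filled Julia
set. -/
structure IsBottcher (d : ℕ) (c : ℂ) (B : ℂ → ℂ) : Prop where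
  holo : DifferentiableOn ℂ B (filledJulia d c)ᶜ
  bij : BijOn B (filledJulia d c)ᶜ {w | 1 < ‖w‖}
  conj : ∀ z ∈ (filledJulia d c)ᶜ, B (P d c z) = B z ^ d
  tangent : Tendsto (fun z => B z / z) (Bornology.cobounded ℂ) (𝓝 1)

/-- The external ray of angle `θ`. -/
def ray (d : ℕ) (c : ℂ) (θ : ℝ) : Set ℂ :=
  {z | z ∈ (filledJulia d c)ᶜ ∧
    ∃ B, IsBottcher d c B ∧ ∃ s : ℝ, 1 < s ∧ B z = s * Complex.exp (θ * Complex.I)}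

/-- The external ray of angle `θ` lands at `x`. -/
def Lands (d : ℕ) (c : ℂ) (θ : ℝ) (x : ℂ) : Prop :=
  ∃ (B : ℂ → ℂ) (γ : ℝ → ℂ), IsBottcher d c B ∧
    (∀ s : ℝ, 1 < s → γ s ∈ (filledJulia d c)ᶜ ∧ B (γ s) = s * Complex.exp (θ * Complex.I)) ∧
    Tendsto γ (𝓝[>] 1) (𝓝 x)

/-- The domain bounded by the equipotential of level `r > 1`. -/
def insideEquipotential (d : ℕ) (c : ℂ) (r : ℝ) : Set ℂ :=
  {z | z ∈ filledJulia d c ∨ ∃ B, IsBottcher d c B ∧ ‖B z‖ < r}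

/-- `α` is the dividing fixed point, the landing point of exactly `q ≥ 2` external rays. -/
def IsDividing (d : ℕ) (c α : ℂ) (q : ℕ) : Prop :=
  P d c α = α ∧ 2 ≤ q ∧ {θ : ℝ | θ ∈ Ico 0 (2 * Real.pi) ∧ Lands d c θ α}.ncard = q

/-! ### Puzzle pieces and renormalization of polynomials -/

/-- The union of the external rays landing at `α`. -/
def raysAt (d : ℕ) (c α : ℂ) : Set ℂ := ⋃ θ ∈ {θ : ℝ | Lands d c θ α}, ray d c θ

/-- The union of the interiors of the puzzle pieces of depth `n` made with the equipotential of
level `r` and the rays landing at `α`. -/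
def puzzle (d : ℕ) (c α : ℂ) (r : ℝ) (n : ℕ) : Set ℂ :=
  (P d c)^[n] ⁻¹' (insideEquipotential d c r \ closure (raysAt d c α))

/-- The interior of the puzzle piece of depth `n` that contains `z`.  The piece itself is the
closure. -/
def piece (d : ℕ) (c α : ℂ) (r : ℝ) (n : ℕ) (z : ℂ) : Set ℂ :=
  connectedComponentIn (puzzle d c α r n) z

/-- The pullback of `Q` by the `n`-th iterate along the critical orbit. -/
def critPullback (d : ℕ) (c : ℂ) (n : ℕ) (Q : Set ℂ) : Set ℂ :=
  connectedComponentIn ((P d c)^[n] ⁻¹' Q) 0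

/-- `p` is the first positive moment when the critical orbit enters `Q`.  The first child of `Q` is
then `critPullback d c p Q`. -/
def IsFirstReturn (d : ℕ) (c : ℂ) (Q : Set ℂ) (p : ℕ) : Prop :=
  IsLeast {n : ℕ | 0 < n ∧ (P d c)^[n] 0 ∈ Q} p

/-- `Q'` is the favorite child of `Q`: the critical orbit first returns to `Q` outside the first
child at the moment `a`, and is back in the first child at the moment `b` for the first time after
that; `Q'` is the pullback of `Q` by the `b`-th iterate along the critical orbit. -/
def IsFavoriteChild (d : ℕ) (c : ℂ) (Q Q' : Set ℂ) : Prop :=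
  ∃ p a b : ℕ, IsFirstReturn d c Q p ∧
    IsLeast {n : ℕ | 0 < n ∧ (P d c)^[n] 0 ∈ Q \ critPullback d c p Q} a ∧
    IsLeast {n : ℕ | a < n ∧ (P d c)^[n] 0 ∈ critPullback d c p Q} b ∧
    Q' = critPullback d c b Q

/-- `w` lies in a non-critical piece of depth one attached to a preimage of `α` other than `α`. -/
def InSymmetricPiece (d : ℕ) (c α : ℂ) (r : ℝ) (w : ℂ) : Prop :=
  w ∈ puzzle d c α r 1 ∧ (0 : ℂ) ∉ piece d c α r 1 w ∧
    ∃ x ∈ closure (piece d c α r 1 w), P d c x = α ∧ x ≠ α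

/-- The (interiors of the) puzzle pieces `Q¹, Q², …` of the favorite nest. -/
inductive InNest (d : ℕ) (c α : ℂ) (r : ℝ) (q : ℕ) : Set ℂ → Prop
  | base (k : ℕ)
      (hk : IsLeast {k : ℕ | 0 < k ∧ InSymmetricPiece d c α r ((P d c)^[k * q] 0)} k) :
      InNest d c α r q
        (critPullback d c (k * q) (piece d c α r 1 ((P d c)^[k * q] 0)))
  | step (Q Q' : Set ℂ) (hQ : InNest d c α r q Q) (hQ' : IsFavoriteChild d c Q Q') :
      InNest d c α r q Q'

/-- `P d c` is satellite renormalizable; its first renormalization is a restriction of the `p`-th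
iterate and has the filled Julia set `Kl`. -/
def IsSatellite (d : ℕ) (c α : ℂ) (r : ℝ) (p : ℕ) (Kl : Set ℂ) : Prop :=
  IsDividing d c α p ∧
    (∀ l : ℕ, (P d c)^[l * p] 0 ∈ closure (piece d c α r 1 0)) ∧
    Kl = {z | ∀ l : ℕ, (P d c)^[l * p] z ∈ closure (piece d c α r 1 0)}

/-- `P d c` is primitively renormalizable: the critical orbit never escapes from the first child of
some piece `Q` of the favorite nest under iterates of the return map, which is the `p`-th iterate
there.  The first renormalization is that iterate; it has the filled Julia set `Kl`. -/
def IsPrimitive (d : ℕ) (c α : ℂ) (r : ℝ) (p : ℕ) (Kl : Set ℂ) : Prop :=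
  ∃ (q : ℕ) (Q : Set ℂ), IsDividing d c α q ∧ InNest d c α r q Q ∧ IsFirstReturn d c Q p ∧
    (∀ l : ℕ, (P d c)^[l * p] 0 ∈ critPullback d c p Q) ∧
    Kl = {z | ∀ l : ℕ, (P d c)^[l * p] z ∈ critPullback d c p Q}

/-! ### Polynomial-like maps -/

/-- An open simply connected subset of the plane. -/
def IsDisk (U : Set ℂ) : Prop := IsOpen U ∧ IsSimplyConnected U

/-- `g : V → U` is a unicritical polynomial-like map of degree `d` with critical point `0`. -/
structure IsPolyLike (d : ℕ) (g : ℂ → ℂ) (V U : Set ℂ) : Prop where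
  disk_dom : IsDisk V
  disk_range : IsDisk U
  compact_closure : IsCompact (closure V)
  closure_subset : closure V ⊆ U
  holo : DifferentiableOn ℂ g V
  mapsTo : MapsTo g V U
  proper : ∀ T ⊆ U, IsCompact T → IsCompact (V ∩ g ⁻¹' T)
  zero_mem : (0 : ℂ) ∈ V
  fiber_crit : ∀ z ∈ V, g z = g 0 → z = 0
  fiber : ∀ w ∈ U, w ≠ g 0 → {z | z ∈ V ∧ g z = w}.ncard = d

/-- The filled Julia set of `g` restricted to `V`. -/
def filled (g : ℂ → ℂ) (V : Set ℂ) : Set ℂ := {z | ∀ j : ℕ, g^[j] z ∈ V}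

/-- `S` is a `K`-quasiconformal hybrid conjugacy, fixing `0`, from `g : W → V` to a restriction of
`P d c`, where `W` is the part of `V` mapped into `V` and the filled Julia set of `g` is `X`. -/
structure IsStraightening (d : ℕ) (K : ℝ) (g : ℂ → ℂ) (V X : Set ℂ) (c : ℂ) (S : ℂ → ℂ) :
    Prop where
  qc : IsQC K V S
  zero : S 0 = 0
  conj : ∀ z ∈ V, g z ∈ V → S (g z) = P d c (S z)
  hybrid : ∀ᵐ z ∂(MeasureTheory.volume : MeasureTheory.Measure ℂ),
    z ∈ X → DifferentiableAt ℂ S z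

/-! ### The construction -/

/-- The objects chosen for one infinitely renormalizable map `f`. -/
structure Choices where
  /-- the map -/
  f : ℂ → ℂ
  /-- ranges of the renormalizations -/
  U : ℕ → Set ℂ
  /-- domains of the renormalizations -/
  V : ℕ → Set ℂ
  /-- periods of the renormalizations -/
  t : ℕ → ℕ
  /-- parameters of the straightened renormalizations -/
  c : ℕ → ℂ
  /-- dividing fixed points of the straightened renormalizations -/
  α : ℕ → ℂ
  /-- straightenings -/
  S : ℕ → ℂ → ℂ
  /-- level of the equipotentials -/
  r : ℝ
  /-- `L (n + 1)` and `L' (n + 1)` are disks in the plane of `P d (c n)` -/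
  L : ℕ → Set ℂ
  L' : ℕ → Set ℂ
  /-- `E n` is a disk in the plane of `P d (c n)` -/
  E : ℕ → Set ℂ

namespace Choices

variable (F : Choices) (d : ℕ)

/-- The `n`-th renormalization, to be restricted to `V n`. -/
def R (n : ℕ) : ℂ → ℂ := F.f^[F.t n]

/-- The little filled Julia set of level `n` that contains the critical point. -/
def K (n : ℕ) : Set ℂ := filled (F.R n) (F.V n)

/-- The preimage of `V n` under the `n`-th renormalization. -/
def W (n : ℕ) : Set ℂ := {z | z ∈ F.V n ∧ F.R n z ∈ F.V n}

/-- The preimage under the straightening `S n` of a set in the plane of `P d (c n)`. -/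
def pull (n : ℕ) (X : Set ℂ) : Set ℂ := {z | z ∈ F.V n ∧ F.S n z ∈ X}

/-- The `n`-th renormalization is satellite renormalizable. -/
def Sat (n : ℕ) : Prop := ∃ p Kl, IsSatellite d (F.c n) (F.α n) F.r p Kl

/-- Level `n` belongs to the last of the three cases: the `n`-th and `(n + 1)`-st renormalizations
are both satellite renormalizable. -/
def CaseC (n : ℕ) : Prop := F.Sat d n ∧ F.Sat d (n + 1)

/-- The Julia bouquet of level `m` in the plane of `P d (c n)`, for `n ≤ m`: the connected component
containing the critical point of the union of the little Julia sets of level `m`. -/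
def bouquet (n m : ℕ) : Set ℂ :=
  connectedComponentIn
    (⋃ i ∈ Finset.range (F.t m / F.t n), (P d (F.c n))^[i] '' (F.S n '' F.K m)) 0

open Classical in
/-- The disk `𝕍 n`, the hole around the critical point of the multiply connected domain that precedes
level `n ≥ 1`: the preimage of `L n` if level `n` follows the last case, and `V n` otherwise.  (Levels
that the construction skips fall under `otherwise`; nothing is lost by keeping them.) -/
def hole : ℕ → Set ℂ
  | 0 => F.V 0
  | n + 1 => if F.CaseC d n then F.pull n (F.L (n + 1)) else F.V (n + 1)

open Classical in
/-- The disk `Δ n` cut out by the outer boundary of the multiply connected domain of level `n`: the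
preimage of `E n` if level `n` follows the last case, and the preimage of the domain bounded by the
equipotential otherwise. -/
def Del : ℕ → Set ℂ
  | 0 => F.pull 0 (insideEquipotential d (F.c 0) F.r)
  | n + 1 => if F.CaseC d n then F.pull (n + 1) (F.E (n + 1))
      else F.pull (n + 1) (insideEquipotential d (F.c (n + 1)) F.r)

end Choices

/-- The requirements on the choices.  Here `ε` is the a priori bound, `η` the upper bound in the
normalization of the domains, `κ` the bound on the dilatation of the straightenings, and `C` the
bound for the moduli of the annuli around Julia bouquets. -/
structure Admissible (d : ℕ) (ε η κ C : ℝ) (F : Choices) : Prop where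
  t_zero : F.t 0 = 1
  polyLike : ∀ n, IsPolyLike d (F.R n) (F.V n) (F.U n)
  orbit : ∀ n, ∀ z ∈ F.V n, ∀ j < F.t n, F.f^[j] z ∈ F.V 0
  connected : ∀ n, IsConnected (frontier (F.K n))
  straight : ∀ n, IsStraightening d κ (F.R n) (F.V n) (F.K n) (F.c n) (F.S n)
  one_lt : 1 < F.r
  equip : ∀ n, insideEquipotential d (F.c n) F.r ⊆ F.S n '' F.W n
  /-- The `(n + 1)`-st renormalization is the first renormalization of the `n`-th one. -/
  renorm : ∀ n, ∃ (p : ℕ) (Kl : Set ℂ), F.t (n + 1) = F.t n * p ∧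
    (IsSatellite d (F.c n) (F.α n) F.r p Kl ∨ IsPrimitive d (F.c n) (F.α n) F.r p Kl) ∧
    F.K (n + 1) = F.pull n Kl
  /-- A priori bounds and normalization of the domains. -/
  bounds : ∀ n, 1 ≤ n → ENNReal.ofReal ε ≤ annMod (F.U n) (F.V n) ∧
    annMod (F.U n) (F.V n) ≤ ENNReal.ofReal η ∧
    annMod (F.V n) (F.K n) ≤ ENNReal.ofReal (2 * η)
  /-- The disks `L` and `L'` around Julia bouquets. -/
  disks : ∀ n, F.CaseC d n →
    IsDisk (F.L (n + 1)) ∧ IsDisk (F.L' (n + 1)) ∧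
    F.L (n + 1) ⊆ piece d (F.c n) (F.α n) F.r 0 0 ∧
    F.L' (n + 1) ⊆ F.L (n + 1) ∧
    F.bouquet d n (n + 2) ⊆ F.L' (n + 1) ∧
    annMod (piece d (F.c n) (F.α n) F.r 0 0) (F.L (n + 1))
      ∈ Icc (ENNReal.ofReal (1 / C)) (ENNReal.ofReal C) ∧
    annMod (F.L (n + 1)) (F.L' (n + 1)) ∈ Icc (ENNReal.ofReal (1 / C)) (ENNReal.ofReal C) ∧
    annMod (F.L' (n + 1)) (F.bouquet d n (n + 2))
      ∈ Icc (ENNReal.ofReal (1 / C)) (ENNReal.ofReal C)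
  /-- The disks `E` that replace the equipotential disks at a level following the last case. -/
  disksE : ∀ n, F.CaseC d n →
    IsDisk (F.E (n + 1)) ∧
    F.E (n + 1) ⊆ F.S (n + 1) '' (F.pull n (F.L' (n + 1)) ∩ F.V (n + 1)) ∩
      insideEquipotential d (F.c (n + 1)) F.r ∧
    F.bouquet d (n + 1) (n + 2) ⊆ F.E (n + 1) ∧
    ENNReal.ofReal (1 / C) ≤ annMod (F.E (n + 1)) (F.bouquet d (n + 1) (n + 2))

end GlueSpace

end

/-!
Both moduli lie in one interval `[lo, hi]`, `0 < lo`, that depends only on `d`, `ε`, `η`, `κ`, `C`,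
so their quotient is at most `hi / lo`.

Away from the satellite-satellite case the annulus is `V n` minus a subset of `R n ⁻¹' V n`.  The
map `R n` covers `U n \ V n` with degree `d`, so a ring of modulus `m` around `V n` lifts to one of
modulus `m / d`: the modulus is at least `ε / d`.  It is at most `2 η` because the set removed
contains `K n`.

In the satellite-satellite case the lower bound is the quasiconformal distortion of `L \ L'`.  For
the upper bound let a ring of modulus `m` surround the pullback of `E` inside that of `L`.  The disk
`L` avoids the dividing fixed point of its plane, and the little Julia set `K n` joins `0` to the
preimage `b` of that point, hence crosses the ring.  Cut the ring into three rings of modulus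
`m / 3`.  If the middle one lies in `V n`, map it by the straightening: its image separates `0` and
the next dividing fixed point, of norm at least `1 / d`, from a point of norm at most `2`, and the
length-area inequality bounds `m`.  Otherwise the middle one leaves `V n`, so an outer third
separates `K n` from the complement of `V n` and `m / 3` is controlled by the lower bound `ε / d`.
-/

namespace GlueSpace

open scoped Real

/-! ### Winding numbers -/

/-- The loop `γ`, parametrized with period `2 π`, avoids `0` and winds `n` times around it. The
function `L` is a continuous logarithm of `γ`. -/
def Winds (γ : ℝ → ℂ) (n : ℤ) : Prop :=
  ∃ L : ℝ → ℂ, Continuous L ∧ (∀ t, Complex.exp (L t) = γ t) ∧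
    ∀ t, L (t + 2 * π) = L t + n * (2 * π * Complex.I)

theorem exists_eq_int_mul_of_exp_eq_one {X : Type*} [TopologicalSpace X] {s : Set X}
    (hs : IsPreconnected s) {f : X → ℂ} (hf : ContinuousOn f s)
    (h : ∀ x ∈ s, Complex.exp (f x) = 1) :
    ∃ n : ℤ, ∀ x ∈ s, f x = n * (2 * π * Complex.I) := by
  rcases s.eq_empty_or_nonempty with rfl | ⟨x₀, hx₀⟩
  · exact ⟨0, by simp⟩
  obtain ⟨n, hn⟩ := Complex.exp_eq_one_iff.1 (h x₀ hx₀)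
  refine ⟨n, fun x hx => (Complex.isCoveringMap_exp.constOn_of_comp hs hf ?_ hx hx₀).trans hn⟩
  exact fun a ha b hb => Subtype.ext ((h a ha).trans (h b hb).symm)

namespace Winds

variable {γ δ : ℝ → ℂ} {n m : ℤ}

theorem of_exp_eq {l : ℝ → ℂ} (hl : Continuous l) (hexp : ∀ t, Complex.exp (l t) = γ t)
    (hp : Function.Periodic γ (2 * π)) (h : l (2 * π) = l 0 + n * (2 * π * Complex.I)) :
    Winds γ n := by
  obtain ⟨k, hk⟩ := exists_eq_int_mul_of_exp_eq_one isPreconnected_univ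
    (f := fun t => l (t + 2 * π) - l t) (by fun_prop)
    fun t _ => by rw [Complex.exp_sub, hexp, hexp, hp, div_self (hexp t ▸ Complex.exp_ne_zero _)]
  refine ⟨l, hl, hexp, fun t => ?_⟩
  have hshift : l (t + 2 * π) - l t = l (0 + 2 * π) - l 0 :=
    (hk t (mem_univ t)).trans (hk 0 (mem_univ 0)).symm
  rw [zero_add, h] at hshift
  linear_combination hshift

theorem exists_of_periodic (hc : Continuous γ) (h0 : ∀ t, γ t ≠ 0)
    (hp : Function.Periodic γ (2 * π)) : ∃ n, Winds γ n := by
  have hsc : IsSimplyConnected (univ : Set ℝ) :=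
    have : ContractibleSpace (univ : Set ℝ) := (Homeomorph.Set.univ ℝ).contractibleSpace
    (inferInstance : SimplyConnectedSpace (univ : Set ℝ))
  obtain ⟨L, hL, hLexp⟩ := Complex.exists_continuousOn_eqOn_exp_comp hsc isOpen_univ
    hc.continuousOn (by rintro ⟨t, -, ht⟩; exact h0 t ht)
  rw [continuousOn_univ] at hL
  have hLexp (t : ℝ) : Complex.exp (L t) = γ t := hLexp (mem_univ t)
  obtain ⟨n, hn⟩ := Complex.exp_eq_exp_iff_exists_int.1 <|
    (hLexp (2 * π)).trans <| (by simpa using hp 0 : γ (2 * π) = γ 0).trans (hLexp 0).symm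
  exact ⟨n, of_exp_eq hL hLexp hp hn⟩

theorem ne_zero (h : Winds γ n) (t : ℝ) : γ t ≠ 0 := by
  obtain ⟨L, -, hL, -⟩ := h
  exact hL t ▸ Complex.exp_ne_zero _

theorem continuous (h : Winds γ n) : Continuous γ := by
  obtain ⟨L, hc, hL, -⟩ := h
  exact (Complex.continuous_exp.comp hc).congr hL

theorem periodic (h : Winds γ n) : Function.Periodic γ (2 * π) := fun t => by
  obtain ⟨L, -, hL, hp⟩ := h
  rw [← hL, ← hL, hp, Complex.exp_add, Complex.exp_int_mul_two_pi_mul_I, mul_one]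

theorem unique (h : Winds γ n) (h' : Winds γ m) : n = m := by
  obtain ⟨L, hc, hL, hp⟩ := h
  obtain ⟨L', hc', hL', hp'⟩ := h'
  obtain ⟨k, hk⟩ := exists_eq_int_mul_of_exp_eq_one (isPreconnected_univ (α := ℝ))
    (f := fun t => L t - L' t) (by fun_prop)
    fun t _ => by rw [Complex.exp_sub, hL, hL', div_self (hL t ▸ Complex.exp_ne_zero _)]
  have hk0 := hk 0 (mem_univ _)
  have hk1 := hk (0 + 2 * π) (mem_univ _)
  rw [hp, hp'] at hk1
  have hmul : ((n : ℂ) - m) * (2 * π * Complex.I) = 0 := by linear_combination hk1 - hk0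
  exact_mod_cast sub_eq_zero.1 ((mul_eq_zero.1 hmul).resolve_right Complex.two_pi_I_ne_zero)

theorem mul (h : Winds γ n) (h' : Winds δ m) : Winds (fun t => γ t * δ t) (n + m) := by
  obtain ⟨L, hc, hL, hp⟩ := h
  obtain ⟨L', hc', hL', hp'⟩ := h'
  refine ⟨fun t => L t + L' t, by fun_prop, fun t => by rw [Complex.exp_add, hL, hL'],
    fun t => ?_⟩
  simp only [hp, hp']
  push_cast
  ring

theorem pow (h : Winds γ n) (k : ℕ) : Winds (fun t => γ t ^ k) (k * n) := by
  obtain ⟨L, hc, hL, hp⟩ := h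
  refine ⟨fun t => k * L t, by fun_prop, fun t => by rw [Complex.exp_nat_mul, hL], fun t => ?_⟩
  simp only [hp]
  push_cast
  ring

theorem comp_mul (h : Winds γ n) (k : ℕ) : Winds (fun t => γ (k * t)) (k * n) := by
  obtain ⟨L, hc, hL, hp⟩ := h
  have hshift (j : ℕ) (s : ℝ) : L (s + j * (2 * π)) = L s + j * n * (2 * π * Complex.I) := by
    induction j with
    | zero => simp
    | succ j ih =>
      rw [show s + ((j + 1 : ℕ) : ℝ) * (2 * π) = s + j * (2 * π) + 2 * π by push_cast; ring, hp, ih]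
      push_cast
      ring
  refine ⟨fun t => L (k * t), by fun_prop, fun t => hL _, fun t => ?_⟩
  simp only [mul_add, hshift]
  push_cast
  ring

theorem exp_comp {l : ℝ → ℂ} (hl : Continuous l) (hp : Function.Periodic l (2 * π)) :
    Winds (fun t => Complex.exp (l t)) 0 :=
  ⟨l, hl, fun _ => rfl, fun t => by simp [hp t]⟩

theorem const {c : ℂ} (hc : c ≠ 0) : Winds (fun _ => c) 0 :=
  ⟨fun _ => Complex.log c, continuous_const, fun _ => Complex.exp_log hc, by simp⟩

theorem exp_vertical (s : ℝ) : Winds (fun t => Complex.exp (s + t * Complex.I)) 1 :=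
  ⟨fun t => s + t * Complex.I, by fun_prop, fun _ => rfl, fun t => by push_cast; ring⟩

theorem of_norm_sub_lt (h : Winds γ n) (hc : Continuous δ) (hp : Function.Periodic δ (2 * π))
    (hd : ∀ t, ‖δ t - γ t‖ < ‖γ t‖) : Winds δ n := by
  have h0 := h.ne_zero
  have hslit (t : ℝ) : δ t / γ t ∈ Complex.slitPlane := by
    rw [show δ t / γ t = 1 + (δ t - γ t) / γ t by field_simp [h0 t]; ring]
    apply Complex.mem_slitPlane_of_norm_lt_one
    rw [norm_div, div_lt_one (norm_pos_iff.2 (h0 t))]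
    exact hd t
  have hquot : Winds (fun t => Complex.exp (Complex.log (δ t / γ t))) 0 :=
    exp_comp ((hc.div h.continuous h0).clog hslit) fun t => by rw [hp, h.periodic]
  convert h.mul hquot using 2 with t
  · rw [Complex.exp_log (Complex.slitPlane_ne_zero (hslit t)), mul_div_cancel₀ _ (h0 t)]
  · rw [add_zero]

theorem eventually_of_continuous {X : Type*} [TopologicalSpace X] {H : X → ℝ → ℂ}
    (hc : Continuous fun q : X × ℝ => H q.1 q.2) (hp : ∀ x, Function.Periodic (H x) (2 * π))
    {x : X} (h : Winds (H x) n) : ∀ᶠ y in 𝓝 x, Winds (H y) n := by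
  have hnear : ∀ᶠ y in 𝓝 x, ∀ t ∈ Icc 0 (2 * π), ‖H y t - H x t‖ < ‖H x t‖ := by
    refine isCompact_Icc.eventually_forall_of_forall_eventually fun t _ => ?_
    have hx : Continuous fun q : X × ℝ => H x q.2 :=
      hc.comp (by fun_prop : Continuous fun q : X × ℝ => (x, q.2))
    exact (hc.sub hx).norm.continuousAt.eventually_lt hx.norm.continuousAt
      (by simpa using h.ne_zero t)
  filter_upwards [hnear] with y hy
  refine h.of_norm_sub_lt (hc.comp (by fun_prop : Continuous fun t => (y, t))) (hp y) fun t => ?_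
  obtain ⟨s, hs, hst⟩ := Function.Periodic.exists_mem_Ico₀
    (f := fun t => (H y t, H x t)) (fun t => Prod.ext (hp y t) (hp x t)) Real.two_pi_pos t
  obtain ⟨hy_eq, hx_eq⟩ := Prod.ext_iff.1 hst
  simp only at hy_eq hx_eq
  rw [hy_eq, hx_eq]
  exact hy s (Ico_subset_Icc_self hs)

theorem of_continuous {X : Type*} [TopologicalSpace X] [PreconnectedSpace X] {H : X → ℝ → ℂ}
    (hc : Continuous fun q : X × ℝ => H q.1 q.2) (h0 : ∀ x t, H x t ≠ 0)
    (hp : ∀ x, Function.Periodic (H x) (2 * π)) {x : X} (h : Winds (H x) n) (y : X) :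
    Winds (H y) n := by
  have hex (x : X) : ∃ n, Winds (H x) n :=
    exists_of_periodic (hc.comp (by fun_prop : Continuous fun t => (x, t))) (h0 x) (hp x)
  choose N hN using hex
  have hconst : IsLocallyConstant N := (IsLocallyConstant.iff_eventually_eq N).2 fun x =>
    (eventually_of_continuous hc hp (hN x)).mono fun y hy => (hN y).unique hy
  rw [h.unique (hN x), hconst.apply_eq_of_preconnectedSpace x y]
  exact hN y

theorem of_homotopy {X : Type*} [TopologicalSpace X] {s : Set X} (hs : IsPreconnected s)
    {H : X → ℝ → ℂ} (hc : ContinuousOn (fun q : X × ℝ => H q.1 q.2) (s ×ˢ univ))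
    (h0 : ∀ x ∈ s, ∀ t, H x t ≠ 0) (hp : ∀ x ∈ s, Function.Periodic (H x) (2 * π))
    {x y : X} (hx : x ∈ s) (hy : y ∈ s) (h : Winds (H x) n) : Winds (H y) n := by
  have := isPreconnected_iff_preconnectedSpace.1 hs
  exact of_continuous (X := s) (H := fun x => H x)
    (hc.comp_continuous (f := fun q : s × ℝ => ((q.1 : X), q.2)) (by fun_prop)
      fun q => ⟨q.1.2, mem_univ _⟩)
    (fun x => h0 x x.2) (fun x => hp x x.2) (x := ⟨x, hx⟩) h ⟨y, hy⟩

theorem sub_of_isPreconnected (hc : Continuous γ) (hp : Function.Periodic γ (2 * π)) {Z : Set ℂ}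
    (hZ : IsPreconnected Z) (hd : ∀ t, γ t ∉ Z) {x y : ℂ} (hx : x ∈ Z) (hy : y ∈ Z)
    (h : Winds (fun t => γ t - x) n) : Winds (fun t => γ t - y) n :=
  of_homotopy hZ (H := fun x t => γ t - x) (by fun_prop)
    (fun _ hx t h => hd t (sub_eq_zero.1 h ▸ hx)) (fun x _ t => congrArg (· - x) (hp t)) hx hy h

theorem sub_of_not_isBounded (hc : Continuous γ) (hp : Function.Periodic γ (2 * π)) {Z : Set ℂ}
    (hZ : IsPreconnected Z) (hd : ∀ t, γ t ∉ Z) (hb : ¬ Bornology.IsBounded Z) {x : ℂ}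
    (hx : x ∈ Z) : Winds (fun t => γ t - x) 0 := by
  obtain ⟨C, hC⟩ := isBounded_iff_forall_norm_le.1 <|
    hp.isBounded_of_continuous Real.two_pi_pos.ne' hc
  obtain ⟨y, hy, hyC⟩ : ∃ y ∈ Z, C < ‖y‖ := by
    by_contra! h
    exact hb (isBounded_iff_forall_norm_le.2 ⟨C, h⟩)
  have hlt (t : ℝ) : ‖γ t‖ < ‖y‖ := (hC _ (mem_range_self t)).trans_lt hyC
  refine sub_of_isPreconnected hc hp hZ hd hy hx ?_
  have hy0 : -y ≠ 0 := neg_ne_zero.2 (norm_pos_iff.1 ((norm_nonneg _).trans_lt (hlt 0)))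
  refine (const hy0).of_norm_sub_lt (by fun_prop) (fun t => by rw [hp]) fun t => ?_
  simpa using hlt t

theorem comp_circleMap {G : ℂ → ℂ} {x : ℂ} {R : ℝ} (hR : 0 ≤ R)
    (hG : ContinuousOn G (Metric.closedBall x R)) (h0 : ∀ z ∈ Metric.closedBall x R, G z ≠ 0) :
    Winds (fun t => G (circleMap x R t)) 0 := by
  have hmem : ∀ r ∈ Icc 0 R, ∀ t, circleMap x r t ∈ Metric.closedBall x R := fun r hr t => by
    simp [circleMap, abs_of_nonneg hr.1, hr.2]
  refine of_homotopy (s := Icc 0 R) isPreconnected_Icc (H := fun r t => G (circleMap x r t))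
    ?_ (fun r hr t => h0 _ (hmem r hr t)) (fun r _ t => congrArg G (periodic_circleMap x r t))
    (left_mem_Icc.2 hR) (right_mem_Icc.2 hR) ?_
  · refine hG.comp (f := fun q : ℝ × ℝ => circleMap x q.1 q.2) ?_ fun q hq => hmem _ hq.1 _
    unfold circleMap
    fun_prop
  · simpa using const (h0 x (by simpa using hR))

end Winds

/-! ### Separation in the plane -/

theorem exists_isClopen_subset_of_connectedComponent_subset {X : Type*} [TopologicalSpace X]
    [T2Space X] [CompactSpace X] {x : X} {N : Set X} (hN : IsOpen N)
    (h : connectedComponent x ⊆ N) : ∃ s, IsClopen s ∧ x ∈ s ∧ s ⊆ N := by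
  rw [connectedComponent_eq_iInter_isClopen] at h
  have : Nonempty {s : Set X // IsClopen s ∧ x ∈ s} := ⟨⟨univ, isClopen_univ, mem_univ _⟩⟩
  have hdir : Directed (· ⊇ ·) fun s : {s : Set X // IsClopen s ∧ x ∈ s} => s.1 := by
    rintro ⟨s, hs, hxs⟩ ⟨t, ht, hxt⟩
    exact ⟨⟨s ∩ t, hs.inter ht, hxs, hxt⟩, inter_subset_left, inter_subset_right⟩
  obtain ⟨⟨s, hs, hxs⟩, hsN⟩ := exists_subset_nhds_of_compactSpace hdir
    (fun s => s.2.1.isClosed) fun y hy => hN.mem_nhds (h hy)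
  exact ⟨s, hs, hxs, hsN⟩

theorem exists_isCompact_isClosed_sdiff {α : Type*} [TopologicalSpace α] [T2Space α]
    {X N : Set α} (hX : IsClosed X) (hN : IsOpen N) (hNc : IsCompact (closure N)) {x : α}
    (hxX : x ∈ X) (hxN : x ∈ N)
    (h : ∀ S, IsPreconnected S → S ⊆ X ∩ closure N → x ∈ S → S ⊆ N) :
    ∃ Q, IsCompact Q ∧ x ∈ Q ∧ Q ⊆ X ∩ N ∧ IsClosed (X \ Q) := by
  have : CompactSpace ↥(X ∩ closure N) := isCompact_iff_compactSpace.1 (hNc.inter_left hX)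
  obtain ⟨s, hs, hxs, hsN⟩ := exists_isClopen_subset_of_connectedComponent_subset
    (x := (⟨x, hxX, subset_closure hxN⟩ : ↥(X ∩ closure N)))
    (hN.preimage continuous_subtype_val) <| image_subset_iff.1 <|
      h _ (isPreconnected_connectedComponent.image _ continuous_subtype_val.continuousOn)
        (by rintro _ ⟨y, -, rfl⟩; exact y.2) ⟨_, mem_connectedComponent, rfl⟩
  have hsN : Subtype.val '' s ⊆ N := image_subset_iff.2 hsN
  refine ⟨Subtype.val '' s, hs.isClosed.isCompact.image continuous_subtype_val, ⟨_, hxs, rfl⟩,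
    fun y hy => ⟨?_, hsN hy⟩, ?_⟩
  · obtain ⟨y, -, rfl⟩ := hy
    exact y.2.1
  have hdiff : X \ Subtype.val '' s = Subtype.val '' sᶜ ∪ (X \ N) := by
    ext y
    constructor
    · rintro ⟨hyX, hy⟩
      by_cases hyN : y ∈ N
      · exact Or.inl ⟨⟨y, hyX, subset_closure hyN⟩, fun h => hy ⟨_, h, rfl⟩, rfl⟩
      · exact Or.inr ⟨hyX, hyN⟩
    · rintro (⟨y, hy, rfl⟩ | ⟨hyX, hyN⟩)
      · exact ⟨y.2.1, fun ⟨z, hz, hzy⟩ => hy (Subtype.ext hzy ▸ hz)⟩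
      · exact ⟨hyX, fun h => hyN (hsN h)⟩
  rw [hdiff]
  exact (hs.compl.isClosed.isCompact.image continuous_subtype_val).isClosed.union (hX.sdiff hN)

theorem exists_isOpen_mem_frontier_subset {O : Set ℂ} (hO : IsOpen O) {x : ℂ} (hx : x ∉ O)
    (hb : Bornology.IsBounded (connectedComponentIn Oᶜ x)) :
    ∃ Ω, IsOpen Ω ∧ Bornology.IsBounded Ω ∧ x ∈ Ω ∧ frontier Ω ⊆ O := by
  obtain ⟨R, hR⟩ := hb.subset_ball x
  obtain ⟨Q, hQ, hxQ, -, hQc⟩ := exists_isCompact_isClosed_sdiff hO.isClosed_compl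
    (Metric.isOpen_ball (x := x) (ε := R)) Metric.isBounded_ball.isCompact_closure hx
    (hR (mem_connectedComponentIn hx)) fun S hS hSX hxS =>
      (hS.subset_connectedComponentIn hxS (hSX.trans inter_subset_left)).trans hR
  obtain ⟨Ω, hΩ, hQΩ, hΩc, hΩk⟩ := exists_open_between_and_isCompact_closure hQ hQc.isOpen_compl
    fun y hy h => h.2 hy
  refine ⟨Ω, hΩ, hΩk.isBounded.subset subset_closure, hQΩ hxQ, fun y hy => ?_⟩
  rw [hΩ.frontier_eq] at hy
  by_contra hyO
  exact hΩc hy.1 ⟨hyO, fun h => hy.2 (hQΩ h)⟩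

theorem not_exists_log_sub_on_frontier {Ω : Set ℂ} (hb : Bornology.IsBounded Ω) {x : ℂ}
    (hx : x ∈ Ω) : ¬ ∃ F : ℂ → ℂ, ContinuousOn F (frontier Ω) ∧
      ∀ z ∈ frontier Ω, Complex.exp (F z) = z - x := by
  classical
  rintro ⟨F, hF, hFexp⟩
  -- Extending `F` over `Ω` makes `z - x` nonvanishing on the plane without changing it on large
  -- circles, where it winds once.
  obtain ⟨g, hg⟩ := ContinuousMap.exists_restrict_eq (isClosed_frontier (s := Ω))
    ⟨(frontier Ω).domRestrict F, continuousOn_iff_continuous_domRestrict.1 hF⟩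
  have hgF : ∀ z ∈ frontier Ω, g z = F z := fun z hz => congrArg (fun f => f ⟨z, hz⟩) hg
  let H : ℂ → ℂ := Ω.piecewise (fun z => Complex.exp (g z)) (fun z => z - x)
  have hH : Continuous H :=
    continuous_piecewise (fun z hz => by rw [hgF z hz, hFexp z hz]) (by fun_prop) (by fun_prop)
  have hH_out : ∀ z ∉ Ω, H z = z - x := fun z hz => piecewise_eq_of_notMem _ _ _ hz
  have hH0 (z : ℂ) : H z ≠ 0 := by
    by_cases hz : z ∈ Ω
    · simp [H, hz]
    · rw [hH_out z hz, sub_ne_zero]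
      exact fun h => hz (h ▸ hx)
  obtain ⟨r, hr, hΩr⟩ := hb.subset_ball_lt 0 x
  have hwind0 := Winds.comp_circleMap (x := x) hr.le hH.continuousOn fun z _ => hH0 z
  have hwind1 : Winds (fun t => H (circleMap x r t)) 1 := by
    convert Winds.exp_vertical (Real.log r) using 2 with t
    rw [hH_out _ fun h => by simpa [circleMap, abs_of_pos hr] using hΩr h, Complex.exp_add,
      ← Complex.ofReal_exp, Real.exp_log hr]
    simp [circleMap]
  exact absurd (hwind0.unique hwind1) (by norm_num)

theorem not_isBounded_of_continuousOn_log_sub {O : Set ℂ} (hO : IsOpen O) {x : ℂ} (hx : x ∉ O)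
    {F : ℂ → ℂ} (hF : ContinuousOn F O) (hFexp : ∀ z ∈ O, Complex.exp (F z) = z - x) :
    ¬ Bornology.IsBounded (connectedComponentIn Oᶜ x) := fun hb =>
  let ⟨_, _, hΩ, hxΩ, hfr⟩ := exists_isOpen_mem_frontier_subset hO hx hb
  not_exists_log_sub_on_frontier hΩ hxΩ ⟨F, hF.mono hfr, fun z hz => hFexp z (hfr hz)⟩

/-- A plane set is full if no component of its complement is bounded. Unlike disks, full sets
need be neither open nor connected. -/
def IsFull (V : Set ℂ) : Prop := ∀ x ∉ V, ¬ Bornology.IsBounded (connectedComponentIn Vᶜ x)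

theorem IsDisk.isFull {V : Set ℂ} (hV : IsDisk V) : IsFull V := by
  intro x hx
  obtain ⟨F, hF, hFexp⟩ := Complex.exists_continuousOn_eqOn_exp_comp hV.2 hV.1
    (g := fun z => z - x) (by fun_prop)
    (by rintro ⟨z, hz, h⟩; exact hx (sub_eq_zero.1 h ▸ hz))
  exact not_isBounded_of_continuousOn_log_sub hV.1 hx hF fun z hz => hFexp hz

theorem IsFull.connectedComponentIn_compl_subset {V A : Set ℂ} (hV : IsFull V) (hAV : A ⊆ V)
    {x : ℂ} (hx : x ∈ surrounded A) : connectedComponentIn Aᶜ x ⊆ V := by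
  intro y hy
  by_contra hyV
  refine hV y hyV (hx.2.subset ?_)
  rw [connectedComponentIn_eq hy]
  exact connectedComponentIn_mono _ (compl_subset_compl.2 hAV)

theorem IsFull.surrounded_subset {V A : Set ℂ} (hV : IsFull V) (hAV : A ⊆ V) :
    surrounded A ⊆ V :=
  fun _ hx => hV.connectedComponentIn_compl_subset hAV hx (mem_connectedComponentIn hx.1)

theorem isClosed_connectedComponentIn {α : Type*} [TopologicalSpace α] {X : Set α}
    (hX : IsClosed X) (x : α) : IsClosed (connectedComponentIn X x) := by
  by_cases hx : x ∈ X
  · exact isClosed_of_closure_subset <|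
      isPreconnected_connectedComponentIn.closure.subset_connectedComponentIn
        (subset_closure (mem_connectedComponentIn hx))
        (closure_minimal (connectedComponentIn_subset _ _) hX)
  · rw [connectedComponentIn_eq_empty hx]
    exact isClosed_empty

theorem isBounded_connectedComponentIn_compl {V A : Set ℂ} (hV : IsOpen V) (hA : IsOpen A) {x : ℂ}
    (hx : x ∈ V \ A) (hC : IsCompact (connectedComponentIn (V \ A) x)) :
    Bornology.IsBounded (connectedComponentIn Aᶜ x) := by
  obtain ⟨N, hN, hCN, hNV, hNc⟩ := exists_open_between_and_isCompact_closure hC hV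
    ((connectedComponentIn_subset _ _).trans sdiff_subset)
  have hsub : ∀ S : Set ℂ, IsPreconnected S → S ⊆ Aᶜ ∩ closure N → x ∈ S → S ⊆ N := by
    intro S hS hSX hxS
    have hSV : S ⊆ V \ A := fun y hy => ⟨hNV (hSX hy).2, (hSX hy).1⟩
    exact (hS.subset_connectedComponentIn hxS hSV).trans hCN
  obtain ⟨Q, hQ, hxQ, -, hQc⟩ := exists_isCompact_isClosed_sdiff hA.isClosed_compl hN hNc hx.2
    (hCN (mem_connectedComponentIn hx)) hsub
  refine hQ.isBounded.subset ?_
  refine (isPreconnected_iff_subset_of_disjoint_closed.1 isPreconnected_connectedComponentIn Q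
    (Aᶜ \ Q) hQ.isClosed hQc ?_ (by ext; simp)).resolve_right fun h =>
      (h (mem_connectedComponentIn hx.2)).2 hxQ
  rw [union_sdiff_self]
  exact (connectedComponentIn_subset _ _).trans subset_union_right

theorem mem_surrounded_iff_isCompact {V A : Set ℂ} (hV : IsOpen V) (hf : IsFull V) (hA : IsOpen A)
    (hAV : A ⊆ V) {x : ℂ} (hx : x ∈ V \ A) :
    x ∈ surrounded A ↔ IsCompact (connectedComponentIn (V \ A) x) := by
  refine ⟨fun h => ?_, fun hC => ⟨hx.2, isBounded_connectedComponentIn_compl hV hA hx hC⟩⟩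
  have heq : connectedComponentIn (V \ A) x = connectedComponentIn Aᶜ x := by
    refine (connectedComponentIn_mono _ fun y hy => hy.2).antisymm ?_
    exact isPreconnected_connectedComponentIn.subset_connectedComponentIn
      (mem_connectedComponentIn hx.2) fun y hy =>
        ⟨hf.connectedComponentIn_compl_subset hAV h hy, connectedComponentIn_subset _ _ hy⟩
  rw [heq]
  exact Metric.isCompact_of_isClosed_isBounded
    (isClosed_connectedComponentIn hA.isClosed_compl x) h.2

/-! ### Open embeddings -/

theorem image_connectedComponentIn_of_leftInvOn {α β : Type*} [TopologicalSpace α]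
    [TopologicalSpace β] {f : α → β} {g : β → α} {s : Set α} (hf : ContinuousOn f s)
    (hg : ContinuousOn g (f '' s)) (hgf : LeftInvOn g f s) {x : α} (hx : x ∈ s) :
    f '' connectedComponentIn s x = connectedComponentIn (f '' s) (f x) := by
  refine (hf.image_connectedComponentIn_subset hx).antisymm fun y hy => ?_
  have hback := hg.image_connectedComponentIn_subset (mem_image_of_mem f hx)
  rw [hgf.image_image, hgf hx] at hback
  obtain ⟨z, hz, rfl⟩ := connectedComponentIn_subset _ _ hy
  exact ⟨z, by simpa only [hgf hz] using hback (mem_image_of_mem g hy), rfl⟩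

/-- `h` restricts to an open embedding of `V`; nothing is said about `h` outside `V`. -/
structure OpenEmb (h : ℂ → ℂ) (V : Set ℂ) : Prop where
  continuousOn : ContinuousOn h V
  injOn : InjOn h V
  isOpen_image : ∀ O ⊆ V, IsOpen O → IsOpen (h '' O)

namespace OpenEmb

variable {h : ℂ → ℂ} {V : Set ℂ}

theorem mono {O : Set ℂ} (H : OpenEmb h V) (hO : O ⊆ V) : OpenEmb h O :=
  ⟨H.continuousOn.mono hO, H.injOn.mono hO, fun O' h' => H.isOpen_image O' (h'.trans hO)⟩

theorem continuousOn_invFunOn (hV : IsOpen V) (H : OpenEmb h V) :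
    ContinuousOn (Function.invFunOn h V) (h '' V) := by
  refine (continuousOn_open_iff (H.isOpen_image V Subset.rfl hV)).2 fun O hO => ?_
  have hinv := H.injOn.leftInvOn_invFunOn
  convert H.isOpen_image (V ∩ O) inter_subset_left (hV.inter hO) using 1
  ext y
  constructor
  · rintro ⟨⟨z, hz, rfl⟩, hzO⟩
    exact ⟨z, ⟨hz, hinv hz ▸ hzO⟩, rfl⟩
  · rintro ⟨z, ⟨hz, hzO⟩, rfl⟩
    exact ⟨⟨z, hz, rfl⟩, by rwa [mem_preimage, hinv hz]⟩

theorem isSimplyConnected_image (hV : IsOpen V) (H : OpenEmb h V) :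
    IsSimplyConnected (h '' V) ↔ IsSimplyConnected V := by
  have he : Topology.IsOpenEmbedding (V.domRestrict h) := by
    refine .of_continuous_injective_isOpenMap
      (continuousOn_iff_continuous_domRestrict.1 H.continuousOn) H.injOn.injective fun O hO => ?_
    have himage : V.domRestrict h '' O = h '' (Subtype.val '' O) := by
      rw [image_image]
      rfl
    rw [himage]
    refine H.isOpen_image _ ?_ (hV.isOpenMap_subtype_val O hO)
    rintro _ ⟨y, -, rfl⟩
    exact y.2
  have huniv := he.isEmbedding.isSimplyConnected_image (s := univ)
  rw [image_univ, range_domRestrict] at huniv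
  rw [huniv]
  exact (Homeomorph.Set.univ V).toHomotopyEquiv.simplyConnectedSpace_iff

theorem isDisk_image (hV : IsDisk V) (H : OpenEmb h V) : IsDisk (h '' V) :=
  ⟨H.isOpen_image V Subset.rfl hV.1, (H.isSimplyConnected_image hV.1).2 hV.2⟩

theorem mem_surrounded_iff {A : Set ℂ} (hV : IsDisk V) (H : OpenEmb h V) (hA : IsOpen A)
    (hAV : A ⊆ V) {x : ℂ} (hx : x ∈ V) : h x ∈ surrounded (h '' A) ↔ x ∈ surrounded A := by
  by_cases hxA : x ∈ A
  · exact iff_of_false (fun h' => h'.1 ⟨x, hxA, rfl⟩) fun h' => h'.1 hxA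
  have hV' := H.isDisk_image hV
  have hinv := H.injOn.leftInvOn_invFunOn
  have hk := H.continuousOn_invFunOn hV.1
  have himg : h '' (V \ A) = h '' V \ h '' A := H.injOn.image_sdiff_subset hAV
  rw [mem_surrounded_iff_isCompact hV.1 hV.isFull hA hAV ⟨hx, hxA⟩,
    mem_surrounded_iff_isCompact hV'.1 hV'.isFull (H.isOpen_image A hAV hA) (image_mono hAV)
      (himg ▸ ⟨x, ⟨hx, hxA⟩, rfl⟩), ← himg,
    ← image_connectedComponentIn_of_leftInvOn (H.continuousOn.mono sdiff_subset)
      (hk.mono (image_mono sdiff_subset)) (hinv.mono sdiff_subset) ⟨hx, hxA⟩]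
  have hCV : connectedComponentIn (V \ A) x ⊆ V :=
    (connectedComponentIn_subset _ _).trans sdiff_subset
  refine ⟨fun hc => ?_, fun hc => hc.image_of_continuousOn (H.continuousOn.mono hCV)⟩
  rw [← (hinv.mono hCV).image_image]
  exact hc.image_of_continuousOn (hk.mono (image_mono hCV))

end OpenEmb

namespace OrientationPreservingOn

variable {D : Set ℂ} {h : ℂ → ℂ}

theorem winds (ho : OrientationPreservingOn D h) (hc : ContinuousOn h D) (hi : InjOn h D) {z : ℂ}
    {r : ℝ} (hr : 0 < r) (hD : Metric.closedBall z r ⊆ D) :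
    Winds (fun t => h (circleMap z r t) - h z) 1 := by
  obtain ⟨θ, hθ, hθ1, hpolar⟩ := ho z r hr hD
  have hmem (t : ℝ) : circleMap z r t ∈ D := hD (by simp [circleMap, abs_of_pos hr])
  have h0 (t : ℝ) : h (circleMap z r t) - h z ≠ 0 := by
    rw [sub_ne_zero]
    intro heq
    simpa [hr.ne'] using hi (hmem t) (hD (by simp [hr.le])) heq
  have hcont : Continuous fun t => h (circleMap z r t) - h z :=
    (hc.comp_continuous (continuous_circleMap z r) hmem).sub continuous_const
  have hper : Function.Periodic (fun t => h (circleMap z r t) - h z) (2 * π) :=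
    fun t => congrArg (h · - h z) (periodic_circleMap z r t)
  refine Winds.of_exp_eq (l := fun t =>
    Real.log ‖h (circleMap z r t) - h z‖ + θ (t / (2 * π)) * Complex.I) ?_ (fun t => ?_) hper ?_
  · have := hcont.norm.log fun t => norm_ne_zero_iff.2 (h0 t)
    fun_prop
  · have hpolar_t := hpolar (t / (2 * π))
    rw [mul_div_cancel₀ t Real.two_pi_pos.ne'] at hpolar_t
    rw [Complex.exp_add, ← Complex.ofReal_exp, Real.exp_log (norm_pos_iff.2 (h0 t)), ← hpolar_t]
  · have hend := hper 0
    simp only [zero_add] at hend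
    simp only [hend, div_self Real.two_pi_pos.ne', zero_div, sub_eq_iff_eq_add.1 hθ1]
    push_cast
    ring

theorem openEmb (ho : OrientationPreservingOn D h) (hc : ContinuousOn h D) (hi : InjOn h D) :
    OpenEmb h D := by
  refine ⟨hc, hi, fun O hOD hO => isOpen_iff_mem_nhds.2 ?_⟩
  rintro _ ⟨z, hz, rfl⟩
  obtain ⟨r, hr, hrO⟩ := Metric.nhds_basis_closedBall.mem_iff.1 (hO.mem_nhds hz)
  have hcircle : Continuous fun t => h (circleMap z r t) :=
    (hc.mono hOD).comp_continuous (continuous_circleMap z r) fun t =>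
      hrO (by simp [circleMap, abs_of_pos hr])
  have hnear := Winds.eventually_of_continuous (H := fun w t => h (circleMap z r t) - w)
    ((hcircle.comp continuous_snd).sub continuous_fst)
    (fun w t => congrArg (h · - w) (periodic_circleMap z r t))
    (ho.winds hc hi hr (hrO.trans hOD))
  filter_upwards [hnear] with w hw
  by_contra hwO
  have hwind0 := Winds.comp_circleMap (G := fun y => h y - w) hr.le
    ((hc.mono (hrO.trans hOD)).sub continuousOn_const)
    fun y hy h0 => hwO ⟨y, hrO hy, sub_eq_zero.1 h0⟩
  exact one_ne_zero (hw.unique hwind0)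

end OrientationPreservingOn

theorem IsQC.openEmb {K : ℝ} {D : Set ℂ} {h : ℂ → ℂ} (hh : IsQC K D h) : OpenEmb h D :=
  hh.orientation.openEmb hh.continuousOn hh.injOn

/-! ### Injective holomorphic maps -/

theorem exists_analyticAt_pow_eq {u : ℂ → ℂ} {z : ℂ} (hu : AnalyticAt ℂ u z) (h0 : u z ≠ 0)
    {n : ℕ} (hn : n ≠ 0) :
    ∃ v : ℂ → ℂ, AnalyticAt ℂ v z ∧ v z ≠ 0 ∧ ∀ᶠ w in 𝓝 z, v w ^ n = u w := by
  obtain ⟨c, hc⟩ := IsAlgClosed.exists_pow_nat_eq (u z) (Nat.pos_of_ne_zero hn)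
  have hc0 : c ≠ 0 := by
    rintro rfl
    exact h0 (by rw [← hc, zero_pow hn])
  have hslit : u z / u z ∈ Complex.slitPlane := by
    rw [div_self h0]
    exact Complex.one_mem_slitPlane
  refine ⟨fun w => c * Complex.exp (Complex.log (u w / u z) / n), analyticAt_const.mul
    ((hu.div analyticAt_const h0).clog hslit).div_const.cexp,
    mul_ne_zero hc0 (Complex.exp_ne_zero _), ?_⟩
  filter_upwards [hu.continuousAt.eventually_ne h0] with w hw
  rw [mul_pow, hc, ← Complex.exp_nat_mul, mul_div_cancel₀ _ (Nat.cast_ne_zero.2 hn),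
    Complex.exp_log (div_ne_zero hw h0), mul_div_cancel₀ _ h0]

theorem exists_analyticAt_sub_eq_pow {f : ℂ → ℂ} {z : ℂ} (hf : AnalyticAt ℂ f z)
    (hc : ¬ ∀ᶠ w in 𝓝 z, f w = f z) :
    ∃ (n : ℕ) (g : ℂ → ℂ), n ≠ 0 ∧ AnalyticAt ℂ g z ∧ g z = 0 ∧ deriv g z ≠ 0 ∧
      ∀ᶠ w in 𝓝 z, f w - f z = g w ^ n := by
  obtain ⟨n, u, hu, hu0, hfu⟩ :=
    (hf.sub analyticAt_const).exists_eventuallyEq_pow_smul_nonzero_iff.2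
      (show ¬ ∀ᶠ w in 𝓝 z, f w - f z = 0 by simpa only [sub_eq_zero] using hc)
  have hn : n ≠ 0 := by
    rintro rfl
    exact hu0 (by simpa using hfu.self_of_nhds.symm)
  obtain ⟨v, hv, hv0, hvu⟩ := exists_analyticAt_pow_eq hu hu0 hn
  refine ⟨n, fun w => (w - z) * v w, hn, (analyticAt_id.sub analyticAt_const).mul hv, by simp,
    ?_, ?_⟩
  · have hd := ((hasDerivAt_id z).sub_const z).mul hv.differentiableAt.hasDerivAt
    rw [show deriv (fun w => (w - z) * v w) z = v z from
      (hd.congr_deriv (by simp)).deriv]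
    exact hv0
  · filter_upwards [hfu, hvu] with w hw hvw
    rw [mul_pow, hvw]
    exact hw

theorem deriv_ne_zero_of_injOn {f : ℂ → ℂ} {U : Set ℂ} (hU : IsOpen U)
    (hf : DifferentiableOn ℂ f U) (hi : InjOn f U) {z : ℂ} (hz : z ∈ U) : deriv f z ≠ 0 := by
  intro hd
  have hfz : AnalyticAt ℂ f z := hf.analyticAt (hU.mem_nhds hz)
  have hnonconst : ¬ ∀ᶠ w in 𝓝 z, f w = f z := fun h => by
    have hfalse : ∀ᶠ _ in 𝓝[≠] z, False := by
      filter_upwards [h.filter_mono nhdsWithin_le_nhds, self_mem_nhdsWithin,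
        nhdsWithin_le_nhds (hU.mem_nhds hz)] with w hw hwz hwU
      exact hwz (hi hwU hz hw)
    exact hfalse.exists.choose_spec
  obtain ⟨n, g, hn0, hg, hg0, hgd, hfg⟩ := exists_analyticAt_sub_eq_pow hfz hnonconst
  have hn1 : n ≠ 1 := by
    rintro rfl
    have hfg' : f =ᶠ[𝓝 z] fun w => g w + f z :=
      hfg.mono fun w hw => by rw [← sub_eq_iff_eq_add, hw, pow_one]
    rw [hfg'.deriv_eq, deriv_add_const] at hd
    exact hgd hd
  -- Otherwise `f` identifies the two preimages by `g` of `ζ` and `ω ζ`, with `ω ^ n = 1`.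
  set ω : ℂ := Complex.exp (2 * π * Complex.I / n)
  have hω : IsPrimitiveRoot ω n := Complex.isPrimitiveRoot_exp n hn0
  have himage : g '' {w | w ∈ U ∧ f w - f z = g w ^ n} ∈ 𝓝 (0 : ℂ) := by
    rw [← hg0, ← hg.hasStrictDerivAt.map_nhds_eq hgd]
    exact image_mem_map ((hU.eventually_mem hz).and hfg)
  have hrotate : Tendsto (ω * ·) (𝓝 0) (𝓝 0) := by
    simpa using (continuous_const_mul ω).tendsto 0
  obtain ⟨ζ, ⟨⟨w₁, ⟨hw₁U, hw₁⟩, rfl⟩, w₂, ⟨hw₂U, hw₂⟩, hw₂ζ⟩, hζ⟩ :=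
    Filter.nonempty_of_mem (inter_mem (nhdsWithin_le_nhds (inter_mem himage (hrotate himage)))
      (self_mem_nhdsWithin (a := (0 : ℂ)) (s := {0}ᶜ)))
  have heq : w₂ = w₁ := hi hw₂U hw₁U <| sub_left_inj.1 <|
    show f w₂ - f z = f w₁ - f z by rw [hw₂, hw₂ζ, mul_pow, hω.pow_eq_one, one_mul, hw₁]
  rw [heq] at hw₂ζ
  exact hω.ne_one (by lia) ((mul_eq_right₀ hζ).1 hw₂ζ.symm)

theorem map_nhds_eq_of_injOn {f : ℂ → ℂ} {U : Set ℂ} (hU : IsOpen U)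
    (hf : DifferentiableOn ℂ f U) (hi : InjOn f U) {z : ℂ} (hz : z ∈ U) :
    map f (𝓝 z) = 𝓝 (f z) :=
  (hf.analyticAt (hU.mem_nhds hz)).hasStrictDerivAt.map_nhds_eq
    (deriv_ne_zero_of_injOn hU hf hi hz)

theorem differentiableAt_of_lift {χ T G : ℂ → ℂ} {w : ℂ} (hT : ContinuousAt T w)
    (hχ : AnalyticAt ℂ χ (T w)) (hd : deriv χ (T w) ≠ 0) (hG : DifferentiableAt ℂ G w)
    (he : ∀ᶠ z in 𝓝 w, χ (T z) = G z) : DifferentiableAt ℂ T w := by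
  have hs := hχ.hasStrictDerivAt
  have hleft : ∀ᶠ y in 𝓝 (T w), hs.localInverse χ _ _ hd (χ y) = y :=
    HasStrictFDerivAt.eventually_left_inverse (hs.hasStrictFDerivAt_equiv hd)
  have hcomp : DifferentiableAt ℂ (fun z => hs.localInverse χ _ _ hd (G z)) w := by
    refine DifferentiableAt.fun_comp' w ?_ hG
    rw [← he.self_of_nhds]
    exact (hs.to_localInverse hd).hasDerivAt.differentiableAt
  refine hcomp.congr_of_eventuallyEq ?_
  filter_upwards [he, hT.eventually hleft] with z hz hinv
  rw [← hz, hinv]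

theorem differentiableAt_of_comp {χ F : ℂ → ℂ} {w : ℂ} (hχ : AnalyticAt ℂ χ w)
    (hd : deriv χ w ≠ 0) (hF : DifferentiableAt ℂ (fun z => F (χ z)) w) :
    DifferentiableAt ℂ F (χ w) := by
  have hs := hχ.hasStrictDerivAt
  have hright : ∀ᶠ y in 𝓝 (χ w), χ (hs.localInverse χ _ _ hd y) = y :=
    HasStrictFDerivAt.eventually_right_inverse (hs.hasStrictFDerivAt_equiv hd)
  have hinv : hs.localInverse χ _ _ hd (χ w) = w :=
    HasStrictFDerivAt.localInverse_apply_image (hs.hasStrictFDerivAt_equiv hd)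
  have hcomp : DifferentiableAt ℂ ((fun z => F (χ z)) ∘ hs.localInverse χ _ _ hd) (χ w) :=
    DifferentiableAt.comp (χ w) (by rwa [hinv])
      (hs.to_localInverse hd).hasDerivAt.differentiableAt
  exact hcomp.congr_of_eventuallyEq (hright.mono fun y hy => by rw [Function.comp_apply, hy])

/-! ### Ring domains as images of strips -/

section StripMaps

/-- The vertical strip of width `ℓ`, on which ring domains are parametrized by universal
coverings. -/
def strip (ℓ : ℝ) : Set ℂ := {w | 0 < w.re ∧ w.re < ℓ}

/-- The round annulus covered by `strip ℓ` under the exponential map. -/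
def roundAnnulus (ℓ : ℝ) : Set ℂ := {z | 1 < ‖z‖ ∧ ‖z‖ < Real.exp ℓ}

variable {Φ : ℂ → ℂ} {ℓ : ℝ} {A : Set ℂ}

theorem isOpen_strip (ℓ : ℝ) : IsOpen (strip ℓ) :=
  (isOpen_lt continuous_const Complex.continuous_re).inter
    (isOpen_lt Complex.continuous_re continuous_const)

theorem convex_strip (ℓ : ℝ) : Convex ℝ (strip ℓ) :=
  (convex_halfSpace_re_gt 0).inter (convex_halfSpace_re_lt ℓ)

theorem isSimplyConnected_strip (hℓ : 0 < ℓ) : IsSimplyConnected (strip ℓ) :=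
  have : ContractibleSpace (strip ℓ) :=
    (convex_strip ℓ).contractibleSpace ⟨((ℓ / 2 : ℝ) : ℂ), by simp [strip, hℓ]⟩
  (inferInstance : SimplyConnectedSpace (strip ℓ))

theorem add_mul_I_mem_strip {s : ℝ} (hs : s ∈ Ioo 0 ℓ) (t : ℝ) :
    (s + t * Complex.I : ℂ) ∈ strip ℓ := by
  simpa [strip] using hs

theorem add_mem_strip {w : ℂ} (hw : w ∈ strip ℓ) (k : ℤ) :
    w + k * (2 * π * Complex.I) ∈ strip ℓ := by
  simpa [strip] using hw

theorem add_two_pi_mul_I_mem_strip {w : ℂ} (hw : w ∈ strip ℓ) :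
    w + 2 * π * Complex.I ∈ strip ℓ := by
  simpa using add_mem_strip hw 1

theorem apply_add_int_mul_of_strip {E : Type*} {f : ℂ → E}
    (hf : ∀ w ∈ strip ℓ, f (w + 2 * π * Complex.I) = f w) {w : ℂ} (hw : w ∈ strip ℓ) (k : ℤ) :
    f (w + k * (2 * π * Complex.I)) = f w := by
  induction k with
  | zero => simp
  | succ k ih =>
    rw [← ih, ← hf _ (add_mem_strip hw k)]
    congr 1
    push_cast
    ring
  | pred k ih =>
    rw [← ih, ← hf _ (add_mem_strip hw _)]
    congr 1
    push_cast
    ring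

theorem isOpen_roundAnnulus (ℓ : ℝ) : IsOpen (roundAnnulus ℓ) :=
  (isOpen_lt continuous_const continuous_norm).inter (isOpen_lt continuous_norm continuous_const)

theorem ne_zero_of_mem_roundAnnulus {z : ℂ} (hz : z ∈ roundAnnulus ℓ) : z ≠ 0 :=
  norm_pos_iff.1 (one_pos.trans hz.1)

theorem exp_mem_roundAnnulus {w : ℂ} : Complex.exp w ∈ roundAnnulus ℓ ↔ w ∈ strip ℓ := by
  simp [roundAnnulus, strip, Complex.norm_exp]

theorem log_mem_strip {z : ℂ} (hz : z ∈ roundAnnulus ℓ) : Complex.log z ∈ strip ℓ := by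
  rwa [← exp_mem_roundAnnulus, Complex.exp_log (ne_zero_of_mem_roundAnnulus hz)]

theorem exp_image_strip (ℓ : ℝ) : Complex.exp '' strip ℓ = roundAnnulus ℓ :=
  (image_subset_iff.2 fun _ => exp_mem_roundAnnulus.2).antisymm fun _ hz =>
    ⟨_, log_mem_strip hz, Complex.exp_log (ne_zero_of_mem_roundAnnulus hz)⟩

/-- `Φ` restricts to a universal covering of the ring domain `A` by the strip of width `ℓ`, with
deck group generated by the translation by `2πi`. Thus `A` has modulus `ℓ / (2π)`. -/
structure StripMap (Φ : ℂ → ℂ) (ℓ : ℝ) (A : Set ℂ) : Prop where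
  pos : 0 < ℓ
  holo : DifferentiableOn ℂ Φ (strip ℓ)
  per : ∀ w ∈ strip ℓ, Φ (w + 2 * π * Complex.I) = Φ w
  inj : ∀ w ∈ strip ℓ, ∀ w' ∈ strip ℓ, Φ w = Φ w' → ∃ k : ℤ, w = w' + k * (2 * π * Complex.I)
  img : Φ '' strip ℓ = A

theorem stripMap_exp (hℓ : 0 < ℓ) : StripMap Complex.exp ℓ (roundAnnulus ℓ) where
  pos := hℓ
  holo := Complex.differentiable_exp.differentiableOn
  per := fun _ _ => by rw [Complex.exp_add, Complex.exp_two_pi_mul_I, mul_one]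
  inj := fun _ _ _ _ => Complex.exp_eq_exp_iff_exists_int.1
  img := exp_image_strip ℓ

theorem IsRing.exists_stripMap {m : ℝ} (h : IsRing A m) : ∃ Φ, StripMap Φ (2 * π * m) A := by
  obtain ⟨hm, φ, hd, hi, himg⟩ := h
  change DifferentiableOn ℂ φ (roundAnnulus _) at hd
  change InjOn φ (roundAnnulus _) at hi
  change φ '' (roundAnnulus _) = A at himg
  have hexp := stripMap_exp (mul_pos Real.two_pi_pos hm)
  refine ⟨fun w => φ (Complex.exp w), hexp.pos,
    hd.comp hexp.holo fun w => exp_mem_roundAnnulus.2,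
    fun w hw => congrArg φ (hexp.per w hw), fun w hw w' hw' he => ?_, ?_⟩
  · exact hexp.inj w hw w' hw' (hi (exp_mem_roundAnnulus.2 hw) (exp_mem_roundAnnulus.2 hw') he)
  · rw [← himg, ← hexp.img, image_image]

namespace StripMap

theorem apply_add_int (H : StripMap Φ ℓ A) {w : ℂ} (hw : w ∈ strip ℓ) (k : ℤ) :
    Φ (w + k * (2 * π * Complex.I)) = Φ w :=
  apply_add_int_mul_of_strip H.per hw k

theorem mem (H : StripMap Φ ℓ A) {w : ℂ} (hw : w ∈ strip ℓ) : Φ w ∈ A := H.img ▸ ⟨w, hw, rfl⟩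

theorem injOn_box (H : StripMap Φ ℓ A) (a : ℝ) :
    InjOn Φ (strip ℓ ∩ Complex.im ⁻¹' Ico a (a + 2 * π)) := by
  rintro w ⟨hw, h1, h2⟩ w' ⟨hw', h1', h2'⟩ he
  obtain ⟨k, rfl⟩ := H.inj _ hw _ hw' he
  have him : (w' + k * (2 * π * Complex.I)).im = w'.im + k * (2 * π) := by simp
  rw [him] at h1 h2
  have hk : |(k : ℝ)| < 1 := abs_lt.2 ⟨by nlinarith [Real.pi_pos], by nlinarith [Real.pi_pos]⟩
  have hk0 : k = 0 := Int.abs_lt_one_iff.1 (by exact_mod_cast hk)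
  simp [hk0]

theorem exists_isOpen_injOn (H : StripMap Φ ℓ A) {w : ℂ} (hw : w ∈ strip ℓ) :
    ∃ O, IsOpen O ∧ w ∈ O ∧ O ⊆ strip ℓ ∧ InjOn Φ O := by
  refine ⟨strip ℓ ∩ Complex.im ⁻¹' Ioo (w.im - π) (w.im - π + 2 * π),
    (isOpen_strip ℓ).inter (isOpen_Ioo.preimage Complex.continuous_im), ⟨hw, ?_⟩,
    inter_subset_left,
    (H.injOn_box (w.im - π)).mono
      (inter_subset_inter_right _ (preimage_mono Ioo_subset_Ico_self))⟩
  constructor <;> linarith [Real.pi_pos]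

theorem map_nhds_eq (H : StripMap Φ ℓ A) {w : ℂ} (hw : w ∈ strip ℓ) :
    map Φ (𝓝 w) = 𝓝 (Φ w) := by
  obtain ⟨O, hO, hwO, hOs, hi⟩ := H.exists_isOpen_injOn hw
  exact map_nhds_eq_of_injOn hO (H.holo.mono hOs) hi hwO

theorem deriv_ne_zero (H : StripMap Φ ℓ A) {w : ℂ} (hw : w ∈ strip ℓ) : deriv Φ w ≠ 0 := by
  obtain ⟨O, hO, hwO, hOs, hi⟩ := H.exists_isOpen_injOn hw
  exact deriv_ne_zero_of_injOn hO (H.holo.mono hOs) hi hwO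

theorem analyticAt (H : StripMap Φ ℓ A) {w : ℂ} (hw : w ∈ strip ℓ) : AnalyticAt ℂ Φ w :=
  H.holo.analyticAt ((isOpen_strip ℓ).mem_nhds hw)

theorem isOpen_image (H : StripMap Φ ℓ A) {O : Set ℂ} (hO : IsOpen O) (hOs : O ⊆ strip ℓ) :
    IsOpen (Φ '' O) := by
  rw [isOpen_iff_mem_nhds]
  rintro _ ⟨w, hw, rfl⟩
  exact H.map_nhds_eq (hOs hw) ▸ image_mem_map (hO.mem_nhds hw)

theorem isOpen (H : StripMap Φ ℓ A) : IsOpen A :=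
  H.img ▸ H.isOpen_image (isOpen_strip ℓ) Subset.rfl

theorem exists_comp_eq (H : StripMap Φ ℓ A) {E : Type*} {L : ℂ → E}
    (hper : ∀ w ∈ strip ℓ, L (w + 2 * π * Complex.I) = L w) :
    ∃ F : ℂ → E, ∀ w ∈ strip ℓ, F (Φ w) = L w := by
  refine ⟨fun z => L (Function.invFunOn Φ (strip ℓ) z), fun w hw => ?_⟩
  have hmem := Function.invFunOn_mem (f := Φ) (s := strip ℓ) ⟨w, hw, rfl⟩
  have heq := Function.invFunOn_eq (f := Φ) (s := strip ℓ) ⟨w, hw, rfl⟩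
  obtain ⟨k, hk⟩ := H.inj _ hmem _ hw heq
  change L (Function.invFunOn Φ (strip ℓ) (Φ w)) = L w
  rw [hk, apply_add_int_mul_of_strip hper hw]

theorem continuousOn_of_comp (H : StripMap Φ ℓ A) {E : Type*} [TopologicalSpace E] {F : ℂ → E}
    (hF : ContinuousOn (fun w => F (Φ w)) (strip ℓ)) : ContinuousOn F A := by
  rw [← H.img]
  rintro _ ⟨w, hw, rfl⟩
  have hcomp := hF.continuousAt ((isOpen_strip ℓ).mem_nhds hw)
  refine ContinuousAt.continuousWithinAt ?_
  rwa [ContinuousAt, ← H.map_nhds_eq hw, tendsto_map'_iff]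

theorem differentiableOn_of_comp (H : StripMap Φ ℓ A) {F : ℂ → ℂ}
    (hF : DifferentiableOn ℂ (fun w => F (Φ w)) (strip ℓ)) : DifferentiableOn ℂ F A := by
  rw [← H.img]
  rintro _ ⟨w, hw, rfl⟩
  exact (differentiableAt_of_comp (H.analyticAt hw) (H.deriv_ne_zero hw)
    (hF.differentiableAt ((isOpen_strip ℓ).mem_nhds hw))).differentiableWithinAt

theorem exists_conformal (H : StripMap Φ ℓ A) {Ψ : ℂ → ℂ} {B : Set ℂ} (H' : StripMap Ψ ℓ B) :
    ∃ φ : ℂ → ℂ, DifferentiableOn ℂ φ A ∧ InjOn φ A ∧ φ '' A = B ∧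
      ∀ w ∈ strip ℓ, φ (Φ w) = Ψ w := by
  obtain ⟨φ, hφ⟩ := H.exists_comp_eq H'.per
  refine ⟨φ, H.differentiableOn_of_comp (H'.holo.congr hφ), ?_, ?_, hφ⟩
  · rw [← H.img]
    rintro _ ⟨w, hw, rfl⟩ _ ⟨w', hw', rfl⟩ he
    rw [hφ w hw, hφ w' hw'] at he
    obtain ⟨k, rfl⟩ := H'.inj w hw w' hw' he
    exact H.apply_add_int hw' k
  · rw [← H.img, image_image, image_congr hφ, H'.img]

theorem isRing (H : StripMap Φ ℓ A) : IsRing A (ℓ / (2 * π)) := by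
  obtain ⟨φ, hd, hi, himg, -⟩ := (stripMap_exp H.pos).exists_conformal H
  refine ⟨div_pos H.pos Real.two_pi_pos, φ, ?_⟩
  rw [mul_div_cancel₀ _ Real.two_pi_pos.ne']
  exact ⟨hd, hi, himg⟩

theorem restrict (H : StripMap Φ ℓ A) {a b : ℝ} (ha : 0 ≤ a) (hab : a < b) (hb : b ≤ ℓ) :
    StripMap (fun w => Φ (a + w)) (b - a) (Φ '' {w | a < w.re ∧ w.re < b}) := by
  have hmem : ∀ w ∈ strip (b - a), (a : ℂ) + w ∈ strip ℓ := by
    rintro w ⟨h1, h2⟩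
    simp only [strip, mem_ofPred_eq, Complex.add_re, Complex.ofReal_re]
    constructor <;> linarith
  refine ⟨sub_pos.2 hab, H.holo.comp (by fun_prop) hmem, fun w hw => ?_, fun w hw w' hw' he => ?_,
    ?_⟩
  · rw [← add_assoc]
    exact H.per _ (hmem w hw)
  · obtain ⟨k, hk⟩ := H.inj _ (hmem w hw) _ (hmem w' hw') he
    exact ⟨k, by linear_combination hk⟩
  · ext y
    constructor
    · rintro ⟨w, ⟨h1, h2⟩, rfl⟩
      refine ⟨a + w, ?_, rfl⟩
      simp only [mem_ofPred_eq, Complex.add_re, Complex.ofReal_re]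
      constructor <;> linarith
    · rintro ⟨w, ⟨h1, h2⟩, rfl⟩
      refine ⟨w - a, ?_, congrArg Φ (add_sub_cancel _ _)⟩
      simp only [strip, mem_ofPred_eq, Complex.sub_re, Complex.ofReal_re]
      constructor <;> linarith

/-! ### Loops of ring domains -/

theorem continuous_loop (H : StripMap Φ ℓ A) {s : ℝ} (hs : s ∈ Ioo 0 ℓ) :
    Continuous fun t : ℝ => Φ (s + t * Complex.I) :=
  H.holo.continuousOn.comp_continuous (by fun_prop) (add_mul_I_mem_strip hs)

theorem periodic_loop (H : StripMap Φ ℓ A) {s : ℝ} (hs : s ∈ Ioo 0 ℓ) :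
    Function.Periodic (fun t : ℝ => Φ (s + t * Complex.I)) (2 * π) := fun t => by
  simp only [← H.per _ (add_mul_I_mem_strip hs t)]
  congr 1
  push_cast
  ring

theorem loop_mem (H : StripMap Φ ℓ A) {s : ℝ} (hs : s ∈ Ioo 0 ℓ) (t : ℝ) :
    Φ (s + t * Complex.I) ∈ A := H.mem (add_mul_I_mem_strip hs t)

theorem winds_loop_sub_zero (H : StripMap Φ ℓ A) {x : ℂ} (hxA : x ∉ A) (hx : x ∉ surrounded A)
    {s : ℝ} (hs : s ∈ Ioo 0 ℓ) : Winds (fun t => Φ (s + t * Complex.I) - x) 0 :=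
  Winds.sub_of_not_isBounded (H.continuous_loop hs) (H.periodic_loop hs)
    isPreconnected_connectedComponentIn
    (fun t h => (connectedComponentIn_subset Aᶜ x h : _ ∈ Aᶜ) (H.loop_mem hs t))
    (fun hb => hx ⟨hxA, hb⟩) (mem_connectedComponentIn hxA)

theorem exists_periodic_log_of_winds_zero (H : StripMap Φ ℓ A) {x : ℂ} (hxA : x ∉ A) {s : ℝ}
    (hs : s ∈ Ioo 0 ℓ) (hwind : Winds (fun t => Φ (s + t * Complex.I) - x) 0) :
    ∃ L : ℂ → ℂ, ContinuousOn L (strip ℓ) ∧ (∀ w ∈ strip ℓ, Complex.exp (L w) = Φ w - x) ∧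
      ∀ w ∈ strip ℓ, L (w + 2 * π * Complex.I) = L w := by
  have hne : ∀ w ∈ strip ℓ, Φ w - x ≠ 0 := fun w hw h => hxA (sub_eq_zero.1 h ▸ H.mem hw)
  obtain ⟨L, hL, hLexp⟩ := Complex.exists_continuousOn_eqOn_exp_comp
    (isSimplyConnected_strip H.pos) (isOpen_strip ℓ) (g := fun w => Φ w - x)
    (H.holo.continuousOn.sub continuousOn_const) fun ⟨w, hw, h⟩ => hne w hw h
  replace hLexp : ∀ w ∈ strip ℓ, Complex.exp (L w) = Φ w - x := fun w hw => hLexp hw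
  obtain ⟨n, hn⟩ := exists_eq_int_mul_of_exp_eq_one (convex_strip ℓ).isPreconnected
    (f := fun w => L (w + 2 * π * Complex.I) - L w)
    ((hL.comp (by fun_prop) fun w => add_two_pi_mul_I_mem_strip).sub hL) fun w hw => by
      rw [Complex.exp_sub, hLexp _ (add_two_pi_mul_I_mem_strip hw), hLexp w hw, H.per w hw,
        div_self (hne w hw)]
  have hloop : Winds (fun t => Φ (s + t * Complex.I) - x) n := by
    refine ⟨fun t => L (s + t * Complex.I),
      hL.comp_continuous (by fun_prop) (add_mul_I_mem_strip hs),
      fun t => hLexp _ (add_mul_I_mem_strip hs t), fun t => ?_⟩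
    rw [← hn _ (add_mul_I_mem_strip hs t), add_sub_cancel]
    push_cast
    ring_nf
  refine ⟨L, hL, hLexp, fun w hw => sub_eq_zero.1 ?_⟩
  rw [hn w hw, hloop.unique hwind, Int.cast_zero, zero_mul]

theorem not_winds_loop_sub_zero (H : StripMap Φ ℓ A) {x : ℂ} (hx : x ∈ surrounded A) {s : ℝ}
    (hs : s ∈ Ioo 0 ℓ) : ¬ Winds (fun t => Φ (s + t * Complex.I) - x) 0 := by
  intro hw
  obtain ⟨L, hL, hLexp, hper⟩ := H.exists_periodic_log_of_winds_zero hx.1 hs hw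
  obtain ⟨F, hF⟩ := H.exists_comp_eq hper
  refine not_isBounded_of_continuousOn_log_sub H.isOpen hx.1
    (H.continuousOn_of_comp (hL.congr hF)) ?_ hx.2
  rw [← H.img]
  rintro _ ⟨w, hw, rfl⟩
  rw [hF w hw, hLexp w hw]

theorem exists_loop_mem (H : StripMap Φ ℓ A) {Z : Set ℂ} (hZ : IsPreconnected Z) {x y : ℂ}
    (hx : x ∈ Z) (hy : y ∈ Z) (hxA : x ∈ surrounded A) (hyA : y ∉ A) (hyA' : y ∉ surrounded A)
    {s : ℝ} (hs : s ∈ Ioo 0 ℓ) : ∃ t : ℝ, Φ (s + t * Complex.I) ∈ Z := by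
  by_contra! h
  exact H.not_winds_loop_sub_zero hxA hs (Winds.sub_of_isPreconnected (H.continuous_loop hs)
    (H.periodic_loop hs) hZ h hy hx (H.winds_loop_sub_zero hyA hyA' hs))

theorem exists_loop_mem_of_not_isBounded (H : StripMap Φ ℓ A) {Z : Set ℂ} (hZ : IsPreconnected Z)
    {x : ℂ} (hx : x ∈ Z) (hxA : x ∈ surrounded A) (hb : ¬ Bornology.IsBounded Z)
    {s : ℝ} (hs : s ∈ Ioo 0 ℓ) : ∃ t : ℝ, Φ (s + t * Complex.I) ∈ Z := by
  by_contra! h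
  exact H.not_winds_loop_sub_zero hxA hs
    (Winds.sub_of_not_isBounded (H.continuous_loop hs) (H.periodic_loop hs) hZ h hb hx)

theorem mem_surrounded (H : StripMap Φ ℓ A) {x : ℂ} (hx : x ∉ A) {s : ℝ} (hs : s ∈ Ioo 0 ℓ)
    (h : ¬ Winds (fun t => Φ (s + t * Complex.I) - x) 0) : x ∈ surrounded A := by
  by_contra hx'
  exact h (H.winds_loop_sub_zero hx hx' hs)

theorem winds_loop_restrict_iff {a b : ℝ} {x : ℂ} {n : ℤ} :
    Winds (fun t => Φ (a + (((b - a) / 2 : ℝ) + t * Complex.I)) - x) n ↔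
      Winds (fun t => Φ (((a + b) / 2 : ℝ) + t * Complex.I) - x) n := by
  have hmid (t : ℝ) : (a + (((b - a) / 2 : ℝ) + t * Complex.I) : ℂ) =
      ((a + b) / 2 : ℝ) + t * Complex.I := by
    push_cast
    ring
  simp only [hmid]

theorem surrounded_subset_restrict (H : StripMap Φ ℓ A) {a b : ℝ} (ha : 0 ≤ a) (hab : a < b)
    (hb : b ≤ ℓ) : surrounded A ⊆ surrounded (Φ '' {w | a < w.re ∧ w.re < b}) := by
  intro x hx
  have hsub : Φ '' {w | a < w.re ∧ w.re < b} ⊆ A := by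
    rintro _ ⟨w, ⟨h1, h2⟩, rfl⟩
    exact H.mem ⟨by linarith, by linarith⟩
  exact (H.restrict ha hab hb).mem_surrounded (fun h => hx.1 (hsub h)) (s := (b - a) / 2)
    ⟨by linarith, by linarith⟩ fun h => H.not_winds_loop_sub_zero hx (s := (a + b) / 2)
      ⟨by linarith, by linarith⟩ (winds_loop_restrict_iff.1 h)

theorem notMem_surrounded_restrict (H : StripMap Φ ℓ A) {a b : ℝ} (ha : 0 ≤ a) (hab : a < b)
    (hb : b ≤ ℓ) {x : ℂ} (hxA : x ∉ A) (hx : x ∉ surrounded A) :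
    x ∉ surrounded (Φ '' {w | a < w.re ∧ w.re < b}) := fun h =>
  (H.restrict ha hab hb).not_winds_loop_sub_zero h (s := (b - a) / 2)
    ⟨by linarith, by linarith⟩ <| winds_loop_restrict_iff.2 <|
      H.winds_loop_sub_zero hxA hx (s := (a + b) / 2) ⟨by linarith, by linarith⟩

theorem exists_sub_eq_exp_sub_mul (H : StripMap Φ ℓ A) {w₀ : ℂ} (hw₀ : w₀ ∈ strip ℓ) :
    ∃ u : ℂ → ℂ, ContinuousOn u (roundAnnulus ℓ) ∧ (∀ z ∈ roundAnnulus ℓ, u z ≠ 0) ∧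
      ∀ w ∈ strip ℓ, Φ w - Φ w₀ = (Complex.exp w - Complex.exp w₀) * u (Complex.exp w) := by
  obtain ⟨φ, hd, hi, -, he⟩ := (stripMap_exp H.pos).exists_conformal H
  have hz₀ := exp_mem_roundAnnulus.2 hw₀
  have hnhds := (isOpen_roundAnnulus ℓ).mem_nhds hz₀
  refine ⟨dslope φ (Complex.exp w₀),
    (continuousOn_dslope hnhds).2 ⟨hd.continuousOn, hd.differentiableAt hnhds⟩,
    fun z hz => ?_, fun w hw => ?_⟩
  · by_cases hzz : z = Complex.exp w₀
    · rw [hzz, dslope_same]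
      exact deriv_ne_zero_of_injOn (isOpen_roundAnnulus ℓ) hd hi hz₀
    · rw [dslope_of_ne _ hzz, slope_def_field]
      exact div_ne_zero (sub_ne_zero.2 fun h => hzz (hi hz hz₀ h)) (sub_ne_zero.2 hzz)
  · rw [← he w hw, ← he w₀ hw₀, ← smul_eq_mul, sub_smul_dslope]

end StripMap

theorem periodic_exp_vertical (s : ℝ) :
    Function.Periodic (fun t : ℝ => Complex.exp (s + t * Complex.I)) (2 * π) :=
  (Winds.exp_vertical s).periodic

theorem winds_exp_sub_of_lt {w : ℂ} {s : ℝ} (hs : s < w.re) :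
    Winds (fun t => Complex.exp (s + t * Complex.I) - Complex.exp w) 0 :=
  (Winds.const (neg_ne_zero.2 (Complex.exp_ne_zero w))).of_norm_sub_lt (by fun_prop)
    (fun t => congrArg (· - _) (periodic_exp_vertical s t))
    fun t => by simpa [Complex.norm_exp] using hs

theorem winds_exp_sub_of_gt {w : ℂ} {s : ℝ} (hs : w.re < s) :
    Winds (fun t => Complex.exp (s + t * Complex.I) - Complex.exp w) 1 :=
  (Winds.exp_vertical s).of_norm_sub_lt (by fun_prop)
    (fun t => congrArg (· - _) (periodic_exp_vertical s t))
    fun t => by simpa [Complex.norm_exp] using hs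

theorem exists_winds_comp_exp {u : ℂ → ℂ} (hu : ContinuousOn u (roundAnnulus ℓ))
    (hu0 : ∀ z ∈ roundAnnulus ℓ, u z ≠ 0) :
    ∃ n, ∀ s ∈ Ioo 0 ℓ, Winds (fun t => u (Complex.exp (s + t * Complex.I))) n := by
  rcases (Ioo 0 ℓ).eq_empty_or_nonempty with hemp | ⟨s₀, hs₀⟩
  · exact ⟨0, by simp [hemp]⟩
  have hmem : ∀ s ∈ Ioo 0 ℓ, ∀ t : ℝ, Complex.exp (s + t * Complex.I) ∈ roundAnnulus ℓ :=
    fun s hs t => exp_mem_roundAnnulus.2 (add_mul_I_mem_strip hs t)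
  have hper (s : ℝ) :
      Function.Periodic (fun t : ℝ => u (Complex.exp (s + t * Complex.I))) (2 * π) :=
    fun t => congrArg u (periodic_exp_vertical s t)
  obtain ⟨n, hn⟩ := Winds.exists_of_periodic
    (hu.comp_continuous (by fun_prop) (hmem s₀ hs₀)) (fun t => hu0 _ (hmem s₀ hs₀ t)) (hper s₀)
  refine ⟨n, fun s hs => Winds.of_homotopy isPreconnected_Ioo
    (H := fun (s : ℝ) t => u (Complex.exp (s + t * Complex.I))) ?_
    (fun s hs t => hu0 _ (hmem s hs t)) (fun s _ => hper s) hs₀ hs hn⟩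
  exact hu.comp (f := fun q : ℝ × ℝ => Complex.exp (q.1 + q.2 * Complex.I)) (by fun_prop)
    fun q hq => hmem _ hq.1 _

namespace StripMap

theorem winds_loop_sub_one (H : StripMap Φ ℓ A) {w₀ : ℂ} (hw₀ : w₀ ∈ strip ℓ) {s s' : ℝ}
    (hs : s ∈ Ioo 0 w₀.re) (hs' : s' ∈ Ioo w₀.re ℓ)
    (h : Winds (fun t => Φ (s + t * Complex.I) - Φ w₀) 0) :
    Winds (fun t => Φ (s' + t * Complex.I) - Φ w₀) 1 := by
  have hsℓ : s ∈ Ioo 0 ℓ := ⟨hs.1, hs.2.trans hw₀.2⟩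
  have hsℓ' : s' ∈ Ioo 0 ℓ := ⟨hw₀.1.trans hs'.1, hs'.2⟩
  obtain ⟨u, hu, hu0, hfactor⟩ := H.exists_sub_eq_exp_sub_mul hw₀
  obtain ⟨n, hn⟩ := exists_winds_comp_exp hu hu0
  have hinner := (winds_exp_sub_of_lt hs.2).mul (hn s hsℓ)
  have houter := (winds_exp_sub_of_gt hs'.1).mul (hn s' hsℓ')
  simp only [← hfactor _ (add_mul_I_mem_strip hsℓ _)] at hinner
  simp only [← hfactor _ (add_mul_I_mem_strip hsℓ' _)] at houter
  have hn0 : n = 0 := by simpa using hinner.unique h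
  simpa [hn0] using houter

theorem exists_loop_mem_or_of_not_isBounded (H : StripMap Φ ℓ A) {w₀ : ℂ} (hw₀ : w₀ ∈ strip ℓ)
    {Z : Set ℂ} (hZ : IsPreconnected Z) (hw₀Z : Φ w₀ ∈ Z) (hb : ¬ Bornology.IsBounded Z) :
    (∀ s ∈ Ioo 0 w₀.re, ∃ t : ℝ, Φ (s + t * Complex.I) ∈ Z) ∨
      ∀ s ∈ Ioo w₀.re ℓ, ∃ t : ℝ, Φ (s + t * Complex.I) ∈ Z := by
  by_contra! hcon
  obtain ⟨⟨s, hs, hdisj⟩, s', hs', hdisj'⟩ := hcon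
  have hsℓ : s ∈ Ioo 0 ℓ := ⟨hs.1, hs.2.trans hw₀.2⟩
  have hsℓ' : s' ∈ Ioo 0 ℓ := ⟨hw₀.1.trans hs'.1, hs'.2⟩
  have hwind := Winds.sub_of_not_isBounded (H.continuous_loop hsℓ) (H.periodic_loop hsℓ) hZ hdisj
    hb hw₀Z
  have hwind' := Winds.sub_of_not_isBounded (H.continuous_loop hsℓ') (H.periodic_loop hsℓ') hZ
    hdisj' hb hw₀Z
  exact zero_ne_one (hwind'.unique (H.winds_loop_sub_one hw₀ hs hs' hwind))

end StripMap

end StripMaps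

/-! ### Length and area -/

section LengthArea

open MeasureTheory

variable {Φ Ψ : ℂ → ℂ} {ℓ ℓ' : ℝ} {A B : Set ℂ}

theorem measurableSet_reProdIm {s t : Set ℝ} (hs : MeasurableSet s) (ht : MeasurableSet t) :
    MeasurableSet (s ×ℂ t) :=
  (Complex.measurable_re hs).inter (Complex.measurable_im ht)

theorem setLIntegral_reProdIm {f : ℂ → ENNReal} (hf : Measurable f) (s t : Set ℝ) :
    ∫⁻ w in s ×ℂ t, f w = ∫⁻ x in s, ∫⁻ y in t, f (x + y * Complex.I) := by
  let e := Complex.measurableEquivRealProd.symm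
  have he : ∀ p : ℝ × ℝ, e p = p.1 + p.2 * Complex.I := fun p => by apply Complex.ext <;> simp [e]
  have hpre : e ⁻¹' (s ×ℂ t) = s ×ˢ t := by
    ext p
    simp [he, Complex.mem_reProdIm]
  rw [← Complex.volume_preserving_equiv_real_prod.symm.setLIntegral_comp_preimage_emb
    e.measurableEmbedding f (s ×ℂ t), hpre, Measure.volume_eq_prod,
    setLIntegral_prod (fun p => f (e p)) (hf.comp e.measurable).aemeasurable]
  simp only [he]

theorem sq_lintegral_le {α : Type*} [MeasurableSpace α] (μ : Measure α) {g : α → ENNReal}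
    (hg : AEMeasurable g μ) : (∫⁻ x, g x ∂μ) ^ 2 ≤ μ univ * ∫⁻ x, g x ^ 2 ∂μ := by
  have hcs := ENNReal.lintegral_mul_le_Lp_mul_Lq μ Real.HolderConjugate.two_two hg
    (aemeasurable_const (b := (1 : ENNReal)))
  simp only [Pi.mul_apply, mul_one, ENNReal.one_rpow, lintegral_const, one_mul] at hcs
  refine (pow_le_pow_left' hcs 2).trans_eq ?_
  rw [mul_pow, ← ENNReal.rpow_natCast, ← ENNReal.rpow_mul, ← ENNReal.rpow_natCast,
    ← ENNReal.rpow_mul, mul_comm]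
  norm_num

theorem length_area {f : ℂ → ENNReal} (hf : Measurable f) {a b c d : ℝ} {l : ENNReal}
    (h : ∀ s ∈ Ioo a b, l ≤ ∫⁻ t in Ico c d, f (s + t * Complex.I)) :
    l ^ 2 * ENNReal.ofReal (b - a) ≤
      ENNReal.ofReal (d - c) * ∫⁻ w in Ioo a b ×ℂ Ico c d, f w ^ 2 := by
  rw [setLIntegral_reProdIm (hf.pow_const 2), ← lintegral_const_mul' _ _ ENNReal.ofReal_ne_top]
  calc l ^ 2 * ENNReal.ofReal (b - a) = ∫⁻ s in Ioo a b, l ^ 2 := by simp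
    _ ≤ _ := setLIntegral_mono' measurableSet_Ioo fun s hs => by
      refine (pow_le_pow_left' (h s hs) 2).trans ((sq_lintegral_le _ ?_).trans_eq ?_)
      · exact (hf.comp (by fun_prop)).aemeasurable
      · simp

theorem det_restrictScalars_toSpanSingleton (c : ℂ) :
    ((ContinuousLinearMap.toSpanSingleton ℂ c).restrictScalars ℝ).det = ‖c‖ ^ 2 := by
  change LinearMap.det (LinearMap.restrictScalars ℝ
    (ContinuousLinearMap.toSpanSingleton ℂ c : ℂ →ₗ[ℂ] ℂ)) = _
  rw [LinearMap.det_restrictScalars, Algebra.norm_complex_apply, LinearMap.det_ring,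
    Complex.normSq_eq_norm_sq]
  simp

theorem setLIntegral_image_of_hasDerivAt {F F' : ℂ → ℂ} {S : Set ℂ} (hS : MeasurableSet S)
    (hF : ∀ w ∈ S, HasDerivAt F (F' w) w) (hi : InjOn F S) (g : ℂ → ENNReal) :
    ∫⁻ z in F '' S, g z = ∫⁻ w in S, ‖F' w‖ₑ ^ 2 * g (F w) := by
  rw [lintegral_image_eq_lintegral_abs_det_fderiv_mul volume hS
    (fun w hw => ((hF w hw).hasFDerivAt.restrictScalars ℝ).hasFDerivWithinAt) hi]
  refine lintegral_congr fun w => ?_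
  rw [det_restrictScalars_toSpanSingleton, abs_of_nonneg (by positivity),
    ENNReal.ofReal_pow (norm_nonneg _), ofReal_norm]

theorem measurable_indicator_comp_mul_enorm {E E' : Type*} [NormedAddCommGroup E]
    [MeasurableSpace E] [BorelSpace E] [NormedAddCommGroup E'] {F : ℂ → E} {G : ℂ → E'}
    {ρ : E → ENNReal} {O : Set ℂ} (hO : IsOpen O) (hF : ContinuousOn F O) (hG : ContinuousOn G O)
    (hρ : Measurable ρ) : Measurable (O.indicator fun w => ρ (F w) * ‖G w‖ₑ) := by
  classical
  have hFm : Measurable (O.piecewise F 0) :=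
    hF.measurable_piecewise continuousOn_const hO.measurableSet
  have hGm : Measurable (O.piecewise (fun w => ‖G w‖ₑ) 0) :=
    (continuous_enorm.comp_continuousOn hG).measurable_piecewise continuousOn_const
      hO.measurableSet
  convert (hρ.comp hFm).mul hGm using 1
  ext w
  by_cases hw : w ∈ O <;> simp [hw]

theorem length_area_of_differentiableOn {F : ℂ → ℂ} {O : Set ℂ} (hO : IsOpen O)
    (hF : DifferentiableOn ℂ F O) {a b c d : ℝ} (hi : InjOn F (O ∩ Ioo a b ×ℂ Ico c d))
    {ρ : ℂ → ENNReal} (hρ : Measurable ρ) {l : ENNReal}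
    (h : ∀ s ∈ Ioo a b, l ≤ ∫⁻ t in Ico c d ∩ {t : ℝ | (s + t * Complex.I : ℂ) ∈ O},
      ρ (F (s + t * Complex.I)) * ‖deriv F (s + t * Complex.I)‖ₑ) :
    l ^ 2 * ENNReal.ofReal (b - a) ≤
      ENNReal.ofReal (d - c) * ∫⁻ z in F '' (O ∩ Ioo a b ×ℂ Ico c d), ρ z ^ 2 := by
  have hm := measurable_indicator_comp_mul_enorm hO hF.continuousOn
    (hF.deriv hO).continuousOn hρ
  refine (length_area hm (a := a) (b := b) (c := c) (d := d) fun s hs => ?_).trans_eq ?_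
  · have hline : MeasurableSet {t : ℝ | (s + t * Complex.I : ℂ) ∈ O} :=
      (hO.preimage (by fun_prop)).measurableSet
    refine (h s hs).trans_eq ?_
    rw [inter_comm, ← Measure.restrict_restrict hline, ← lintegral_indicator hline]
    rfl
  · rw [setLIntegral_image_of_hasDerivAt
      (hO.measurableSet.inter (measurableSet_reProdIm measurableSet_Ioo measurableSet_Ico))
      (fun w hw => (hF.differentiableAt (hO.mem_nhds hw.1)).hasDerivAt) hi,
      ← Measure.restrict_restrict hO.measurableSet, ← lintegral_indicator hO.measurableSet]
    congr 2 with w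
    by_cases hw : w ∈ O
    · simp only [indicator_of_mem hw]
      ring
    · simp [hw]

theorem ofReal_sub_le_setLIntegral {v v' : ℝ → ℝ} {f : ℝ → ENNReal} {S : Set ℝ}
    (hS : MeasurableSet S) (hv : ∀ t ∈ S, HasDerivAt v (v' t) t) (hf : ∀ t ∈ S, ‖v' t‖ₑ ≤ f t)
    {x y : ℝ} (hxy : Ioo x y ⊆ v '' S) : ENNReal.ofReal (y - x) ≤ ∫⁻ t in S, f t := by
  calc ENNReal.ofReal (y - x) = volume (Ioo x y) := Real.volume_Ioo.symm
    _ ≤ volume (v '' S) := measure_mono hxy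
    _ ≤ ∫⁻ t in S, ‖v' t‖ₑ := by
      simpa [ContinuousLinearMap.det_toSpanSingleton, ← Real.enorm_eq_ofReal_abs] using
        addHaar_image_le_lintegral_abs_det_fderiv volume hS
          fun t ht => (hv t ht).hasFDerivAt.hasFDerivWithinAt
    _ ≤ ∫⁻ t in S, f t := setLIntegral_mono' hS hf

theorem exists_mem_Ico_eq_of_periodic {v : ℝ → ℝ} {T : ℝ} (hc : Continuous v)
    (hp : Function.Periodic v T) (hT : 0 < T) {t₀ t₁ y : ℝ} (h₀ : v t₀ ≤ y) (h₁ : y ≤ v t₁) :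
    ∃ t ∈ Ico 0 T, v t = y := by
  obtain ⟨t, rfl⟩ := mem_range_of_exists_le_of_exists_ge hc ⟨t₀, h₀⟩ ⟨t₁, h₁⟩
  obtain ⟨t', ht', he⟩ := hp.exists_mem_Ico₀ hT t
  exact ⟨t', ht', he.symm⟩

theorem hasDerivAt_norm {γ : ℝ → ℂ} {γ' : ℂ} {t : ℝ} (h : HasDerivAt γ γ' t) (h0 : γ t ≠ 0) :
    HasDerivAt (fun t => ‖γ t‖) (‖γ t‖ * (γ' / γ t).re) t := by
  have hn : ‖γ t‖ ≠ 0 := norm_ne_zero_iff.2 h0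
  convert h.norm_sq.sqrt (pow_ne_zero 2 hn) using 1
  · simp only [Real.sqrt_sq (norm_nonneg _)]
  · rw [Real.sqrt_sq (norm_nonneg _), Complex.inner, Complex.div_re, ← add_div,
      Complex.normSq_eq_norm_sq, Complex.mul_re, Complex.conj_re, Complex.conj_im]
    field_simp
    ring

theorem hasDerivAt_log_norm {γ : ℝ → ℂ} {γ' : ℂ} {t : ℝ} (h : HasDerivAt γ γ' t)
    (h0 : γ t ≠ 0) : HasDerivAt (fun t => Real.log ‖γ t‖) (γ' / γ t).re t := by
  have hn : ‖γ t‖ ≠ 0 := norm_ne_zero_iff.2 h0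
  simpa only [mul_div_cancel_left₀ _ hn] using (hasDerivAt_norm h h0).log hn

theorem abs_norm_mul_re_div_le {z w : ℂ} : |‖z‖ * (w / z).re| ≤ ‖w‖ := by
  rcases eq_or_ne z 0 with rfl | hz
  · simp
  calc |‖z‖ * (w / z).re| = ‖z‖ * |(w / z).re| := by rw [abs_mul, abs_norm]
    _ ≤ ‖z‖ * ‖w / z‖ := by gcongr; exact Complex.abs_re_le_norm _
    _ = ‖w‖ := by rw [norm_div, mul_div_cancel₀ _ (norm_ne_zero_iff.2 hz)]

theorem hasDerivAt_comp_vertical {g : ℂ → ℂ} {g' : ℂ} {s t : ℝ}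
    (h : HasDerivAt g g' (s + t * Complex.I)) :
    HasDerivAt (fun t : ℝ => g (s + t * Complex.I)) (g' * Complex.I) t := by
  have hline : HasDerivAt (fun t : ℝ => (s + t * Complex.I : ℂ)) Complex.I t := by
    simpa using ((hasDerivAt_id t).ofReal_comp.mul_const Complex.I).const_add (s : ℂ)
  exact HasDerivAt.comp t h hline

namespace StripMap

theorem injOn_reProdIm (H : StripMap Φ ℓ A) {a b : ℝ} (ha : 0 ≤ a) (hb : b ≤ ℓ) :
    InjOn Φ (Ioo a b ×ℂ Ico 0 (2 * π)) := by
  refine (H.injOn_box 0).mono (inter_subset_inter (fun w hw => ?_) (by rw [zero_add]))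
  exact ⟨ha.trans_lt hw.1, hw.2.trans_le hb⟩

theorem hasDerivAt_loop (H : StripMap Φ ℓ A) {s : ℝ} (hs : s ∈ Ioo 0 ℓ) (t : ℝ) :
    HasDerivAt (fun t : ℝ => Φ (s + t * Complex.I))
      (deriv Φ (s + t * Complex.I) * Complex.I) t :=
  hasDerivAt_comp_vertical
    (H.analyticAt (add_mul_I_mem_strip hs t)).differentiableAt.hasDerivAt

theorem exists_loop_eq_add_mul (H : StripMap Φ ℓ A) {p v : ℂ} (hp : p ∈ surrounded A)
    (hv : v ≠ 0) {s : ℝ} (hs : s ∈ Ioo 0 ℓ) :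
    ∃ t τ : ℝ, 0 ≤ τ ∧ Φ (s + t * Complex.I) = p + τ * v := by
  have hray : IsPreconnected ((fun τ : ℝ => p + τ * v) '' Ici 0) :=
    isPreconnected_Ici.image _ (by fun_prop)
  have hunb : ¬ Bornology.IsBounded ((fun τ : ℝ => p + τ * v) '' Ici 0) := fun hbd => by
    obtain ⟨C, hC⟩ := isBounded_iff_forall_norm_le.1 hbd
    have hpC : ‖p‖ ≤ C := hC p ⟨0, self_mem_Ici, by simp⟩
    have hτ : 0 ≤ (C + ‖p‖ + 1) / ‖v‖ := div_nonneg (by linarith [norm_nonneg p]) (norm_nonneg v)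
    have hnorm : ‖(((C + ‖p‖ + 1) / ‖v‖ : ℝ) : ℂ) * v‖ = C + ‖p‖ + 1 := by
      rw [norm_mul, Complex.norm_of_nonneg hτ, div_mul_cancel₀ _ (norm_ne_zero_iff.2 hv)]
    have hle := norm_le_add_norm_add ((((C + ‖p‖ + 1) / ‖v‖ : ℝ) : ℂ) * v) p
    rw [add_comm _ p] at hle
    linarith [hC _ ⟨_, hτ, rfl⟩]
  obtain ⟨t, τ, hτ, ht⟩ := H.exists_loop_mem_of_not_isBounded hray ⟨0, self_mem_Ici, by simp⟩
    hp hunb hs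
  exact ⟨t, τ, hτ, ht.symm⟩

theorem ofReal_norm_le_length (H : StripMap Φ ℓ A) {a : ℂ} (h0 : 0 ∈ surrounded A)
    (ha : a ∈ surrounded A) {s : ℝ} (hs : s ∈ Ioo 0 ℓ) :
    ENNReal.ofReal ‖a‖ ≤ ∫⁻ t in Ico 0 (2 * π), ‖deriv Φ (s + t * Complex.I)‖ₑ := by
  rcases eq_or_ne a 0 with rfl | ha0
  · simp
  -- The loop meets both rays of the line `ℝ a` that leave the segment `[0, a]`.
  obtain ⟨t₀, τ₀, hτ₀, ht₀⟩ := H.exists_loop_eq_add_mul h0 (neg_ne_zero.2 ha0) hs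
  obtain ⟨t₁, τ₁, hτ₁, ht₁⟩ := H.exists_loop_eq_add_mul ha ha0 hs
  set v : ℝ → ℝ := fun t => ‖a‖ * (Φ (s + t * Complex.I) / a).re with hv
  have hvc : Continuous v :=
    continuous_const.mul (Complex.continuous_re.comp ((H.continuous_loop hs).div_const a))
  have hvp : Function.Periodic v (2 * π) := fun t =>
    congrArg (fun z => ‖a‖ * (z / a).re) (H.periodic_loop hs t)
  have hv₀ : v t₀ ≤ 0 := by
    have hre : (Φ (s + t₀ * Complex.I) / a).re = -τ₀ := by
      rw [ht₀, zero_add, mul_neg, neg_div, mul_div_cancel_right₀ _ ha0]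
      simp
    rw [hv]
    simp only [hre]
    exact mul_nonpos_of_nonneg_of_nonpos (norm_nonneg a) (neg_nonpos.2 hτ₀)
  have hv₁ : ‖a‖ ≤ v t₁ := by
    have hre : (Φ (s + t₁ * Complex.I) / a).re = 1 + τ₁ := by
      rw [ht₁, add_div, mul_div_cancel_right₀ _ ha0, div_self ha0]
      simp
    rw [hv]
    simp only [hre]
    exact le_mul_of_one_le_right (norm_nonneg a) (le_add_of_nonneg_right hτ₁)
  have hlen := ofReal_sub_le_setLIntegral (x := 0) (y := ‖a‖) measurableSet_Ico
    (f := fun t => ‖deriv Φ (s + t * Complex.I)‖ₑ)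
    (fun t _ => (Complex.reCLM.hasFDerivAt.comp_hasDerivAt t
      ((H.hasDerivAt_loop hs t).div_const a)).const_mul ‖a‖) (fun t _ => ?_)
    fun y hy => exists_mem_Ico_eq_of_periodic hvc hvp Real.two_pi_pos (hv₀.trans hy.1.le)
      (hy.2.le.trans hv₁)
  · simpa using hlen
  · rw [enorm_le_iff_norm_le, norm_mul, norm_norm]
    simpa [abs_mul] using
      abs_norm_mul_re_div_le (z := a) (w := deriv Φ (s + t * Complex.I) * Complex.I)

theorem ofReal_sub_le_length_inter_ball (H : StripMap Φ ℓ A) {s : ℝ} (hs : s ∈ Ioo 0 ℓ)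
    {r R t₀ t₁ : ℝ} (ht₀ : ‖Φ (s + t₀ * Complex.I)‖ ≤ r) (ht₁ : R ≤ ‖Φ (s + t₁ * Complex.I)‖) :
    ENNReal.ofReal (R - r) ≤ ∫⁻ t in Ico 0 (2 * π) ∩ {t : ℝ | ‖Φ (s + t * Complex.I)‖ < R},
      ‖deriv Φ (s + t * Complex.I)‖ₑ := by
  set v : ℝ → ℝ := fun t => ‖Φ (s + t * Complex.I)‖
  have hvc : Continuous v := (H.continuous_loop hs).norm
  have hvp : Function.Periodic v (2 * π) := fun t => congrArg norm (H.periodic_loop hs t)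
  -- Since `0 ≤ r`, the loop avoids the point `0`, where the norm is not smooth, on this set.
  have hS : MeasurableSet (Ico 0 (2 * π) ∩ v ⁻¹' Ioo r R) :=
    measurableSet_Ico.inter (isOpen_Ioo.preimage hvc).measurableSet
  have hne : ∀ t ∈ Ico 0 (2 * π) ∩ v ⁻¹' Ioo r R, Φ (s + t * Complex.I) ≠ 0 := fun t ht =>
    norm_pos_iff.1 (((norm_nonneg _).trans ht₀).trans_lt ht.2.1)
  refine (ofReal_sub_le_setLIntegral hS
    (fun t ht => hasDerivAt_norm (H.hasDerivAt_loop hs t) (hne t ht)) (fun t _ => ?_)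
    fun y hy => ?_).trans (lintegral_mono_set (inter_subset_inter_right _ fun t ht => ht.2))
  · rw [enorm_le_iff_norm_le]
    exact abs_norm_mul_re_div_le.trans_eq (by rw [norm_mul, Complex.norm_I, mul_one])
  · obtain ⟨t, ht, rfl⟩ := exists_mem_Ico_eq_of_periodic hvc hvp Real.two_pi_pos
      (ht₀.trans hy.1.le) (hy.2.le.trans ht₁)
    exact ⟨t, ⟨ht, hy⟩, rfl⟩

theorem ofReal_le_length_of_separates (H : StripMap Φ ℓ A) {a b : ℂ} (h0 : 0 ∈ surrounded A)
    (ha : a ∈ surrounded A) (hbA : b ∉ A) (hb : b ∉ surrounded A) {δ R : ℝ} (hδa : δ ≤ ‖a‖)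
    (hδR : δ + ‖b‖ ≤ R) {s : ℝ} (hs : s ∈ Ioo 0 ℓ) :
    ENNReal.ofReal δ ≤ ∫⁻ t in Ico 0 (2 * π) ∩ {t : ℝ | ‖Φ (s + t * Complex.I)‖ < R},
      ‖deriv Φ (s + t * Complex.I)‖ₑ := by
  by_cases hball : ∀ t : ℝ, ‖Φ (s + t * Complex.I)‖ < R
  · rw [show {t : ℝ | ‖Φ (s + t * Complex.I)‖ < R} = univ from eq_univ_of_forall hball,
      inter_univ]
    exact (ENNReal.ofReal_le_ofReal hδa).trans (H.ofReal_norm_le_length h0 ha hs)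
  · push Not at hball
    obtain ⟨t₁, ht₁⟩ := hball
    obtain ⟨t₀, ht₀⟩ := H.exists_loop_mem (convex_segment (𝕜 := ℝ) (0 : ℂ) b).isPreconnected
      (left_mem_segment ℝ _ _) (right_mem_segment ℝ _ _) h0 hbA hb hs
    have ht₀b : ‖Φ (s + t₀ * Complex.I)‖ ≤ ‖b‖ := by
      simpa using (convex_closedBall (0 : ℂ) ‖b‖).segment_subset (by simp) (by simp) ht₀
    exact (ENNReal.ofReal_le_ofReal (by linarith)).trans
      (H.ofReal_sub_le_length_inter_ball hs ht₀b ht₁)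

theorem sq_mul_le_of_separates (H : StripMap Φ ℓ A) {a b : ℂ} (h0 : 0 ∈ surrounded A)
    (ha : a ∈ surrounded A) (hbA : b ∉ A) (hb : b ∉ surrounded A) {δ R : ℝ} (hδ : 0 ≤ δ)
    (hδa : δ ≤ ‖a‖) (hδR : δ + ‖b‖ ≤ R) : δ ^ 2 * ℓ ≤ 2 * π ^ 2 * R ^ 2 := by
  set O : Set ℂ := strip ℓ ∩ Φ ⁻¹' Metric.ball 0 R with hOdef
  have hO : IsOpen O :=
    H.holo.continuousOn.isOpen_inter_preimage (isOpen_strip ℓ) Metric.isOpen_ball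
  have hlen : ∀ s ∈ Ioo 0 ℓ, ENNReal.ofReal δ ≤
      ∫⁻ t in Ico 0 (2 * π) ∩ {t : ℝ | (s + t * Complex.I : ℂ) ∈ O},
        1 * ‖deriv Φ (s + t * Complex.I)‖ₑ := fun s hs => by
    have hline : {t : ℝ | (s + t * Complex.I : ℂ) ∈ O} =
        {t : ℝ | ‖Φ (s + t * Complex.I)‖ < R} := by
      ext t
      simp [hOdef, add_mul_I_mem_strip hs t]
    simpa only [hline, one_mul] using H.ofReal_le_length_of_separates h0 ha hbA hb hδa hδR hs
  have hle := length_area_of_differentiableOn hO (H.holo.mono inter_subset_left)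
    ((H.injOn_reProdIm le_rfl le_rfl).mono inter_subset_right) (measurable_const (a := 1)) hlen
  have harea : ∫⁻ _ in Φ '' (O ∩ Ioo 0 ℓ ×ℂ Ico 0 (2 * π)), 1 ^ 2 ≤
      ENNReal.ofReal (π * R ^ 2) := by
    rw [one_pow, setLIntegral_one]
    refine (measure_mono (image_subset_iff.2 fun _ hw => hw.1.2)).trans_eq ?_
    have hR : 0 ≤ R := by linarith [norm_nonneg b]
    rw [Complex.volume_ball, ← ENNReal.ofReal_pow hR, ← ENNReal.ofReal_coe_nnreal,
      ← ENNReal.ofReal_mul (by positivity), mul_comm, NNReal.coe_real_pi]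
  have hbound := hle.trans (mul_le_mul_right harea _)
  rw [sub_zero, sub_zero, ← ENNReal.ofReal_pow hδ, ← ENNReal.ofReal_mul (by positivity),
    ← ENNReal.ofReal_mul (by positivity), ENNReal.ofReal_le_ofReal_iff (by positivity)] at hbound
  linarith

end StripMap

theorem lintegral_roundAnnulus_inv_sq_le (hℓ : 0 < ℓ) :
    ∫⁻ z in roundAnnulus ℓ, (‖z‖ₑ⁻¹) ^ 2 ≤ ENNReal.ofReal (2 * π * ℓ) := by
  have H := stripMap_exp hℓ
  have himg : roundAnnulus ℓ ⊆ Complex.exp '' (Ioo 0 ℓ ×ℂ Ico 0 (2 * π)) := by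
    rw [← exp_image_strip]
    rintro _ ⟨w, hw, rfl⟩
    obtain ⟨t, ht, he⟩ := (H.periodic_loop hw).exists_mem_Ico₀ Real.two_pi_pos w.im
    refine ⟨w.re + t * Complex.I, ⟨by simpa [strip] using hw, by simpa using ht⟩, ?_⟩
    simpa only [Complex.re_add_im] using he.symm
  calc _ ≤ ∫⁻ z in Complex.exp '' (Ioo 0 ℓ ×ℂ Ico 0 (2 * π)), (‖z‖ₑ⁻¹) ^ 2 :=
        lintegral_mono_set himg
    _ = ∫⁻ _ in Ioo 0 ℓ ×ℂ Ico 0 (2 * π), 1 := by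
      rw [setLIntegral_image_of_hasDerivAt (measurableSet_reProdIm measurableSet_Ioo
        measurableSet_Ico) (fun w _ => Complex.hasDerivAt_exp w) (H.injOn_reProdIm le_rfl le_rfl)]
      refine lintegral_congr fun w => ?_
      rw [← mul_pow, ENNReal.mul_inv_cancel (by simp) (by simp), one_pow]
    _ = ENNReal.ofReal (2 * π * ℓ) := by
      rw [setLIntegral_reProdIm measurable_const]
      simp only [setLIntegral_const, one_mul, Real.volume_Ico, Real.volume_Ioo, sub_zero]
      rw [← ENNReal.ofReal_mul (by positivity)]

namespace StripMap

theorem ofReal_le_length_of_crosses (H : StripMap Ψ ℓ' B) {k : ℂ → ℂ}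
    (hkd : DifferentiableOn ℂ k B) (hk : ∀ w ∈ strip ℓ', k (Ψ w) = Complex.exp w)
    {γ γ' : ℝ → ℂ} (hγ : ∀ t, HasDerivAt γ (γ' t) t) (hp : Function.Periodic γ (2 * π))
    {t₀ t₁ : ℝ} (ht₀ : γ t₀ ∈ surrounded B) (ht₁ : γ t₁ ∉ B) (ht₁' : γ t₁ ∉ surrounded B) :
    ENNReal.ofReal ℓ' ≤ ∫⁻ t in Ico 0 (2 * π) ∩ γ ⁻¹' B,
      ‖k (γ t)‖ₑ⁻¹ * ‖deriv k (γ t) * γ' t‖ₑ := by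
  have hγc : Continuous γ := continuous_iff_continuousAt.2 fun t => (hγ t).continuousAt
  have hk0 : ∀ z ∈ B, k z ≠ 0 := by
    rw [← H.img]
    rintro _ ⟨w, hw, rfl⟩
    exact hk w hw ▸ Complex.exp_ne_zero w
  have hderiv : ∀ t ∈ Ico 0 (2 * π) ∩ γ ⁻¹' B, HasDerivAt (fun t => Real.log ‖k (γ t)‖)
      (deriv k (γ t) * γ' t / k (γ t)).re t := fun t ht =>
    hasDerivAt_log_norm (HasDerivAt.comp t
      (hkd.differentiableAt (H.isOpen.mem_nhds ht.2)).hasDerivAt (hγ t)) (hk0 _ ht.2)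
  refine le_of_eq_of_le (by rw [sub_zero]) (ofReal_sub_le_setLIntegral (x := 0) (y := ℓ')
    (measurableSet_Ico.inter (H.isOpen.preimage hγc).measurableSet) hderiv (fun t ht => ?_)
    fun y hy => ?_)
  · rw [← enorm_inv (hk0 _ ht.2), ← enorm_mul, enorm_le_iff_norm_le, ← div_eq_inv_mul]
    exact Complex.abs_re_le_norm _
  · -- The curve meets the core curve of level `y` of the ring `B`.
    obtain ⟨u, t, ht⟩ := H.exists_loop_mem (isPreconnected_range hγc) ⟨t₀, rfl⟩ ⟨t₁, rfl⟩
      ht₀ ht₁ ht₁' hy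
    obtain ⟨t', ht', he⟩ := hp.exists_mem_Ico₀ Real.two_pi_pos t
    have hu := add_mul_I_mem_strip hy u
    rw [ht] at he
    refine ⟨t', ⟨ht', mem_preimage.2 (he ▸ H.mem hu)⟩, ?_⟩
    simp only [← he, hk _ hu, Complex.norm_exp, Real.log_exp]
    simp

theorem ofReal_le_log_length_of_crosses (H : StripMap Φ ℓ A) (H' : StripMap Ψ ℓ' B) {k : ℂ → ℂ}
    (hkd : DifferentiableOn ℂ k B) (hk : ∀ w ∈ strip ℓ', k (Ψ w) = Complex.exp w) {s : ℝ}
    (hs : s ∈ Ioo 0 ℓ) {t₀ t₁ : ℝ} (ht₀ : Φ (s + t₀ * Complex.I) ∈ surrounded B)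
    (ht₁ : Φ (s + t₁ * Complex.I) ∉ B) (ht₁' : Φ (s + t₁ * Complex.I) ∉ surrounded B) :
    ENNReal.ofReal ℓ' ≤
      ∫⁻ t in Ico 0 (2 * π) ∩ {t : ℝ | (s + t * Complex.I : ℂ) ∈ strip ℓ ∩ Φ ⁻¹' B},
        ‖(k ∘ Φ) (s + t * Complex.I)‖ₑ⁻¹ * ‖deriv (k ∘ Φ) (s + t * Complex.I)‖ₑ := by
  have hline : {t : ℝ | (s + t * Complex.I : ℂ) ∈ strip ℓ ∩ Φ ⁻¹' B} =
      (fun t : ℝ => Φ (s + t * Complex.I)) ⁻¹' B := by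
    ext t
    exact and_iff_right (add_mul_I_mem_strip hs t)
  rw [hline]
  refine (H'.ofReal_le_length_of_crosses hkd hk (H.hasDerivAt_loop hs) (H.periodic_loop hs)
    ht₀ ht₁ ht₁').trans_eq (setLIntegral_congr_fun (measurableSet_Ico.inter
      (H'.isOpen.preimage (H.continuous_loop hs)).measurableSet) fun t ht => ?_)
  have hderiv := ((hkd.differentiableAt (H'.isOpen.mem_nhds ht.2)).hasDerivAt.comp _
    (H.analyticAt (add_mul_I_mem_strip hs t)).differentiableAt.hasDerivAt).deriv
  simp only [hderiv, ← mul_assoc, enorm_mul _ Complex.I, Function.comp_apply]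
  simp [enorm]

theorem mul_sub_le_of_crosses (H : StripMap Φ ℓ A) (H' : StripMap Ψ ℓ' B) {a b : ℝ} (ha : 0 ≤ a)
    (hb : b ≤ ℓ) (hin : ∀ s ∈ Ioo a b, ∃ t : ℝ, Φ (s + t * Complex.I) ∈ surrounded B)
    (hout : ∀ s ∈ Ioo a b, ∃ t : ℝ,
      Φ (s + t * Complex.I) ∉ B ∧ Φ (s + t * Complex.I) ∉ surrounded B) :
    ℓ' * (b - a) ≤ 4 * π ^ 2 := by
  obtain ⟨k, hkd, hki, hkB, hk⟩ := H'.exists_conformal (stripMap_exp H'.pos)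
  set O : Set ℂ := strip ℓ ∩ Φ ⁻¹' B
  have hO : IsOpen O := H.holo.continuousOn.isOpen_inter_preimage (isOpen_strip ℓ) H'.isOpen
  have hdiff : DifferentiableOn ℂ (k ∘ Φ) O :=
    hkd.comp (H.holo.mono inter_subset_left) inter_subset_right
  have hinj : InjOn (k ∘ Φ) (O ∩ Ioo a b ×ℂ Ico 0 (2 * π)) :=
    hki.comp ((H.injOn_reProdIm ha hb).mono inter_subset_right) fun w hw => hw.1.2
  have hle := length_area_of_differentiableOn hO hdiff hinj (ρ := fun z => ‖z‖ₑ⁻¹) (by fun_prop)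
    (l := ENNReal.ofReal ℓ') fun s hs => by
      obtain ⟨t₀, ht₀⟩ := hin s hs
      obtain ⟨t₁, ht₁, ht₁'⟩ := hout s hs
      exact H.ofReal_le_log_length_of_crosses H' hkd hk
        ⟨ha.trans_lt hs.1, hs.2.trans_le hb⟩ ht₀ ht₁ ht₁'
  have himg : k ∘ Φ '' (O ∩ Ioo a b ×ℂ Ico 0 (2 * π)) ⊆ roundAnnulus ℓ' :=
    image_subset_iff.2 fun w hw => hkB ▸ mem_image_of_mem k hw.1.2
  have hbound := hle.trans (mul_le_mul_right
    ((lintegral_mono_set himg).trans (lintegral_roundAnnulus_inv_sq_le H'.pos)) _)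
  have hpos := H'.pos
  rw [sub_zero, ← ENNReal.ofReal_pow hpos.le, ← ENNReal.ofReal_mul (by positivity),
    ← ENNReal.ofReal_mul (by positivity), ENNReal.ofReal_le_ofReal_iff (by positivity)] at hbound
  exact le_of_mul_le_mul_left (by linarith) hpos

end StripMap

end LengthArea

/-! ### Polynomial-like maps as branched coverings -/

theorem mem_connectedComponentIn_of_mem_closure {F : Set ℂ} {x y : ℂ} (hx : x ∈ F)
    (hy : y ∈ closure (connectedComponentIn F x)) (hyF : y ∈ F) :
    y ∈ connectedComponentIn F x :=
  have hpre : IsPreconnected (insert y (connectedComponentIn F x)) :=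
    isPreconnected_connectedComponentIn.subset_closure (subset_insert _ _)
      (insert_subset hy subset_closure)
  hpre.subset_connectedComponentIn (mem_insert_of_mem _ (mem_connectedComponentIn hx))
    (insert_subset hyF (connectedComponentIn_subset _ _)) (mem_insert _ _)

theorem exists_isOpen_injOn_of_ncard_fiber_le {X Y : Type*} [TopologicalSpace X] [T2Space X]
    [TopologicalSpace Y] {f : X → Y} {V : Set X} {z : X} (hV : IsOpen V) (hz : z ∈ V)
    (hf : ContinuousAt f z) (hopen : ∀ y ∈ V, f y = f z → 𝓝 (f z) ≤ map f (𝓝 y))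
    (hfin : {y | y ∈ V ∧ f y = f z}.Finite)
    (hcard : ∀ᶠ w in 𝓝 (f z), {y | y ∈ V ∧ f y = w}.Finite ∧
      {y | y ∈ V ∧ f y = w}.ncard ≤ {y | y ∈ V ∧ f y = f z}.ncard) :
    ∃ O, IsOpen O ∧ z ∈ O ∧ O ⊆ V ∧ InjOn f O := by
  set S := {y | y ∈ V ∧ f y = f z}
  have hzS : z ∈ S := ⟨hz, rfl⟩
  obtain ⟨N, hN, hdisj⟩ := hfin.t2_separation
  have hmeet : ∀ᶠ w in 𝓝 (f z), ∀ y ∈ S, ∃ x ∈ N y ∩ V, f x = w :=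
    (eventually_all_finite hfin).2 fun y hy => hopen y hy.1 hy.2
      (image_mem_map (((hN y).2.inter hV).mem_nhds ⟨(hN y).1, hy.1⟩))
  obtain ⟨O, hOs, hO, hzO⟩ := mem_nhds_iff.1 (inter_mem (hf.eventually (hmeet.and hcard))
    (((hN z).2.inter hV).mem_nhds ⟨(hN z).1, hz⟩))
  refine ⟨O, hO, hzO, fun y hy => (hOs hy).2.2, fun y₁ h₁ y₂ h₂ he => ?_⟩
  obtain ⟨⟨hp, hfin₁, hcard₁⟩, -⟩ := hOs h₁
  choose! p hpN hpf using hp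
  have hpinj : InjOn p S := fun x hx y hy hxy => by
    by_contra hne
    exact disjoint_left.1 (hdisj hx hy hne) (hpN x hx).1 (hxy ▸ (hpN y hy).1)
  have hfiber : p '' S = {y | y ∈ V ∧ f y = f y₁} :=
    eq_of_subset_of_ncard_le (image_subset_iff.2 fun x hx => ⟨(hpN x hx).2, hpf x hx⟩)
      (by rwa [hpinj.ncard_image]) hfin₁
  have hunique : ∀ y ∈ O, f y = f y₁ → y = p z := fun y hy hye => by
    obtain ⟨x, hx, rfl⟩ : y ∈ p '' S := hfiber ▸ ⟨(hOs hy).2.2, hye⟩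
    by_contra hne
    exact disjoint_left.1 (hdisj hx hzS fun h => hne (h ▸ rfl)) (hpN x hx).1 (hOs hy).2.1
  rw [hunique y₁ h₁ rfl, hunique y₂ h₂ he.symm]

theorem exists_eq_sub_pow_mul {f : ℂ → ℂ} {V : Set ℂ} {a : ℂ} (hV : IsOpen V)
    (hf : DifferentiableOn ℂ f V) (ha : a ∈ V) (h0 : ∀ z ∈ V, f z = 0 → z = a) :
    ∃ (n : ℕ) (v : ℂ → ℂ), ContinuousOn v V ∧ (∀ z ∈ V, v z ≠ 0) ∧
      ∀ z, f z = (z - a) ^ n * v z := by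
  classical
  have hne : ¬ ∀ᶠ z in 𝓝 a, f z = 0 := fun hc => by
    have hfalse : ∀ᶠ _ in 𝓝[≠] a, False := by
      filter_upwards [self_mem_nhdsWithin, nhdsWithin_le_nhds (hV.mem_nhds ha),
        nhdsWithin_le_nhds hc] with z hz hzV hz0 using hz (h0 z hzV hz0)
    exact hfalse.exists.elim fun _ => id
  obtain ⟨n, u, hu, hu0, hfu⟩ :=
    (hf.analyticAt (hV.mem_nhds ha)).exists_eventuallyEq_pow_smul_nonzero_iff.2 hne
  simp only [smul_eq_mul] at hfu
  set v := Function.update (fun z => f z / (z - a) ^ n) a (u a)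
  have hva : v a = u a := Function.update_self ..
  have hvne {z : ℂ} (hz : z ≠ a) : v z = f z / (z - a) ^ n := Function.update_of_ne hz ..
  have hfactor (z : ℂ) : f z = (z - a) ^ n * v z := by
    rcases eq_or_ne z a with rfl | hza
    · rw [hva, hfu.self_of_nhds]
    · rw [hvne hza, mul_div_cancel₀ _ (pow_ne_zero _ (sub_ne_zero.2 hza))]
  refine ⟨n, v, fun z hz => ContinuousAt.continuousWithinAt ?_, fun z hz hvz => ?_, hfactor⟩
  · rcases eq_or_ne z a with rfl | hza
    · refine continuousAt_update_same.2
        ((hu.continuousAt.tendsto.mono_left nhdsWithin_le_nhds).congr' ?_)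
      filter_upwards [self_mem_nhdsWithin, nhdsWithin_le_nhds hfu] with y hy hye
      rw [hye, mul_div_cancel_left₀ _ (pow_ne_zero _ (sub_ne_zero.2 hy))]
    · exact (continuousAt_update_of_ne hza).2 <|
        (hf.continuousOn.continuousAt (hV.mem_nhds hz)).div (by fun_prop)
          (pow_ne_zero _ (sub_ne_zero.2 hza))
  · obtain rfl := h0 z hz (by rw [hfactor z, hvz, mul_zero])
    exact hu0 (hva ▸ hvz)

theorem exists_eq_sub_pow_mul_exp {f : ℂ → ℂ} {V : Set ℂ} {a : ℂ} (hV : IsOpen V)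
    (hVs : IsSimplyConnected V) (hf : DifferentiableOn ℂ f V) (ha : a ∈ V)
    (h0 : ∀ z ∈ V, f z = 0 → z = a) :
    ∃ (n : ℕ) (l : ℂ → ℂ), ContinuousOn l V ∧
      ∀ z ∈ V, f z = (z - a) ^ n * Complex.exp (l z) := by
  obtain ⟨n, v, hvc, hv0, hfv⟩ := exists_eq_sub_pow_mul hV hf ha h0
  obtain ⟨l, hl, hle⟩ := Complex.exists_continuousOn_eqOn_exp_comp hVs hV hvc
    fun ⟨z, hz, hvz⟩ => hv0 z hz hvz
  exact ⟨n, l, hl, fun z hz => (hfv z).trans (congrArg _ (hle hz).symm)⟩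

namespace IsPolyLike

variable {d : ℕ} {g : ℂ → ℂ} {V U : Set ℂ}

theorem dom_subset_range (h : IsPolyLike d g V U) : V ⊆ U := subset_closure.trans h.closure_subset

theorem isPreconnected_dom (h : IsPolyLike d g V U) : IsPreconnected V :=
  h.disk_dom.2.isPathConnected.isConnected.isPreconnected

theorem analyticAt (h : IsPolyLike d g V U) {z : ℂ} (hz : z ∈ V) : AnalyticAt ℂ g z :=
  h.holo.analyticAt (h.disk_dom.1.mem_nhds hz)

theorem nhds_le_map (h : IsPolyLike d g V U) {z : ℂ} (hz : z ∈ V) : 𝓝 (g z) ≤ map g (𝓝 z) := by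
  refine (h.analyticAt hz).eventually_constant_or_nhds_le_map_nhds.resolve_left fun hc => ?_
  have hconst : EqOn g (fun _ => g z) V := AnalyticOnNhd.eqOn_of_preconnected_of_eventuallyEq
    (fun _ hy => h.analyticAt hy) (fun _ _ => analyticAt_const) h.isPreconnected_dom hz hc
  have hfalse : ∀ᶠ _ in 𝓝[≠] (0 : ℂ), False := by
    filter_upwards [self_mem_nhdsWithin,
      nhdsWithin_le_nhds (h.disk_dom.1.mem_nhds h.zero_mem)] with y hy hyV
    exact hy (h.fiber_crit y hyV ((hconst hyV).trans (hconst h.zero_mem).symm))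
  exact hfalse.exists.elim fun _ => id

theorem isOpen_image (h : IsPolyLike d g V U) {O : Set ℂ} (hO : IsOpen O) (hOV : O ⊆ V) :
    IsOpen (g '' O) := by
  rw [isOpen_iff_mem_nhds]
  rintro _ ⟨w, hw, rfl⟩
  exact h.nhds_le_map (hOV hw) (image_mem_map (hO.mem_nhds hw))

theorem mapsTo_filled : MapsTo g (filled g V) (filled g V) := fun z hz j =>
  Function.iterate_succ_apply g j z ▸ hz (j + 1)

theorem isCompact_filled (h : IsPolyLike d g V U) : IsCompact (filled g V) := by
  have hK : IsCompact (V ∩ g ⁻¹' closure V) := h.proper _ h.closure_subset h.compact_closure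
  have hsub : filled g V ⊆ V ∩ g ⁻¹' closure V := fun z hz =>
    ⟨hz 0, subset_closure (mapsTo_filled hz 0)⟩
  have hcl : closure (filled g V) ⊆ V := fun z hz => (closure_minimal hsub hK.isClosed hz).1
  have hmap : MapsTo g (closure (filled g V)) (closure (filled g V)) := fun z hz =>
    (h.analyticAt (hcl hz)).continuousAt.continuousWithinAt.mem_closure hz mapsTo_filled
  exact hK.of_isClosed_subset
    (isClosed_of_closure_subset fun z hz j => hcl (hmap.iterate j hz)) hsub

theorem finite_fiber (hd : d ≠ 0) (h : IsPolyLike d g V U) {w : ℂ} (hw : w ∈ U) (hw0 : w ≠ g 0) :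
    {z | z ∈ V ∧ g z = w}.Finite :=
  finite_of_ncard_ne_zero (by rwa [h.fiber w hw hw0])

theorem exists_injOn (hd : d ≠ 0) (h : IsPolyLike d g V U) {z : ℂ} (hz : z ∈ V) (hz0 : z ≠ 0) :
    ∃ O, IsOpen O ∧ z ∈ O ∧ O ⊆ V ∧ InjOn g O := by
  have hgz : g z ∈ U \ {g 0} := ⟨h.mapsTo hz, fun he => hz0 (h.fiber_crit z hz he)⟩
  refine exists_isOpen_injOn_of_ncard_fiber_le h.disk_dom.1 hz (h.analyticAt hz).continuousAt
    (fun y hy hye => hye ▸ h.nhds_le_map hy) (h.finite_fiber hd hgz.1 hgz.2) ?_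
  filter_upwards [(h.disk_range.1.sdiff isClosed_singleton).mem_nhds hgz] with w hw
  exact ⟨h.finite_fiber hd hw.1 hw.2, by rw [h.fiber w hw.1 hw.2, h.fiber _ hgz.1 hgz.2]⟩

theorem deriv_ne_zero (hd : d ≠ 0) (h : IsPolyLike d g V U) {z : ℂ} (hz : z ∈ V) (hz0 : z ≠ 0) :
    deriv g z ≠ 0 :=
  have ⟨_, hO, hzO, hOV, hi⟩ := h.exists_injOn hd hz hz0
  deriv_ne_zero_of_injOn hO (h.holo.mono hOV) hi hzO

theorem isProperMap_restrict (h : IsPolyLike d g V U) :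
    IsProperMap (h.mapsTo.restrict g V U) := by
  have : LocallyCompactSpace U := h.disk_range.1.locallyCompactSpace
  refine isProperMap_iff_isCompact_preimage.2
    ⟨h.holo.continuousOn.mapsToRestrict h.mapsTo, fun K hK => ?_⟩
  have hpre : IsCompact (V ∩ g ⁻¹' (Subtype.val '' K)) :=
    h.proper _ (Subtype.coe_image_subset U K) (hK.image continuous_subtype_val)
  rw [Subtype.isCompact_iff]
  convert hpre using 1
  ext z
  constructor
  · rintro ⟨y, hy, rfl⟩
    exact ⟨y.2, _, hy, rfl⟩
  · rintro ⟨hz, y, hy, he⟩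
    have hzy : h.mapsTo.restrict g V U ⟨z, hz⟩ = y := Subtype.ext he.symm
    exact ⟨⟨z, hz⟩, mem_preimage.2 (hzy ▸ hy), rfl⟩

theorem isLocalHomeomorphOn_restrict (hd : d ≠ 0) (h : IsPolyLike d g V U) :
    IsLocalHomeomorphOn (h.mapsTo.restrict g V U) {z | (z : ℂ) ≠ 0} := by
  rw [isLocalHomeomorphOn_iff_isOpenEmbedding_restrict]
  intro z hz
  obtain ⟨O, hO, hzO, -, hi⟩ := h.exists_injOn hd z.2 hz
  refine ⟨Subtype.val ⁻¹' O, (hO.preimage continuous_subtype_val).mem_nhds hzO,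
    .of_continuous_injective_isOpenMap
      (h.isProperMap_restrict.continuous.comp continuous_subtype_val)
      (fun x y hxy => Subtype.ext (Subtype.ext (hi x.2 y.2 (congrArg Subtype.val hxy))))
      fun B hB => ?_⟩
  have hBopen : IsOpen (Subtype.val '' (Subtype.val '' B : Set V)) :=
    h.disk_dom.1.isOpenMap_subtype_val _
      ((hO.preimage continuous_subtype_val).isOpenMap_subtype_val _ hB)
  rw [h.disk_range.1.isOpenEmbedding_subtypeVal.isOpen_iff_image_isOpen]
  convert h.isOpen_image hBopen (Subtype.coe_image_subset _ _) using 1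
  simp only [image_image]
  rfl

theorem isCoveringMapOn (hd : d ≠ 0) (h : IsPolyLike d g V U) :
    IsCoveringMapOn (h.mapsTo.restrict g V U) {w | (w : ℂ) ≠ g 0} := by
  refine h.isProperMap_restrict.isClosedMap.isCoveringMapOn_of_isLocalHomeomorphOn
    (fun w hw => ?_) ((h.isLocalHomeomorphOn_restrict hd).mono ?_)
  · refine Finite.of_finite_image (f := Subtype.val) ((h.finite_fiber hd w.2 hw).subset ?_)
      Subtype.val_injective.injOn
    rintro _ ⟨y, hy, rfl⟩
    exact ⟨y.2, congrArg Subtype.val hy⟩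
  · exact fun z hz hz0 => hz (congrArg g hz0)

theorem eqOn_of_lift (hd : d ≠ 0) (h : IsPolyLike d g V U) {S : Set ℂ} (hS : IsPreconnected S)
    {ψ₁ ψ₂ : ℂ → ℂ} (h₁ : ContinuousOn ψ₁ S) (h₂ : ContinuousOn ψ₂ S)
    (hm₁ : MapsTo ψ₁ S (V \ {0})) (hm₂ : MapsTo ψ₂ S (V \ {0}))
    (he : ∀ w ∈ S, g (ψ₁ w) = g (ψ₂ w)) {w₀ : ℂ} (hw₀ : w₀ ∈ S) (h0 : ψ₁ w₀ = ψ₂ w₀) :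
    EqOn ψ₁ ψ₂ S := by
  have hinj : IsLocallyInjective ((V \ {0}).domRestrict g) := fun z => by
    obtain ⟨O, hO, hzO, -, hi⟩ := h.exists_injOn hd z.2.1 z.2.2
    exact ⟨Subtype.val ⁻¹' O, hO.preimage continuous_subtype_val, hzO,
      fun x hx y hy hxy => Subtype.ext (hi hx hy hxy)⟩
  have := isPreconnected_iff_preconnectedSpace.1 hS
  have heq := (T2Space.isSeparatedMap _).eq_of_comp_eq hinj (h₁.mapsToRestrict hm₁)
    (h₂.mapsToRestrict hm₂) (funext fun w => he w w.2) ⟨w₀, hw₀⟩ (Subtype.ext h0)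
  exact fun w hw => congrArg Subtype.val (congrFun heq ⟨w, hw⟩)

theorem exists_mem_closure_eq (h : IsPolyLike d g V U) {C : Set ℂ} (hC : C ⊆ V) {y : ℂ}
    (hyU : y ∈ U) (hy : y ∈ closure (g '' C)) : ∃ x ∈ closure C, x ∈ V ∧ g x = y := by
  obtain ⟨T, hT, hTU, hTc⟩ := local_compact_nhds (h.disk_range.1.mem_nhds hyU)
  have hK : IsCompact (g '' (closure C ∩ (V ∩ g ⁻¹' T))) :=
    ((h.proper T hTU hTc).inter_left isClosed_closure).image_of_continuousOn
      (h.holo.continuousOn.mono (inter_subset_right.trans inter_subset_left))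
  have hsub : g '' C ∩ T ⊆ g '' (closure C ∩ (V ∩ g ⁻¹' T)) := by
    rintro _ ⟨⟨x, hx, rfl⟩, hxT⟩
    exact ⟨x, ⟨subset_closure hx, hC hx, hxT⟩, rfl⟩
  obtain ⟨x, ⟨hxC, hxV, -⟩, rfl⟩ :=
    closure_minimal hsub hK.isClosed <|
    closure_mono (inter_subset_inter_right _ interior_subset)
      (isOpen_interior.closure_inter ⟨hy, mem_interior_iff_mem_nhds.2 hT⟩)
  exact ⟨x, hxC, hxV, rfl⟩

theorem isPreconnected_preimage (h : IsPolyLike d g V U) (h0 : g 0 ∈ V) :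
    IsPreconnected (V ∩ g ⁻¹' V) := by
  set W := V ∩ g ⁻¹' V
  have hW : IsOpen W := h.holo.continuousOn.isOpen_inter_preimage h.disk_dom.1 h.disk_dom.1
  suffices hcomp : ∀ z ∈ W, (0 : ℂ) ∈ connectedComponentIn W z by
    have hWeq : W = connectedComponentIn W 0 :=
      Subset.antisymm (fun z hz => connectedComponentIn_eq (hcomp z hz) ▸
        mem_connectedComponentIn hz) (connectedComponentIn_subset _ _)
    exact hWeq ▸ isPreconnected_connectedComponentIn
  intro z hz
  have hCW : connectedComponentIn W z ⊆ W := connectedComponentIn_subset _ _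
  have hsurj : V ⊆ g '' connectedComponentIn W z :=
    h.isPreconnected_dom.subset_of_closure_inter_subset
      (h.isOpen_image hW.connectedComponentIn (hCW.trans inter_subset_left))
      ⟨g z, hz.2, z, mem_connectedComponentIn hz, rfl⟩ fun y ⟨hy, hyV⟩ => by
        obtain ⟨x, hx, hxV, rfl⟩ := h.exists_mem_closure_eq (hCW.trans inter_subset_left)
          (h.dom_subset_range hyV) hy
        exact ⟨x, mem_connectedComponentIn_of_mem_closure hz hx ⟨hxV, hyV⟩, rfl⟩
  obtain ⟨y, hy, hye⟩ := hsurj h0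
  rwa [h.fiber_crit y (hCW hy).1 hye] at hy

end IsPolyLike

/-! ### Pulling back ring domains -/

theorem exists_pos_forall_mem_iff_dvd (G : AddSubgroup ℤ) {m : ℕ} (hm : 0 < m)
    (hmG : (m : ℤ) ∈ G) : ∃ k : ℕ, 0 < k ∧ k ≤ m ∧ ∀ j : ℤ, j ∈ G ↔ (k : ℤ) ∣ j := by
  obtain ⟨a, ha⟩ := Int.subgroup_cyclic G
  have hiff (j : ℤ) : j ∈ G ↔ (a.natAbs : ℤ) ∣ j := by
    rw [Int.natAbs_dvd]
    simp [ha, AddSubgroup.mem_closure_singleton, dvd_iff_exists_eq_mul_left, eq_comm]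
  have hdvd : a.natAbs ∣ m := Int.natCast_dvd_natCast.1 ((hiff m).1 hmG)
  exact ⟨a.natAbs, Nat.pos_of_dvd_of_pos hdvd hm, Nat.le_of_dvd hm hdvd, hiff⟩

section StripPeriods

variable {ℓ : ℝ} {Φ g ψ : ℂ → ℂ} {A V U : Set ℂ} {d k : ℕ}

/-- The group of integers `j` such that the translation by `2πij` leaves `ψ` invariant on the strip
of width `ℓ`. -/
def stripPeriods (ψ : ℂ → ℂ) (ℓ : ℝ) : AddSubgroup ℤ where
  carrier := {j | ∀ w ∈ strip ℓ, ψ (w + j * (2 * π * Complex.I)) = ψ w}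
  zero_mem' := by simp
  add_mem' := fun {i j} hi hj w hw => by
    rw [← hi w hw, ← hj _ (add_mem_strip hw i)]
    push_cast
    ring_nf
  neg_mem' := fun {j} hj w hw => by
    rw [← hj _ (add_mem_strip hw (-j))]
    push_cast
    ring_nf

theorem StripMap.comp_mul_of_lift (H : StripMap Φ ℓ A) (hψ : DifferentiableOn ℂ ψ (strip ℓ))
    (hlift : ∀ w ∈ strip ℓ, g (ψ w) = Φ w) (hk : 0 < k) (hkψ : (k : ℤ) ∈ stripPeriods ψ ℓ)
    (hdvd : ∀ w ∈ strip ℓ, ∀ j : ℤ, ψ (w + j * (2 * π * Complex.I)) = ψ w → (k : ℤ) ∣ j) :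
    StripMap (fun w => ψ (k * w)) (ℓ / k) ((fun w => ψ (k * w)) '' strip (ℓ / k)) := by
  have hkpos : (0 : ℝ) < k := Nat.cast_pos.2 hk
  have hmaps : MapsTo (fun w : ℂ => k * w) (strip (ℓ / k)) (strip ℓ) := fun w hw => by
    simpa [strip, hkpos, lt_div_iff₀' hkpos] using hw
  refine ⟨div_pos H.pos hkpos, hψ.comp (by fun_prop) hmaps, fun w hw => ?_,
    fun w hw w' hw' he => ?_, rfl⟩
  · rw [mul_add, ← hkψ _ (hmaps hw), Int.cast_natCast]
  · obtain ⟨j, hj⟩ := H.inj _ (hmaps hw) _ (hmaps hw') <| by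
      rw [← hlift _ (hmaps hw), ← hlift _ (hmaps hw')]
      exact congrArg g he
    obtain ⟨q, rfl⟩ := hdvd _ (hmaps hw') j (by rw [← hj]; exact he)
    refine ⟨q, mul_left_cancel₀ (Nat.cast_ne_zero.2 hk.ne' : (k : ℂ) ≠ 0) (hj.trans ?_)⟩
    push_cast
    ring

namespace IsPolyLike

theorem exists_strip_lift (hd : d ≠ 0) (h : IsPolyLike d g V U) (hℓ : 0 < ℓ)
    (hΦ : ContinuousOn Φ (strip ℓ)) (hΦU : MapsTo Φ (strip ℓ) (U \ {g 0})) {w₀ e₀ : ℂ}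
    (hw₀ : w₀ ∈ strip ℓ) (he₀ : e₀ ∈ V) (he : g e₀ = Φ w₀) :
    ∃ ψ : ℂ → ℂ, ContinuousOn ψ (strip ℓ) ∧ MapsTo ψ (strip ℓ) V ∧
      ∀ w ∈ strip ℓ, g (ψ w) = Φ w := by
  classical
  have := (isSimplyConnected_strip hℓ).simplyConnectedSpace
  have := (isOpen_strip ℓ).locallyPathConnectedSpace
  obtain ⟨F, ⟨-, hF⟩, -⟩ := (h.isCoveringMapOn hd).existsUnique_continuousMap_lifts
    (A := strip ℓ) ⟨fun w => (⟨Φ w, (hΦU w.2).1⟩ : U),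
      (continuousOn_iff_continuous_domRestrict.1 hΦ).subtype_mk _⟩ (a₀ := ⟨w₀, hw₀⟩)
    (e₀ := ⟨e₀, he₀⟩) (Subtype.ext he) (fun w => (hΦU w.2).2)
  obtain ⟨ψ, hψ⟩ : ∃ ψ : ℂ → ℂ, ∀ w : strip ℓ, ψ w = F w :=
    ⟨fun w => if hw : w ∈ strip ℓ then F ⟨w, hw⟩ else 0, by simp⟩
  refine ⟨ψ, ?_, fun w hw => ?_, fun w hw => ?_⟩
  · rw [continuousOn_iff_continuous_domRestrict]
    exact (continuous_subtype_val.comp F.continuous).congr fun w => (hψ w).symm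
  · exact hψ ⟨w, hw⟩ ▸ (F _).2
  · rw [hψ ⟨w, hw⟩]
    exact congrArg Subtype.val (congrFun hF ⟨w, hw⟩)

theorem exists_differentiableOn_strip_lift (hd : d ≠ 0) (h : IsPolyLike d g V U)
    (H : StripMap Φ ℓ A) (hAU : A ⊆ U \ {g 0}) :
    ∃ ψ : ℂ → ℂ, DifferentiableOn ℂ ψ (strip ℓ) ∧ MapsTo ψ (strip ℓ) (V \ {0}) ∧
      ∀ w ∈ strip ℓ, g (ψ w) = Φ w := by
  have hw₀ : ((ℓ / 2 : ℝ) : ℂ) ∈ strip ℓ := by simp [strip, H.pos]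
  have hΦw₀ := hAU (H.mem hw₀)
  obtain ⟨e₀, he₀V, he₀⟩ : {z | z ∈ V ∧ g z = Φ (ℓ / 2 : ℝ)}.Nonempty := by
    rwa [← ncard_pos (h.finite_fiber hd hΦw₀.1 hΦw₀.2), h.fiber _ hΦw₀.1 hΦw₀.2,
      Nat.pos_iff_ne_zero]
  obtain ⟨ψ, hψc, hψV, hlift⟩ := h.exists_strip_lift hd H.pos H.holo.continuousOn
    (fun _ hw => hAU (H.mem hw)) hw₀ he₀V he₀
  have hψ0 : ∀ w ∈ strip ℓ, ψ w ≠ 0 := fun w hw hz =>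
    (hAU (H.mem hw)).2 (by rw [← hlift w hw, hz, mem_singleton_iff])
  refine ⟨ψ, fun w hw => ?_, fun w hw => ⟨hψV hw, hψ0 w hw⟩, hlift⟩
  have hnhds := (isOpen_strip ℓ).mem_nhds hw
  exact (differentiableAt_of_lift (hψc.continuousAt hnhds) (h.analyticAt (hψV hw))
    (h.deriv_ne_zero hd (hψV hw) (hψ0 w hw)) (H.analyticAt hw).differentiableAt
    (eventually_of_mem hnhds hlift)).differentiableWithinAt

theorem mem_stripPeriods_of_apply_eq (hd : d ≠ 0) (h : IsPolyLike d g V U) (H : StripMap Φ ℓ A)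
    (hψ : ContinuousOn ψ (strip ℓ)) (hψV : MapsTo ψ (strip ℓ) (V \ {0}))
    (hlift : ∀ w ∈ strip ℓ, g (ψ w) = Φ w) {w₀ : ℂ} (hw₀ : w₀ ∈ strip ℓ) {j : ℤ}
    (he : ψ (w₀ + j * (2 * π * Complex.I)) = ψ w₀) : j ∈ stripPeriods ψ ℓ :=
  have hmaps : MapsTo (fun w => w + j * (2 * π * Complex.I)) (strip ℓ) (strip ℓ) :=
    fun _ hw => add_mem_strip hw j
  h.eqOn_of_lift hd (convex_strip ℓ).isPreconnected (hψ.comp (by fun_prop) hmaps) hψ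
    (hψV.comp hmaps) hψV
    (fun w hw => by rw [hlift _ (hmaps hw), hlift w hw, H.apply_add_int hw])
    hw₀ he

theorem exists_pos_mem_stripPeriods (hd : d ≠ 0) (h : IsPolyLike d g V U) (H : StripMap Φ ℓ A)
    (hAU : A ⊆ U \ {g 0}) (hψ : ContinuousOn ψ (strip ℓ)) (hψV : MapsTo ψ (strip ℓ) (V \ {0}))
    (hlift : ∀ w ∈ strip ℓ, g (ψ w) = Φ w) :
    ∃ m : ℕ, 0 < m ∧ m ≤ d ∧ (m : ℤ) ∈ stripPeriods ψ ℓ := by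
  have hw₀ : ((ℓ / 2 : ℝ) : ℂ) ∈ strip ℓ := by simp [strip, H.pos]
  have hΦw₀ := hAU (H.mem hw₀)
  have hmaps : MapsTo (fun i : ℕ => ψ ((ℓ / 2 : ℝ) + (i : ℤ) * (2 * π * Complex.I)))
      (Finset.range (d + 1)) {z | z ∈ V ∧ g z = Φ (ℓ / 2 : ℝ)} := fun i _ =>
    have hmem := add_mem_strip hw₀ i
    ⟨(hψV hmem).1, by rw [hlift _ hmem, H.apply_add_int hw₀]⟩
  obtain ⟨i, hi, j, hj, hij, he⟩ := exists_ne_map_eq_of_ncard_lt_of_maps_to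
    (by rw [h.fiber _ hΦw₀.1 hΦw₀.2, ncard_coe_finset, Finset.card_range]; exact d.lt_succ_self)
    hmaps (h.finite_fiber hd hΦw₀.1 hΦw₀.2)
  wlog hlt : i < j generalizing i j
  · exact this j hj i hi hij.symm he.symm (by lia)
  have hjd : j < d + 1 := Finset.mem_range.1 hj
  refine ⟨j - i, by lia, by lia,
    h.mem_stripPeriods_of_apply_eq hd H hψ hψV hlift (add_mem_strip hw₀ i) (he.symm ▸ ?_)⟩
  rw [Nat.cast_sub hlt.le]
  push_cast
  ring_nf

theorem zero_mem_surrounded_of_lift {A' : Set ℂ} (h : IsPolyLike d g V U) (H : StripMap Φ ℓ A)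
    (hk : 0 < k) (H' : StripMap (fun w => ψ (k * w)) (ℓ / k) A') (hA'V : A' ⊆ V \ {0})
    (hlift : ∀ w ∈ strip ℓ, g (ψ w) = Φ w) (h0 : g 0 ∈ surrounded A) : 0 ∈ surrounded A' := by
  have hs : ℓ / 2 ∈ Ioo 0 ℓ := ⟨half_pos H.pos, half_lt_self H.pos⟩
  have hs' : ℓ / k / 2 ∈ Ioo 0 (ℓ / k) := ⟨half_pos H'.pos, half_lt_self H'.pos⟩
  refine H'.mem_surrounded (fun h0A' => (hA'V h0A').2 rfl) hs' fun hwind => ?_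
  set σ : ℝ → ℂ := fun t => ψ (k * ((ℓ / k / 2 : ℝ) + t * Complex.I))
  have hσV : ∀ t, σ t ∈ V := fun t => (hA'V (H'.loop_mem hs' t)).1
  obtain ⟨n, l, hl, hgl⟩ := exists_eq_sub_pow_mul_exp h.disk_dom.1 h.disk_dom.2
    (h.holo.sub_const (g 0)) h.zero_mem fun z hz he => h.fiber_crit z hz (sub_eq_zero.1 he)
  have hwind_g : Winds (fun t => g (σ t) - g 0) (n * 0 + 0) := by
    simp only [hgl _ (hσV _)]
    exact (hwind.pow n).mul (Winds.exp_comp (hl.comp_continuous (H'.continuous_loop hs') hσV)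
      fun t => congrArg l (H'.periodic_loop hs' t))
  obtain ⟨n₀, hn₀⟩ := Winds.exists_of_periodic (γ := fun t => Φ ((ℓ / 2 : ℝ) + t * Complex.I) - g 0)
    ((H.continuous_loop hs).sub continuous_const)
    (fun t he => h0.1 (sub_eq_zero.1 he ▸ H.loop_mem hs t))
    fun t => congrArg (· - g 0) (H.periodic_loop hs t)
  have hwind_k := hn₀.comp_mul k
  have hloop (t : ℝ) : Φ ((ℓ / 2 : ℝ) + (k * t : ℝ) * Complex.I) = g (σ t) := by
    rw [← hlift _ (add_mul_I_mem_strip hs _)]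
    refine congrArg g (congrArg ψ ?_)
    have hkC : (k : ℂ) ≠ 0 := Nat.cast_ne_zero.2 hk.ne'
    push_cast
    field_simp
  simp only [hloop] at hwind_k
  have hn₀0 : n₀ = 0 := by
    simpa [hk.ne'] using hwind_k.unique hwind_g
  exact H.not_winds_loop_sub_zero h0 hs (hn₀0 ▸ hn₀)

theorem exists_ring_pullback (hd : d ≠ 0) (h : IsPolyLike d g V U) (h0 : g 0 ∈ V) {m : ℝ}
    (hA : IsRing A m) (hAU : A ⊆ U \ V) (hVA : V ⊆ surrounded A) :
    ∃ A' m', IsRing A' m' ∧ m ≤ d * m' ∧ A' ⊆ V \ (V ∩ g ⁻¹' V) ∧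
      V ∩ g ⁻¹' V ⊆ surrounded A' := by
  obtain ⟨Φ, H⟩ := hA.exists_stripMap
  have hAU0 : A ⊆ U \ {g 0} := hAU.trans (sdiff_subset_sdiff_right (singleton_subset_iff.2 h0))
  obtain ⟨ψ, hψ, hψV, hlift⟩ := h.exists_differentiableOn_strip_lift hd H hAU0
  obtain ⟨n, hn, hnd, hnψ⟩ :=
    h.exists_pos_mem_stripPeriods hd H hAU0 hψ.continuousOn hψV hlift
  obtain ⟨k, hk, hkn, hkψ⟩ := exists_pos_forall_mem_iff_dvd _ hn hnψ
  have H' := H.comp_mul_of_lift hψ hlift hk ((hkψ k).2 dvd_rfl) fun w hw j he =>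
    (hkψ j).1 (h.mem_stripPeriods_of_apply_eq hd H hψ.continuousOn hψV hlift hw he)
  set A' := (fun w => ψ (k * w)) '' strip (2 * π * m / k)
  have hkpos : (0 : ℝ) < k := Nat.cast_pos.2 hk
  have hA' : A' ⊆ V \ {0} ∩ g ⁻¹' A := by
    rintro _ ⟨w, hw, rfl⟩
    have hkw : (k : ℂ) * w ∈ strip (2 * π * m) := by
      simpa [strip, hkpos, lt_div_iff₀' hkpos] using hw
    exact ⟨hψV hkw, mem_preimage.2 (hlift _ hkw ▸ H.mem hkw)⟩
  have hdisj : V ∩ g ⁻¹' V ⊆ A'ᶜ := fun z hz hzA' => (hAU (hA' hzA').2).2 hz.2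
  have h0A' : 0 ∈ surrounded A' := h.zero_mem_surrounded_of_lift H hk H'
    (hA'.trans inter_subset_left) hlift (hVA h0)
  refine ⟨A', _, H'.isRing, ?_, fun z hz => ⟨(hA' hz).1.1, fun hzW => hdisj hzW hz⟩,
    fun z hz => ⟨hdisj hz, ?_⟩⟩
  · have hkd : (k : ℝ) ≤ d := Nat.cast_le.2 (hkn.trans hnd)
    calc m ≤ m * (d / k) := le_mul_of_one_le_right hA.1.le ((one_le_div hkpos).2 hkd)
      _ = d * (2 * π * m / k / (2 * π)) := by field_simp
  · exact connectedComponentIn_eq ((h.isPreconnected_preimage h0).subset_connectedComponentIn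
      ⟨h.zero_mem, h0⟩ hdisj hz) ▸ h0A'.2

theorem annMod_le (hd : d ≠ 0) (h : IsPolyLike d g V U) (h0 : g 0 ∈ V) :
    annMod U V ≤ d * annMod V (V ∩ g ⁻¹' V) := by
  refine iSup_le fun A => iSup_le fun m => iSup_le fun ⟨hA, hAU, hVA⟩ => ?_
  obtain ⟨A', m', hA', hm, hA'V, hW⟩ := h.exists_ring_pullback hd h0 hA hAU hVA
  calc ENNReal.ofReal m ≤ ENNReal.ofReal (d * m') := ENNReal.ofReal_le_ofReal hm
    _ = d * ENNReal.ofReal m' := by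
      rw [ENNReal.ofReal_mul d.cast_nonneg, ENNReal.ofReal_natCast]
    _ ≤ d * annMod V (V ∩ g ⁻¹' V) := by
      gcongr
      exact le_iSup_of_le A' (le_iSup_of_le m' (le_iSup_of_le ⟨hA', hA'V, hW⟩ le_rfl))

end IsPolyLike

end StripPeriods

theorem annMod_anti {U X Y : Set ℂ} (h : X ⊆ Y) : annMod U Y ≤ annMod U X :=
  iSup₂_mono fun _ _ => iSup_mono' fun ⟨hA, hAU, hYA⟩ =>
    ⟨⟨hA, hAU.trans (sdiff_subset_sdiff_right h), h.trans hYA⟩, le_rfl⟩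

section FilledJulia

variable {d : ℕ} {c : ℂ}

/-! ### Filled Julia sets of unicritical polynomials -/

theorem continuous_P : Continuous (P d c) := by
  unfold P
  fun_prop

theorem P_mem_filledJulia {z : ℂ} : P d c z ∈ filledJulia d c ↔ z ∈ filledJulia d c := by
  have h := tendsto_add_atTop_iff_nat (f := fun n : ℕ => (P d c)^[n] z)
    (l := Bornology.cobounded ℂ) 1
  simp only [Function.iterate_succ_apply] at h
  exact not_congr h

theorem iterate_P_mem_filledJulia {z : ℂ} (n : ℕ) :
    (P d c)^[n] z ∈ filledJulia d c ↔ z ∈ filledJulia d c := by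
  induction n with
  | zero => rfl
  | succ n ih => rw [Function.iterate_succ_apply', P_mem_filledJulia, ih]

theorem mem_filledJulia_of_norm_iterate_le {z : ℂ} {C : ℝ} (h : ∀ n : ℕ, ‖(P d c)^[n] z‖ ≤ C) :
    z ∈ filledJulia d c := fun ht =>
  let ⟨n, hn⟩ := ((tendsto_norm_atTop_iff_cobounded.2 ht).eventually_gt_atTop C).exists
  (h n).not_gt hn

theorem norm_mul_norm_sub_one_le_norm_P (hd : 2 ≤ d) {w : ℂ} (h1 : 1 ≤ ‖w‖) (hc : ‖c‖ ≤ ‖w‖) :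
    ‖w‖ * (‖w‖ - 1) ≤ ‖P d c w‖ := by
  have h2 : ‖w ^ d‖ - ‖c‖ ≤ ‖P d c w‖ := by simpa [P] using norm_sub_norm_le (w ^ d) (-c)
  have h3 : ‖w‖ ^ 2 ≤ ‖w ^ d‖ := by
    rw [norm_pow]
    exact pow_le_pow_right₀ h1 hd
  nlinarith

theorem norm_mul_pow_le_norm_iterate_P (hd : 2 ≤ d) {z : ℂ} (hz : 2 ≤ ‖z‖) (hc : ‖c‖ ≤ ‖z‖)
    (n : ℕ) : ‖z‖ * (‖z‖ - 1) ^ n ≤ ‖(P d c)^[n] z‖ := by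
  induction n with
  | zero => simp
  | succ n ih =>
    have hle : ‖z‖ ≤ ‖(P d c)^[n] z‖ :=
      (le_mul_of_one_le_right (norm_nonneg z) (one_le_pow₀ (by linarith))).trans ih
    rw [Function.iterate_succ_apply', pow_succ, ← mul_assoc]
    calc ‖z‖ * (‖z‖ - 1) ^ n * (‖z‖ - 1) ≤ ‖(P d c)^[n] z‖ * (‖(P d c)^[n] z‖ - 1) :=
          mul_le_mul ih (by linarith) (by linarith) (norm_nonneg _)
      _ ≤ _ := norm_mul_norm_sub_one_le_norm_P hd (by linarith) (hc.trans hle)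

theorem norm_le_norm_iterate_P (hd : 2 ≤ d) {z : ℂ} (hz : 2 ≤ ‖z‖) (hc : ‖c‖ ≤ ‖z‖) (n : ℕ) :
    ‖z‖ ≤ ‖(P d c)^[n] z‖ :=
  (le_mul_of_one_le_right (norm_nonneg z) (one_le_pow₀ (by linarith))).trans
    (norm_mul_pow_le_norm_iterate_P hd hz hc n)

theorem notMem_filledJulia_of_two_lt (hd : 2 ≤ d) {z : ℂ} (hz : 2 < ‖z‖) (hc : ‖c‖ ≤ ‖z‖) :
    z ∉ filledJulia d c := by
  refine not_not.2 (tendsto_norm_atTop_iff_cobounded.1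
    (tendsto_atTop_mono (norm_mul_pow_le_norm_iterate_P hd hz.le hc) ?_))
  exact (tendsto_pow_atTop_atTop_of_one_lt (by linarith)).const_mul_atTop (by linarith)

theorem filledJulia_subset_closedBall (hd : 2 ≤ d) (h0 : (0 : ℂ) ∈ filledJulia d c) :
    filledJulia d c ⊆ Metric.closedBall 0 2 := by
  have hcJ : c ∈ filledJulia d c := by
    simpa [P, show d ≠ 0 by lia] using P_mem_filledJulia.2 h0
  have hc2 : ‖c‖ ≤ 2 := by
    by_contra! h
    exact notMem_filledJulia_of_two_lt hd h le_rfl hcJ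
  intro z hz
  rw [mem_closedBall_zero_iff]
  by_contra! h
  exact notMem_filledJulia_of_two_lt hd h (hc2.trans h.le) hz

end FilledJulia

/-! ### The Böttcher coordinate -/

theorem isPreconnected_setOf_lt_norm {ρ : ℝ} (hρ : 0 < ρ) : IsPreconnected {w : ℂ | ρ < ‖w‖} := by
  have himg : {w : ℂ | ρ < ‖w‖} = Complex.exp '' {w | Real.log ρ < w.re} := by
    ext w
    constructor
    · intro hw
      refine ⟨Complex.log w, ?_, Complex.exp_log (norm_pos_iff.1 (hρ.trans hw))⟩
      rw [mem_ofPred_eq, Complex.log_re]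
      exact Real.log_lt_log hρ hw
    · rintro ⟨v, hv, rfl⟩
      rw [mem_ofPred_eq, Complex.norm_exp]
      exact (Real.log_lt_iff_lt_exp hρ).1 hv
  rw [himg]
  exact (convex_halfSpace_re_gt _).isPreconnected.image _ Complex.continuous_exp.continuousOn

theorem exists_forall_norm_pow_sub_one_lt_imp_eq_one {d : ℕ} (hd : 2 ≤ d) :
    ∃ δ > 0, ∀ v : ℂ, (∀ j : ℕ, ‖v ^ d ^ j - 1‖ < δ) → v = 1 := by
  have hcont : Continuous fun v : ℂ => ‖∑ i ∈ Finset.range d, v ^ i‖ := by fun_prop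
  have hgt : ∀ᶠ v in 𝓝 (1 : ℂ), (3 / 2 : ℝ) < ‖∑ i ∈ Finset.range d, v ^ i‖ := by
    refine hcont.continuousAt.eventually_const_lt ?_
    have : (2 : ℝ) ≤ d := mod_cast hd
    simp only [one_pow, Finset.sum_const, Finset.card_range, nsmul_eq_mul, mul_one,
      Complex.norm_natCast]
    linarith
  obtain ⟨δ, hδ, hball⟩ := Metric.eventually_nhds_iff.1 hgt
  refine ⟨δ, hδ, fun v hv => ?_⟩
  have hexpand : ∀ j : ℕ, (3 / 2 : ℝ) ^ j * ‖v - 1‖ ≤ ‖v ^ d ^ j - 1‖ := by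
    intro j
    induction j with
    | zero => simp
    | succ j ih =>
      have hfac : v ^ d ^ (j + 1) - 1 =
          (∑ i ∈ Finset.range d, (v ^ d ^ j) ^ i) * (v ^ d ^ j - 1) := by
        rw [geom_sum_mul, ← pow_mul, pow_succ]
      rw [hfac, norm_mul, pow_succ', mul_assoc]
      exact mul_le_mul (hball (by simpa only [dist_eq_norm] using hv j)).le ih (by positivity)
        (norm_nonneg _)
  by_contra hne
  have hpos : 0 < ‖v - 1‖ := norm_pos_iff.2 (sub_ne_zero.2 hne)
  obtain ⟨j, hj⟩ := pow_unbounded_of_one_lt (δ / ‖v - 1‖) (by norm_num : (1 : ℝ) < 3 / 2)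
  rw [div_lt_iff₀ hpos] at hj
  exact (hj.trans_le (hexpand j)).not_gt (hv j)

namespace IsBottcher

variable {d : ℕ} {c : ℂ} {B : ℂ → ℂ}

theorem ne_zero (hB : IsBottcher d c B) {z : ℂ} (hz : z ∉ filledJulia d c) : B z ≠ 0 :=
  norm_pos_iff.1 (one_pos.trans (hB.bij.mapsTo hz))

theorem apply_iterate (hB : IsBottcher d c B) {z : ℂ} (hz : z ∉ filledJulia d c) (n : ℕ) :
    B ((P d c)^[n] z) = B z ^ d ^ n := by
  induction n with
  | zero => simp
  | succ n ih =>
    rw [Function.iterate_succ_apply', hB.conj _ (mt (iterate_P_mem_filledJulia n).1 hz), ih,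
      ← pow_mul, pow_succ]

theorem openEmb (hB : IsBottcher d c B) (hJ : IsClosed (filledJulia d c)) :
    OpenEmb B (filledJulia d c)ᶜ := by
  refine ⟨hB.holo.continuousOn, hB.bij.injOn, fun O hOs hO => isOpen_iff_mem_nhds.2 ?_⟩
  rintro _ ⟨z, hz, rfl⟩
  rw [← map_nhds_eq_of_injOn hJ.isOpen_compl hB.holo hB.bij.injOn (hOs hz)]
  exact image_mem_map (hO.mem_nhds hz)

theorem continuousOn_invFunOn (hB : IsBottcher d c B) (hJ : IsClosed (filledJulia d c)) :
    ContinuousOn (Function.invFunOn B (filledJulia d c)ᶜ) {w | 1 < ‖w‖} := by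
  simpa only [hB.bij.image_eq] using (hB.openEmb hJ).continuousOn_invFunOn hJ.isOpen_compl

theorem isPreconnected_setOf_lt_norm (hB : IsBottcher d c B) (hJ : IsClosed (filledJulia d c))
    {ρ : ℝ} (hρ : 1 ≤ ρ) : IsPreconnected {z | z ∉ filledJulia d c ∧ ρ < ‖B z‖} := by
  have himg : Function.invFunOn B (filledJulia d c)ᶜ '' {w | ρ < ‖w‖} =
      {z | z ∉ filledJulia d c ∧ ρ < ‖B z‖} := by
    refine Subset.antisymm ?_ fun z hz => ⟨B z, hz.2, hB.bij.injOn.leftInvOn_invFunOn hz.1⟩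
    rintro _ ⟨w, hw, rfl⟩
    have hw' : w ∈ B '' (filledJulia d c)ᶜ := hB.bij.image_eq ▸ hρ.trans_lt hw
    exact ⟨Function.invFunOn_mem hw', by rwa [Function.invFunOn_eq hw']⟩
  rw [← himg]
  exact (GlueSpace.isPreconnected_setOf_lt_norm (one_pos.trans_le hρ)).image _
    ((hB.continuousOn_invFunOn hJ).mono fun w hw => hρ.trans_lt hw)

theorem isPreconnected_compl (hB : IsBottcher d c B) (hJ : IsClosed (filledJulia d c)) :
    IsPreconnected (filledJulia d c)ᶜ := by
  convert hB.isPreconnected_setOf_lt_norm hJ le_rfl using 1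
  exact ext fun z => ⟨fun hz => ⟨hz, hB.bij.mapsTo hz⟩, fun hz => hz.1⟩

theorem tendsto_norm (hB : IsBottcher d c B) :
    Tendsto (fun z => ‖B z‖) (Bornology.cobounded ℂ) atTop := by
  have hmul : Tendsto (fun z => ‖B z / z‖ * ‖z‖) (Bornology.cobounded ℂ) atTop :=
    hB.tangent.norm.pos_mul_atTop (by simp) tendsto_norm_cobounded_atTop
  refine hmul.congr' ?_
  filter_upwards [tendsto_norm_cobounded_atTop.eventually_gt_atTop (0 : ℝ)] with z hz
  rw [norm_div, div_mul_cancel₀ _ hz.ne']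

/-- The connected set where the coordinate exceeds its maximum over a circle around the Julia set
cannot cross that circle. -/
theorem exists_lt_norm (hB : IsBottcher d c B) (hJ : IsCompact (filledJulia d c)) (R : ℝ) :
    ∃ ρ : ℝ, ∀ z ∉ filledJulia d c, ρ < ‖B z‖ → R < ‖z‖ := by
  obtain ⟨R₁, hR₁⟩ := hJ.isBounded.subset_closedBall 0
  set R' := max R R₁ + 1
  have hsphere : Metric.sphere (0 : ℂ) R' ⊆ (filledJulia d c)ᶜ := by
    intro z hz hzJ
    have h1 := mem_closedBall_zero_iff.1 (hR₁ hzJ)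
    rw [mem_sphere_zero_iff_norm] at hz
    linarith [le_max_right R R₁]
  obtain ⟨M, hM⟩ := ((isCompact_sphere (0 : ℂ) R').image_of_continuousOn
    (hB.holo.continuousOn.mono hsphere)).isBounded.exists_norm_le
  have hpre := hB.isPreconnected_setOf_lt_norm hJ.isClosed (le_max_left 1 M)
  have houtside : ∀ᶠ z in Bornology.cobounded ℂ, z ∉ filledJulia d c := hJ.isBounded
  obtain ⟨z₁, hz₁J, hz₁, hz₁B⟩ := (houtside.and
    ((tendsto_norm_cobounded_atTop.eventually_gt_atTop R').and
      (hB.tendsto_norm.eventually_gt_atTop (max 1 M)))).exists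
  refine ⟨max 1 M, fun z hz hBz => ?_⟩
  by_contra! hle
  obtain ⟨x, hx, hxR⟩ := hpre.intermediate_value ⟨hz, hBz⟩ ⟨hz₁J, hz₁B⟩
    continuous_norm.continuousOn ⟨by linarith [le_max_left R R₁], hz₁.le⟩
  exact ((le_max_right 1 M).trans_lt hx.2).not_ge
    (hM _ (mem_image_of_mem B (mem_sphere_zero_iff_norm.2 hxR)))

theorem eventually_norm_lt (hB : IsBottcher d c B) (hJ : IsCompact (filledJulia d c)) {y : ℂ}
    (hy : y ∈ filledJulia d c) {r : ℝ} (hr : 1 < r) :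
    ∀ᶠ z in 𝓝 y, z ∉ filledJulia d c → ‖B z‖ < r := by
  obtain ⟨ρ, hρ⟩ := hB.exists_lt_norm hJ (‖y‖ + 1)
  set k := Function.invFunOn B (filledJulia d c)ᶜ
  have hC : IsCompact {w : ℂ | r ≤ ‖w‖ ∧ ‖w‖ ≤ ρ} :=
    (isCompact_closedBall (0 : ℂ) ρ).of_isClosed_subset
      ((isClosed_le continuous_const continuous_norm).inter
        (isClosed_le continuous_norm continuous_const))
      fun w hw => mem_closedBall_zero_iff.2 hw.2
  have hkC : IsCompact (k '' {w : ℂ | r ≤ ‖w‖ ∧ ‖w‖ ≤ ρ}) :=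
    hC.image_of_continuousOn ((hB.continuousOn_invFunOn hJ.isClosed).mono fun w hw =>
      hr.trans_le hw.1)
  have hyC : y ∉ k '' {w : ℂ | r ≤ ‖w‖ ∧ ‖w‖ ≤ ρ} := by
    rintro ⟨w, hw, rfl⟩
    have hw' : w ∈ B '' (filledJulia d c)ᶜ := hB.bij.image_eq ▸ hr.trans_le hw.1
    exact Function.invFunOn_mem hw' hy
  filter_upwards [hkC.isClosed.isOpen_compl.mem_nhds hyC, Metric.ball_mem_nhds y one_pos]
    with z hz hzb hzJ
  by_contra! hrz
  refine hz ⟨B z, ⟨hrz, ?_⟩, hB.bij.injOn.leftInvOn_invFunOn hzJ⟩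
  by_contra! hρz
  rw [mem_ball_iff_norm] at hzb
  linarith [hρ z hzJ hρz, norm_sub_norm_le z y]

theorem tendsto_div (hB : IsBottcher d c B) {B' : ℂ → ℂ} (hB' : IsBottcher d c B') :
    Tendsto (fun z => B' z / B z) (Bornology.cobounded ℂ) (𝓝 1) := by
  have h := hB'.tangent.div hB.tangent one_ne_zero
  rw [div_one] at h
  refine h.congr' ?_
  filter_upwards [tendsto_norm_cobounded_atTop.eventually_gt_atTop (0 : ℝ)] with z hz
  exact div_div_div_cancel_right₀ (norm_pos_iff.1 hz) _ _

/-- The quotient of two coordinates is raised to the power `d` along orbits and tends to `1` at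
infinity, a repelling fixed point of that power. -/
theorem eventually_eq (hd : 2 ≤ d) (hB : IsBottcher d c B) {B' : ℂ → ℂ} (hB' : IsBottcher d c B')
    (hJ : IsCompact (filledJulia d c)) : ∀ᶠ z in Bornology.cobounded ℂ, B' z = B z := by
  obtain ⟨δ, hδ, hpow⟩ := exists_forall_norm_pow_sub_one_lt_imp_eq_one hd
  have hev : ∀ᶠ z in Bornology.cobounded ℂ, ‖B' z / B z - 1‖ < δ ∧ z ∉ filledJulia d c := by
    refine Filter.Eventually.and ?_ hJ.isBounded
    simpa only [dist_eq_norm] using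
      (hB.tendsto_div hB').eventually (Metric.ball_mem_nhds (1 : ℂ) hδ)
  obtain ⟨R, -, hR⟩ := (Filter.hasBasis_cobounded_norm (E := ℂ)).eventually_iff.1 hev
  filter_upwards [tendsto_norm_cobounded_atTop.eventually_ge_atTop (max R (max 2 ‖c‖))] with z hz
  have hle := norm_le_norm_iterate_P hd
    (((le_max_left 2 ‖c‖).trans (le_max_right R _)).trans hz)
    (((le_max_right 2 ‖c‖).trans (le_max_right R _)).trans hz)
  have hRz : R ≤ ‖z‖ := (le_max_left R _).trans hz
  have hzJ : z ∉ filledJulia d c := (hR hRz).2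
  refine (div_eq_one_iff_eq (hB.ne_zero hzJ)).1 (hpow _ fun j => ?_)
  rw [div_pow, ← hB.apply_iterate hzJ, ← hB'.apply_iterate hzJ]
  exact (hR (hRz.trans (hle j))).1

theorem eqOn (hd : 2 ≤ d) (hB : IsBottcher d c B) {B' : ℂ → ℂ} (hB' : IsBottcher d c B')
    (hJ : IsCompact (filledJulia d c)) : EqOn B' B (filledJulia d c)ᶜ := by
  have hopen := hJ.isClosed.isOpen_compl
  obtain ⟨R, -, hR⟩ := (Filter.hasBasis_cobounded_norm (E := ℂ)).eventually_iff.1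
    ((hB.eventually_eq hd hB' hJ).and hJ.isBounded)
  obtain ⟨z₁, hz₁⟩ := (tendsto_norm_cobounded_atTop (E := ℂ)).eventually_gt_atTop R |>.exists
  refine (hB'.holo.analyticOnNhd hopen).eqOn_of_preconnected_of_eventuallyEq
    (hB.holo.analyticOnNhd hopen) (hB.isPreconnected_compl hJ.isClosed) (hR hz₁.le).2 ?_
  filter_upwards [(isOpen_lt continuous_const continuous_norm).mem_nhds hz₁] with z hz
  exact (hR (le_of_lt hz)).1

theorem isOpen_insideEquipotential (hB : IsBottcher d c B)
    (hJ : IsCompact (filledJulia d c)) {r : ℝ} (hr : 1 < r) :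
    IsOpen (insideEquipotential d c r) := by
  rw [isOpen_iff_mem_nhds]
  intro z hz
  by_cases hzJ : z ∈ filledJulia d c
  · filter_upwards [hB.eventually_norm_lt hJ hzJ hr] with y hy
    by_cases hyJ : y ∈ filledJulia d c
    · exact Or.inl hyJ
    · exact Or.inr ⟨B, hB, hy hyJ⟩
  · obtain ⟨B', hB', hlt⟩ := hz.resolve_left hzJ
    have hcont := (hB'.holo.continuousOn.continuousAt (hJ.isClosed.isOpen_compl.mem_nhds hzJ)).norm
    filter_upwards [hcont.eventually_lt_const hlt] with y hy using Or.inr ⟨B', hB', hy⟩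

end IsBottcher

/-! ### External rays and the dividing fixed point -/

section Rays

variable {d : ℕ} {c : ℂ} {α : ℂ} {q : ℕ}

theorem Lands.congr {θ θ' : ℝ} {x : ℂ} (h : Lands d c θ x)
    (he : Complex.exp (θ * Complex.I) = Complex.exp (θ' * Complex.I)) : Lands d c θ' x :=
  let ⟨B, γ, hB, hγ, hl⟩ := h
  ⟨B, γ, hB, he ▸ hγ, hl⟩

theorem ray_congr {θ θ' : ℝ} (he : Complex.exp (θ * Complex.I) = Complex.exp (θ' * Complex.I)) :
    ray d c θ = ray d c θ' := by
  unfold ray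
  rw [he]

theorem Lands.mem_closure_ray {θ : ℝ} {x : ℂ} (h : Lands d c θ x) : x ∈ closure (ray d c θ) := by
  obtain ⟨B, γ, hB, hγ, hl⟩ := h
  refine mem_closure_of_tendsto hl ?_
  filter_upwards [self_mem_nhdsWithin] with s hs using ⟨(hγ s hs).1, B, hB, s, hs, (hγ s hs).2⟩

theorem exp_toIcoMod_mul_I (θ : ℝ) :
    Complex.exp (θ * Complex.I) =
      Complex.exp ((toIcoMod Real.two_pi_pos 0 θ : ℝ) * Complex.I) := by
  rw [Complex.exp_eq_exp_iff_exists_int]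
  refine ⟨toIcoDiv Real.two_pi_pos 0 θ, ?_⟩
  have hθ := toIcoMod_add_toIcoDiv_zsmul Real.two_pi_pos 0 θ
  rw [zsmul_eq_mul] at hθ
  calc (θ : ℂ) * Complex.I = ((toIcoMod Real.two_pi_pos 0 θ +
        toIcoDiv Real.two_pi_pos 0 θ * (2 * π) : ℝ) : ℂ) * Complex.I := by rw [hθ]
    _ = _ := by push_cast; ring

theorem raysAt_subset_biUnion_Ico : raysAt d c α ⊆
    ⋃ θ ∈ {θ : ℝ | θ ∈ Ico 0 (2 * π) ∧ Lands d c θ α}, ray d c θ := by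
  refine iUnion₂_subset fun θ hθ => ?_
  rw [ray_congr (exp_toIcoMod_mul_I θ)]
  refine subset_biUnion_of_mem (u := fun θ => ray d c θ)
    (x := toIcoMod Real.two_pi_pos 0 θ) ⟨?_, Lands.congr hθ (exp_toIcoMod_mul_I θ)⟩
  simpa using toIcoMod_mem_Ico Real.two_pi_pos 0 θ

theorem filledJulia_mem_nhds_of_norm_deriv_lt_one (hα : P d c α = α)
    (hlt : ‖(d : ℂ) * α ^ (d - 1)‖ < 1) : filledJulia d c ∈ 𝓝 α := by
  have hder : HasDerivAt (P d c) (d * α ^ (d - 1)) α := (hasDerivAt_pow d α).add_const c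
  have hcontract : ∀ᶠ z in 𝓝 α, ‖P d c z - α‖ ≤ ‖z - α‖ := by
    filter_upwards [(hasDerivAt_iff_isLittleO.1 hder).def (sub_pos.2 hlt)] with z hz
    rw [hα, smul_eq_mul] at hz
    have htri := norm_add_le (P d c z - α - (z - α) * (d * α ^ (d - 1)))
      ((z - α) * (d * α ^ (d - 1)))
    rw [sub_add_cancel, norm_mul] at htri
    linarith
  obtain ⟨δ, hδ, hball⟩ := Metric.eventually_nhds_iff.1 hcontract
  refine mem_of_superset (Metric.ball_mem_nhds α hδ) fun z hz => ?_
  have hiter : ∀ n : ℕ, (P d c)^[n] z ∈ Metric.ball α δ := by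
    intro n
    induction n with
    | zero => exact hz
    | succ n ih =>
      rw [Function.iterate_succ_apply', mem_ball_iff_norm]
      exact (hball ih).trans_lt (mem_ball_iff_norm.1 ih)
  refine mem_filledJulia_of_norm_iterate_le (C := ‖α‖ + δ) fun n => ?_
  linarith [mem_ball_iff_norm.1 (hiter n), norm_le_norm_add_norm_sub' ((P d c)^[n] z) α]

theorem mem_puzzle_of_mem_closure_piece {r : ℝ} {n : ℕ} {x z : ℂ}
    (hx : x ∈ closure (piece d c α r n z)) : z ∈ puzzle d c α r n := by
  by_contra hz
  rw [piece, connectedComponentIn_eq_empty hz, closure_empty] at hx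
  exact hx

theorem mul_mem_piece_of_pow_eq_one {r : ℝ} {ω z : ℂ} (hω : ω ^ d = 1)
    (hz : z ∈ piece d c α r 1 0) : ω * z ∈ piece d c α r 1 0 := by
  have h0 := mem_puzzle_of_mem_closure_piece (subset_closure hz)
  refine (isPreconnected_connectedComponentIn.image (fun z => ω * z)
    (by fun_prop)).subset_connectedComponentIn
      ⟨0, mem_connectedComponentIn h0, mul_zero ω⟩ ?_ (mem_image_of_mem _ hz)
  rintro _ ⟨z, hz, rfl⟩
  have hPz : P d c (ω * z) = P d c z := by simp only [P, mul_pow, hω, one_mul]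
  have hzO := connectedComponentIn_subset _ _ hz
  simp only [puzzle, mem_preimage, Function.iterate_one] at hzO ⊢
  rwa [hPz]

namespace IsDividing

theorem finite_setOf_lands (h : IsDividing d c α q) :
    {θ : ℝ | θ ∈ Ico 0 (2 * π) ∧ Lands d c θ α}.Finite :=
  finite_of_ncard_ne_zero (by have := h.2; lia)

theorem exists_lands (h : IsDividing d c α q) : ∃ θ, Lands d c θ α :=
  let ⟨θ, _, hθ⟩ := nonempty_of_ncard_ne_zero (by have := h.2; lia :
    {θ : ℝ | θ ∈ Ico 0 (2 * π) ∧ Lands d c θ α}.ncard ≠ 0)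
  ⟨θ, hθ⟩

theorem exists_isBottcher (h : IsDividing d c α q) : ∃ B, IsBottcher d c B :=
  let ⟨_, B, _, hB, _⟩ := h.exists_lands
  ⟨B, hB⟩

theorem mem_closure_raysAt (h : IsDividing d c α q) : α ∈ closure (raysAt d c α) :=
  let ⟨_, hθ⟩ := h.exists_lands
  closure_mono (subset_biUnion_of_mem (u := fun θ => ray d c θ) hθ) hθ.mem_closure_ray

theorem iterate_eq (h : IsDividing d c α q) (n : ℕ) : (P d c)^[n] α = α :=
  Function.iterate_fixed h.1 n

theorem mem_filledJulia (h : IsDividing d c α q) : α ∈ filledJulia d c :=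
  mem_filledJulia_of_norm_iterate_le (C := ‖α‖) fun n => by rw [h.iterate_eq]

theorem eq_of_mem_closure_raysAt (hd : 2 ≤ d) (h : IsDividing d c α q)
    (hJ : IsCompact (filledJulia d c)) {y : ℂ} (hy : y ∈ closure (raysAt d c α))
    (hyJ : y ∈ filledJulia d c) : y = α := by
  have hy' := closure_mono raysAt_subset_biUnion_Ico hy
  rw [h.finite_setOf_lands.closure_biUnion, mem_iUnion₂] at hy'
  obtain ⟨θ, ⟨-, B, γ, hB, hγ, hl⟩, hyθ⟩ := hy'
  refine eq_of_forall_dist_le fun ε hε => ?_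
  obtain ⟨u, hu, hsub⟩ := (mem_nhdsGT_iff_exists_Ioo_subset (a := (1 : ℝ))).1
    (hl.eventually (Metric.closedBall_mem_nhds α hε))
  suffices y ∈ closure (Metric.closedBall α ε) by
    rwa [Metric.isClosed_closedBall.closure_eq] at this
  rw [mem_closure_iff_frequently] at hyθ ⊢
  refine (hyθ.and_eventually (hB.eventually_norm_lt hJ hyJ (r := u) hu)).mono ?_
  rintro z ⟨⟨hzJ, B', hB', s, hs, hBz⟩, hlt⟩
  have hBz' : B z = s * Complex.exp (θ * Complex.I) := by
    rw [← hBz]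
    exact (hB.eqOn hd hB' hJ hzJ).symm
  have hz : z = γ s := hB.bij.injOn hzJ (hγ s hs).1 (by rw [hBz', (hγ s hs).2])
  have hsu : s < u := by
    simpa only [hBz', norm_mul, Complex.norm_exp_ofReal_mul_I, mul_one, Complex.norm_real,
      Real.norm_of_nonneg (one_pos.trans hs).le] using hlt hzJ
  rw [hz]
  exact hsub ⟨hs, hsu⟩

theorem one_le_norm_deriv (h : IsDividing d c α q) : 1 ≤ ‖(d : ℂ) * α ^ (d - 1)‖ := by
  by_contra! hlt
  obtain ⟨θ, hθ⟩ := h.exists_lands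
  obtain ⟨z, hz, hzray⟩ := mem_closure_iff_nhds.1 hθ.mem_closure_ray _
    (filledJulia_mem_nhds_of_norm_deriv_lt_one h.1 hlt)
  exact hzray.1 hz

theorem inv_le_norm (hd : 2 ≤ d) (h : IsDividing d c α q) : (d : ℝ)⁻¹ ≤ ‖α‖ := by
  have hd0 : (0 : ℝ) < d := mod_cast (by lia : 0 < d)
  by_contra! hlt
  have hα1 : ‖α‖ ≤ 1 := hlt.le.trans (inv_le_one_of_one_le₀ (mod_cast (by lia : 1 ≤ d)))
  have hone : 1 ≤ (d : ℝ) * ‖α‖ := calc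
    (1 : ℝ) ≤ d * ‖α‖ ^ (d - 1) := by simpa using h.one_le_norm_deriv
    _ ≤ d * ‖α‖ ^ 1 := by
      gcongr ?_ * ?_
      exact pow_le_pow_of_le_one (norm_nonneg α) hα1 (by lia)
    _ = d * ‖α‖ := by rw [pow_one]
  rw [inv_eq_one_div, lt_div_iff₀' hd0] at hlt
  exact hlt.not_ge hone

theorem isOpen_puzzle (h : IsDividing d c α q) (hJ : IsCompact (filledJulia d c))
    {r : ℝ} (hr : 1 < r) (n : ℕ) : IsOpen (puzzle d c α r n) :=
  let ⟨_, hB⟩ := h.exists_isBottcher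
  ((hB.isOpen_insideEquipotential hJ hr).sdiff isClosed_closure).preimage (continuous_P.iterate n)

theorem exists_mem_closure_piece_apply_eq (hd : 2 ≤ d) (h : IsDividing d c α q)
    (hJ : IsCompact (filledJulia d c)) (hJc : IsPreconnected (filledJulia d c)) {r : ℝ}
    (hr : 1 < r) {z : ℂ} (hzJ : z ∈ filledJulia d c) (hz : z ∈ puzzle d c α r 1) :
    ∃ x ∈ closure (piece d c α r 1 z), P d c x = α := by
  have hopen : IsOpen (piece d c α r 1 z) := (h.isOpen_puzzle hJ hr 1).connectedComponentIn
  have hα : α ∉ puzzle d c α r 1 := fun hα => hα.2 (by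
    rw [h.iterate_eq]
    exact h.mem_closure_raysAt)
  obtain ⟨x, hxJ, hx, hxY⟩ :
      ∃ x ∈ filledJulia d c, x ∈ closure (piece d c α r 1 z) \ piece d c α r 1 z := by
    by_contra! hno
    have hsub : filledJulia d c ⊆ piece d c α r 1 z :=
      hJc.subset_of_closure_inter_subset hopen ⟨z, hzJ, mem_connectedComponentIn hz⟩
        fun x hx => by_contra fun hxY => hno x hx.2 ⟨hx.1, hxY⟩
    exact hα (connectedComponentIn_subset _ _ (hsub h.mem_filledJulia))
  refine ⟨x, hx, h.eq_of_mem_closure_raysAt hd hJ ?_ (P_mem_filledJulia.2 hxJ)⟩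
  by_contra hn
  exact hxY (mem_connectedComponentIn_of_mem_closure hz hx ⟨Or.inl (P_mem_filledJulia.2 hxJ), hn⟩)

/-- The preimages of `α` are the multiples of `α` by the `d`-th roots of unity, and the critical
piece of depth one is invariant under these rotations. -/
theorem mem_closure_piece (hd : 2 ≤ d) (h : IsDividing d c α q) (hJ : IsCompact (filledJulia d c))
    (hJc : IsPreconnected (filledJulia d c)) (h0J : (0 : ℂ) ∈ filledJulia d c) {r : ℝ} (hr : 1 < r)
    (h0 : (0 : ℂ) ∈ puzzle d c α r 1) : α ∈ closure (piece d c α r 1 0) := by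
  obtain ⟨x, hx, hPx⟩ := h.exists_mem_closure_piece_apply_eq hd hJ hJc hr h0J h0
  have hd0 : d ≠ 0 := by lia
  have hpow : x ^ d = α ^ d := add_right_cancel (hPx.trans h.1.symm)
  rcases eq_or_ne x 0 with rfl | hx0
  · rw [zero_pow hd0] at hpow
    obtain rfl : α = 0 := (pow_eq_zero_iff hd0).1 hpow.symm
    exact hx
  · have hω : (α / x) ^ d = 1 := by rw [div_pow, hpow, div_self (hpow ▸ pow_ne_zero d hx0)]
    have hclosure := map_mem_closure (f := fun z => α / x * z) (by fun_prop) hx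
      fun z hz => mul_mem_piece_of_pow_eq_one hω hz
    rwa [div_mul_cancel₀ α hx0] at hclosure

end IsDividing

namespace IsSatellite

variable {r : ℝ} {p : ℕ} {Kl : Set ℂ}

theorem zero_mem_puzzle (hs : IsSatellite d c α r p Kl) : (0 : ℂ) ∈ puzzle d c α r 1 :=
  mem_puzzle_of_mem_closure_piece (hs.2.1 0)

/-- The `q`-th iterates of the critical point never leave the closure of the critical piece of depth
one, so the favorite nest has no first piece. -/
theorem not_inNest (hs : IsSatellite d c α r p Kl) (hq : IsDividing d c α q) {Q : Set ℂ} :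
    ¬ InNest d c α r q Q := by
  intro hQ
  obtain rfl : p = q := hs.1.2.2.symm.trans hq.2.2
  induction hQ with
  | base k hk =>
    obtain ⟨-, hw, h0, -⟩ := hk.1
    have hmem := mem_connectedComponentIn_of_mem_closure hs.zero_mem_puzzle (hs.2.1 k) hw
    rw [piece, ← connectedComponentIn_eq hmem] at h0
    exact h0 (mem_connectedComponentIn hs.zero_mem_puzzle)
  | step _ _ _ _ ih => exact ih

theorem not_isPrimitive (hs : IsSatellite d c α r p Kl) {p' : ℕ} {Kl' : Set ℂ} :
    ¬ IsPrimitive d c α r p' Kl' := fun ⟨_, _, hq, hQ, _⟩ => hs.not_inNest hq hQ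

theorem dividing_mem (hd : 2 ≤ d) (hs : IsSatellite d c α r p Kl)
    (hJ : IsCompact (filledJulia d c)) (hJc : IsPreconnected (filledJulia d c))
    (h0J : (0 : ℂ) ∈ filledJulia d c) (hr : 1 < r) : α ∈ Kl := by
  rw [hs.2.2]
  intro l
  rw [hs.1.iterate_eq]
  exact hs.1.mem_closure_piece hd hJ hJc h0J hr hs.zero_mem_puzzle

end IsSatellite

end Rays

/-! ### Thin rings -/

theorem subset_left_of_frontier_subset {K u v : Set ℂ} (hK : IsCompact K) (hu : IsClosed u)
    (hv : IsClosed v) (huv : Disjoint u v) (hKuv : K ⊆ u ∪ v) (hf : frontier K ⊆ u) : K ⊆ u := by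
  have hKv : K ∩ v = interior K ∩ uᶜ := by
    ext z
    refine ⟨fun ⟨hz, hzv⟩ => ?_, fun ⟨hz, hzu⟩ =>
      ⟨interior_subset hz, (hKuv (interior_subset hz)).resolve_left hzu⟩⟩
    have hzu : z ∉ u := fun h => disjoint_left.1 huv h hzv
    exact ⟨by_contra fun hi => hzu (hf ⟨subset_closure hz, hi⟩), hzu⟩
  have hclopen : IsClopen (K ∩ v) :=
    ⟨hK.isClosed.inter hv, hKv ▸ isOpen_interior.inter hu.isOpen_compl⟩
  rcases isClopen_iff.1 hclopen with h | h
  · exact fun z hz => (hKuv hz).resolve_right fun hzv => h.subset ⟨hz, hzv⟩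
  · exact absurd (isCompact_univ_iff.1 (h ▸ hK.inter_right hv))
      (not_compactSpace_iff.2 inferInstance)

theorem isPreconnected_of_isPreconnected_frontier {K : Set ℂ} (hK : IsCompact K)
    (hf : IsPreconnected (frontier K)) : IsPreconnected K := by
  rw [isPreconnected_iff_subset_of_fully_disjoint_closed hK.isClosed]
  intro u v hu hv hKuv huv
  rcases (isPreconnected_iff_subset_of_fully_disjoint_closed isClosed_frontier).1 hf u v hu hv
    (hK.isClosed.frontier_subset.trans hKuv) huv with h | h
  · exact Or.inl (subset_left_of_frontier_subset hK hu hv huv hKuv h)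
  · exact Or.inr (subset_left_of_frontier_subset hK hv hu huv.symm (union_comm u v ▸ hKuv) h)

namespace StripMap

variable {Φ : ℂ → ℂ} {ℓ a b : ℝ} {A : Set ℂ}

theorem isCompact_image_re_mem_Icc (H : StripMap Φ ℓ A) (ha : 0 < a) (hb : b < ℓ) :
    IsCompact (Φ '' {w | w.re ∈ Icc a b}) := by
  have hbox : Φ '' {w | w.re ∈ Icc a b} = Φ '' (Icc a b ×ℂ Icc 0 (2 * π)) := by
    refine Subset.antisymm ?_ (image_mono fun w hw => hw.1)
    rintro _ ⟨w, hw, rfl⟩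
    have hws : w.re ∈ Ioo 0 ℓ := ⟨ha.trans_le hw.1, hw.2.trans_lt hb⟩
    obtain ⟨t, ht, he⟩ := (H.periodic_loop hws).exists_mem_Ico₀ Real.two_pi_pos w.im
    refine ⟨w.re + t * Complex.I, ?_, ?_⟩
    · simpa [Complex.mem_reProdIm] using ⟨hw, Ico_subset_Icc_self ht⟩
    · rw [← he, Complex.re_add_im]
  rw [hbox]
  exact (isCompact_Icc.reProdIm isCompact_Icc).image_of_continuousOn
    (H.holo.continuousOn.mono fun w hw => ⟨ha.trans_le hw.1.1, hw.1.2.trans_lt hb⟩)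

/-- A component of the complement of `V` that meets the middle third of `A` crosses an outer
third. -/
theorem mul_le_of_exists_notMem {X : ℂ → ℂ} {ℓ' : ℝ} {A' V : Set ℂ} (H : StripMap Φ ℓ A)
    (H' : StripMap X ℓ' A') (hV : IsFull V) (hA'V : A' ⊆ V)
    (hin : ∀ s ∈ Ioo 0 ℓ, ∃ t : ℝ, Φ (s + t * Complex.I) ∈ surrounded A')
    {w₀ : ℂ} (hw₀ : w₀.re ∈ Icc (ℓ / 3) (2 * ℓ / 3)) (hw₀V : Φ w₀ ∉ V) :
    ℓ' * ℓ ≤ 12 * π ^ 2 := by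
  have hℓ := H.pos
  have hout (z : ℂ) (hz : z ∈ connectedComponentIn Vᶜ (Φ w₀)) : z ∉ A' ∧ z ∉ surrounded A' :=
    have hzV : z ∉ V := connectedComponentIn_subset _ _ hz
    ⟨fun h => hzV (hA'V h), fun h => hzV (hV.surrounded_subset hA'V h)⟩
  rcases H.exists_loop_mem_or_of_not_isBounded ⟨by linarith [hw₀.1], by linarith [hw₀.2]⟩
    isPreconnected_connectedComponentIn (mem_connectedComponentIn hw₀V) (hV _ hw₀V) with hc | hc
  · have hle := H.mul_sub_le_of_crosses H' (a := 0) (b := ℓ / 3) le_rfl (by linarith)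
      (fun s hs => hin s ⟨hs.1, by linarith [hs.2]⟩)
      (fun s hs => (hc s ⟨hs.1, hs.2.trans_le hw₀.1⟩).imp fun t ht => hout _ ht)
    linarith
  · have hle := H.mul_sub_le_of_crosses H' (a := 2 * ℓ / 3) (b := ℓ) (by linarith) le_rfl
      (fun s hs => hin s ⟨by linarith [hs.1], hs.2⟩)
      (fun s hs => (hc s ⟨hw₀.2.trans_lt hs.1, hs.2⟩).imp fun t ht => hout _ ht)
    linarith

end StripMap

theorem IsQC.sq_mul_le_of_separates {κ m : ℝ} {V A : Set ℂ} {S : ℂ → ℂ} {a b : ℂ} {δ R : ℝ}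
    (hS : IsQC κ V S) (hV : IsDisk V) (hS0 : S 0 = 0) (hA : IsRing A m)
    (hAc : IsCompact (closure A)) (hAV : closure A ⊆ V) (hbV : b ∈ V)
    (h0 : (0 : ℂ) ∈ surrounded A) (ha : a ∈ surrounded A) (hbA : b ∉ A)
    (hb : b ∉ surrounded A) (hδ : 0 ≤ δ) (hδa : δ ≤ ‖S a‖) (hδR : δ + ‖S b‖ ≤ R) :
    δ ^ 2 * m ≤ π * κ * R ^ 2 := by
  have hAV' : A ⊆ V := subset_closure.trans hAV
  obtain ⟨m', hm'⟩ := (hS.ring_iff A hAc hAV).1 ⟨m, hA⟩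
  have hmm' : m / κ ≤ m' := (hS.ring_le A hAc hAV m m' hA hm').1
  obtain ⟨Φ, hΦ⟩ := hA.exists_stripMap
  obtain ⟨Ψ, hΨ⟩ := hm'.exists_stripMap
  have hsurr {x : ℂ} (hx : x ∈ V) : S x ∈ surrounded (S '' A) ↔ x ∈ surrounded A :=
    hS.openEmb.mem_surrounded_iff hV hΦ.isOpen hAV' hx
  have hAin : surrounded A ⊆ V := hV.isFull.surrounded_subset hAV'
  have hm'R := hΨ.sq_mul_le_of_separates (hS0 ▸ (hsurr (hAin h0)).2 h0) ((hsurr (hAin ha)).2 ha)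
    (fun h => hbA ((hS.injOn.mem_image_iff hAV' hbV).1 h)) (fun h => hb ((hsurr hbV).1 h))
    hδ hδa hδR
  have hκ : 0 < κ := one_pos.trans_le hS.one_le
  rw [div_le_iff₀ hκ] at hmm'
  refine le_of_mul_le_mul_left (a := 2 * π) ?_ Real.two_pi_pos
  calc 2 * π * (δ ^ 2 * m) ≤ 2 * π * (δ ^ 2 * (m' * κ)) := by gcongr
    _ = δ ^ 2 * (2 * π * m') * κ := by ring
    _ ≤ 2 * π ^ 2 * R ^ 2 * κ := by gcongr
    _ = 2 * π * (π * κ * R ^ 2) := by ring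

theorem IsQC.sq_mul_le_of_middle_subset {κ m δ R : ℝ} {V A : Set ℂ} {S Φ : ℂ → ℂ} {a b : ℂ}
    (hS : IsQC κ V S) (hV : IsDisk V) (hS0 : S 0 = 0) (hΦ : StripMap Φ (2 * π * m) A)
    (hmiddle : Φ '' {w | w.re ∈ Icc (2 * π * m / 3) (2 * (2 * π * m) / 3)} ⊆ V) (hbV : b ∈ V)
    (h0 : (0 : ℂ) ∈ surrounded A) (ha : a ∈ surrounded A) (hbA : b ∉ A) (hb : b ∉ surrounded A)
    (hδ : 0 ≤ δ) (hδa : δ ≤ ‖S a‖) (hδR : δ + ‖S b‖ ≤ R) :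
    δ ^ 2 * m ≤ 3 * (π * κ * R ^ 2) := by
  have hℓ := hΦ.pos
  set ℓ := 2 * π * m with hℓm
  let B := Φ '' {w | ℓ / 3 < w.re ∧ w.re < 2 * ℓ / 3}
  have hB : StripMap _ _ B := hΦ.restrict (by linarith) (by linarith) (by linarith)
  have hBring : IsRing B (m / 3) := by
    convert hB.isRing using 1
    rw [hℓm]
    field_simp
    ring
  have hcompact := hΦ.isCompact_image_re_mem_Icc (a := ℓ / 3) (b := 2 * ℓ / 3) (by linarith)
    (by linarith)
  have hclosure := closure_minimal
    (image_mono fun w hw => ⟨hw.1.le, hw.2.le⟩ : B ⊆ Φ '' {w | w.re ∈ Icc (ℓ / 3) (2 * ℓ / 3)})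
    hcompact.isClosed
  have hBA : B ⊆ A := image_subset_iff.2 fun w hw => hΦ.mem
    ⟨by linarith [hw.1], by linarith [hw.2]⟩
  have hsurr : surrounded A ⊆ surrounded B :=
    hΦ.surrounded_subset_restrict (by linarith) (by linarith) (by linarith)
  have hbB : b ∉ surrounded B :=
    hΦ.notMem_surrounded_restrict (by linarith) (by linarith) (by linarith) hbA hb
  have hle := hS.sq_mul_le_of_separates hV hS0 hBring
    (hcompact.of_isClosed_subset isClosed_closure hclosure) (hclosure.trans hmiddle) hbV
    (hsurr h0) (hsurr ha) (fun h => hbA (hBA h)) hbB hδ hδa hδR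
  linarith

/-- The middle third of the ring `A` either stays in the chart domain `V`, where the chart compares
it with a ring separating `0` and `S a` from `S b`, or it leaves `V`, and then an outer third of `A`
crosses every ring around `Z` in `V`. -/
theorem IsQC.annMod_le_or_sq_mul_le_of_separates {κ m δ R : ℝ} {V A Z : Set ℂ} {S : ℂ → ℂ}
    {a b : ℂ} (hS : IsQC κ V S) (hV : IsDisk V) (hS0 : S 0 = 0) (hA : IsRing A m)
    (hZ : IsPreconnected Z) (hZV : Z ⊆ V) (h0Z : (0 : ℂ) ∈ Z) (hbZ : b ∈ Z)
    (h0 : (0 : ℂ) ∈ surrounded A) (ha : a ∈ surrounded A) (hbA : b ∉ A) (hb : b ∉ surrounded A)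
    (hδ : 0 ≤ δ) (hδa : δ ≤ ‖S a‖) (hδR : δ + ‖S b‖ ≤ R) :
    annMod V Z ≤ ENNReal.ofReal (3 / m) ∨ δ ^ 2 * m ≤ 3 * (π * κ * R ^ 2) := by
  obtain ⟨Φ, hΦ⟩ := hA.exists_stripMap
  by_cases hmiddle : Φ '' {w | w.re ∈ Icc (2 * π * m / 3) (2 * (2 * π * m) / 3)} ⊆ V
  · exact Or.inr <| hS.sq_mul_le_of_middle_subset hV hS0 hΦ hmiddle (hZV hbZ) h0 ha hbA
      hb hδ hδa hδR
  · obtain ⟨_, ⟨w₀, hw₀, rfl⟩, hw₀V⟩ := not_subset.1 hmiddle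
    refine Or.inl <| iSup_le fun A' => iSup_le fun m' => iSup_le fun ⟨hA', hA'V, hZA'⟩ =>
      ENNReal.ofReal_le_ofReal ?_
    obtain ⟨X, hX⟩ := hA'.exists_stripMap
    have hle := hΦ.mul_le_of_exists_notMem hX hV.isFull (hA'V.trans sdiff_subset) (fun s hs =>
      (hΦ.exists_loop_mem hZ h0Z hbZ h0 hbA hb hs).imp fun t ht => hZA' ht) hw₀ hw₀V
    rw [le_div_iff₀ hA.1]
    refine le_of_mul_le_mul_left (a := 4 * π ^ 2) ?_ (by positivity)
    linarith

theorem IsQC.annMod_image_le {κ : ℝ} {V U X : Set ℂ} {S : ℂ → ℂ} (hS : IsQC κ V S) (hU : IsDisk U)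
    (hUc : IsCompact (closure U)) (hUV : closure U ⊆ V) (hXU : X ⊆ U) :
    annMod (S '' U) (S '' X) ≤ ENNReal.ofReal κ * annMod U X := by
  refine iSup_le fun A => iSup_le fun m => iSup_le fun ⟨hA, hAU, hXA⟩ => ?_
  have himg : S '' (U ∩ S ⁻¹' A) = A := by
    rw [image_inter_preimage, inter_eq_right.2 (hAU.trans sdiff_subset)]
  rw [← himg] at hA hAU hXA
  set B := U ∩ S ⁻¹' A
  have hBU : B ⊆ U := inter_subset_left
  have hBc := hUc.of_isClosed_subset isClosed_closure (closure_mono hBU)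
  have hBV := (closure_mono hBU).trans hUV
  obtain ⟨m', hB⟩ := (hS.ring_iff B hBc hBV).2 ⟨m, hA⟩
  obtain ⟨Φ, hΦ⟩ := hB.exists_stripMap
  have hBX : B ⊆ U \ X := fun z hz => ⟨hz.1, fun hzX =>
    (hAU (mem_image_of_mem S hz)).2 (mem_image_of_mem S hzX)⟩
  have hXB : X ⊆ surrounded B := fun x hx =>
    ((hS.openEmb.mono (subset_closure.trans hUV)).mem_surrounded_iff hU hΦ.isOpen hBU (hXU hx)).1
      (hXA (mem_image_of_mem S hx))
  calc ENNReal.ofReal m ≤ ENNReal.ofReal (κ * m') :=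
        ENNReal.ofReal_le_ofReal (hS.ring_le B hBc hBV m' m hB hA).2
    _ = ENNReal.ofReal κ * ENNReal.ofReal m' := ENNReal.ofReal_mul (zero_le_one.trans hS.one_le)
    _ ≤ ENNReal.ofReal κ * annMod U X := by
      gcongr
      exact le_iSup_of_le B (le_iSup_of_le m' (le_iSup_of_le ⟨hB, hBX, hXB⟩ le_rfl))

/-! ### Infinitely renormalizable maps -/

namespace Choices

variable {F : Choices} {n : ℕ}

theorem K_subset_V : F.K n ⊆ F.V n := fun _ hz => hz 0

theorem K_subset_W : F.K n ⊆ F.W n := fun _ hz => ⟨hz 0, hz 1⟩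

theorem iterate_R_mem_K {z : ℂ} (hz : z ∈ F.K n) (j : ℕ) : (F.R n)^[j] z ∈ F.K n :=
  IsPolyLike.mapsTo_filled.iterate j hz

end Choices

namespace Admissible

open Choices

variable {d : ℕ} {ε η κ C : ℝ} {F : Choices} {n : ℕ}

theorem t_pos (h : Admissible d ε η κ C F) : ∀ n, 0 < F.t n
  | 0 => h.t_zero ▸ one_pos
  | n + 1 => by
    obtain ⟨p, Kl, ht, hs | ⟨q, Q, -, -, hp, -⟩, -⟩ := h.renorm n
    · exact ht ▸ Nat.mul_pos (h.t_pos n) (zero_lt_two.trans_le hs.1.2.1)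
    · exact ht ▸ Nat.mul_pos (h.t_pos n) hp.1.1

theorem zero_mem_K_succ (h : Admissible d ε η κ C F) (n : ℕ) : (0 : ℂ) ∈ F.K (n + 1) := by
  obtain ⟨p, Kl, -, hs, hK⟩ := h.renorm n
  rw [hK]
  refine ⟨(h.polyLike n).zero_mem, ?_⟩
  rw [(h.straight n).zero]
  rcases hs with ⟨-, h0, rfl⟩ | ⟨q, Q, -, -, -, h0, rfl⟩
  · exact h0
  · exact h0

theorem zero_mem_K (h : Admissible d ε η κ C F) : ∀ n, (0 : ℂ) ∈ F.K n
  | 0 => fun j => by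
    have hV : (F.R 1)^[j / F.t 1] 0 ∈ F.V 1 := h.zero_mem_K_succ 0 _
    have horbit := h.orbit 1 _ hV (j % F.t 1) (Nat.mod_lt _ (h.t_pos 1))
    rw [Choices.R, ← Function.iterate_mul, ← Function.iterate_add_apply, Nat.mod_add_div] at horbit
    rwa [Choices.R, h.t_zero, Function.iterate_one]
  | n + 1 => h.zero_mem_K_succ n

theorem isPreconnected_K (h : Admissible d ε η κ C F) (n : ℕ) : IsPreconnected (F.K n) :=
  isPreconnected_of_isPreconnected_frontier (h.polyLike n).isCompact_filled
    (h.connected n).isPreconnected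

theorem continuousOn_S_K (h : Admissible d ε η κ C F) (n : ℕ) : ContinuousOn (F.S n) (F.K n) :=
  (h.straight n).qc.continuousOn.mono K_subset_V

theorem isCompact_image_K (h : Admissible d ε η κ C F) (n : ℕ) : IsCompact (F.S n '' F.K n) :=
  (h.polyLike n).isCompact_filled.image_of_continuousOn (h.continuousOn_S_K n)

theorem S_iterate_R (h : Admissible d ε η κ C F) {z : ℂ} (hz : z ∈ F.K n) (j : ℕ) :
    F.S n ((F.R n)^[j] z) = (P d (F.c n))^[j] (F.S n z) := by
  induction j with
  | zero => rfl
  | succ j ih =>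
    have hjK := iterate_R_mem_K hz j
    rw [Function.iterate_succ_apply', Function.iterate_succ_apply', ← ih]
    exact (h.straight n).conj _ (hjK 0) (hjK 1)

theorem image_pull (h : Admissible d ε η κ C F) {X : Set ℂ}
    (hX : X ⊆ insideEquipotential d (F.c n) F.r) : F.S n '' F.pull n X = X := by
  refine Subset.antisymm (image_subset_iff.2 fun z hz => hz.2) fun w hw => ?_
  obtain ⟨z, hz, rfl⟩ := h.equip n (hX hw)
  exact ⟨z, ⟨hz.1, hw⟩, rfl⟩

theorem pull_subset_W (h : Admissible d ε η κ C F) {X : Set ℂ}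
    (hX : X ⊆ insideEquipotential d (F.c n) F.r) : F.pull n X ⊆ F.W n := by
  intro z hz
  obtain ⟨y, hy, he⟩ := h.equip n (hX hz.2)
  rwa [← (h.straight n).qc.injOn hy.1 hz.1 he]

theorem pull_filledJulia_subset_K (h : Admissible d ε η κ C F) (n : ℕ) :
    F.pull n (filledJulia d (F.c n)) ⊆ F.K n := by
  have hinv : MapsTo (F.R n) (F.pull n (filledJulia d (F.c n)))
      (F.pull n (filledJulia d (F.c n))) := by
    intro z hz
    have hzW := h.pull_subset_W (fun w hw => Or.inl hw) hz
    refine ⟨hzW.2, ?_⟩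
    rw [(h.straight n).conj z hzW.1 hzW.2]
    exact P_mem_filledJulia.2 hz.2
  exact fun z hz j => (hinv.iterate j hz).1

theorem filledJulia_eq (h : Admissible d ε η κ C F) (n : ℕ) :
    filledJulia d (F.c n) = F.S n '' F.K n := by
  apply Subset.antisymm
  · rw [← h.image_pull (X := filledJulia d (F.c n)) fun w hw => Or.inl hw]
    exact image_mono (h.pull_filledJulia_subset_K n)
  · rintro _ ⟨z, hz, rfl⟩
    obtain ⟨M, hM⟩ := (h.isCompact_image_K n).isBounded.exists_norm_le
    refine mem_filledJulia_of_norm_iterate_le (C := M) fun j => ?_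
    rw [← h.S_iterate_R hz]
    exact hM _ (mem_image_of_mem _ (iterate_R_mem_K hz j))

theorem isCompact_filledJulia (h : Admissible d ε η κ C F) (n : ℕ) :
    IsCompact (filledJulia d (F.c n)) := h.filledJulia_eq n ▸ h.isCompact_image_K n

theorem isPreconnected_filledJulia (h : Admissible d ε η κ C F) (n : ℕ) :
    IsPreconnected (filledJulia d (F.c n)) :=
  h.filledJulia_eq n ▸ (h.isPreconnected_K n).image _ (h.continuousOn_S_K n)

theorem zero_mem_filledJulia (h : Admissible d ε η κ C F) (n : ℕ) :
    (0 : ℂ) ∈ filledJulia d (F.c n) :=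
  h.filledJulia_eq n ▸ ⟨0, h.zero_mem_K n, (h.straight n).zero⟩

theorem norm_S_le_two (h : Admissible d ε η κ C F) (hd : 2 ≤ d) {z : ℂ} (hz : z ∈ F.K n) :
    ‖F.S n z‖ ≤ 2 :=
  mem_closedBall_zero_iff.1 <| filledJulia_subset_closedBall hd (h.zero_mem_filledJulia n) <|
    h.filledJulia_eq n ▸ mem_image_of_mem _ hz

theorem isCompact_inter_preimage_closure (h : Admissible d ε η κ C F) (n : ℕ) :
    IsCompact (F.V n ∩ F.R n ⁻¹' closure (F.V n)) :=
  (h.polyLike n).proper _ (h.polyLike n).closure_subset (h.polyLike n).compact_closure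

theorem closure_W_subset (h : Admissible d ε η κ C F) (n : ℕ) :
    closure (F.W n) ⊆ F.V n ∩ F.R n ⁻¹' closure (F.V n) :=
  closure_minimal (fun _ hz => ⟨hz.1, subset_closure hz.2⟩)
    (h.isCompact_inter_preimage_closure n).isClosed

theorem isDisk_pull (h : Admissible d ε η κ C F) {X : Set ℂ} (hXd : IsDisk X)
    (hX : X ⊆ insideEquipotential d (F.c n) F.r) : IsDisk (F.pull n X) := by
  have hopen : IsOpen (F.pull n X) :=
    (h.straight n).qc.continuousOn.isOpen_inter_preimage (h.polyLike n).disk_dom.1 hXd.1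
  have hemb : OpenEmb (F.S n) (F.pull n X) := (h.straight n).qc.openEmb.mono fun z hz => hz.1
  refine ⟨hopen, ?_⟩
  rw [← hemb.isSimplyConnected_image hopen, h.image_pull hX]
  exact hXd.2

theorem annMod_le_mul_annMod_pull (h : Admissible d ε η κ C F) {X Y : Set ℂ} (hX : IsDisk X)
    (hXr : X ⊆ insideEquipotential d (F.c n) F.r) (hYX : Y ⊆ X) :
    annMod X Y ≤ ENNReal.ofReal κ * annMod (F.pull n X) (F.pull n Y) := by
  have hcl := (closure_mono (h.pull_subset_W hXr)).trans (h.closure_W_subset n)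
  have hle := (h.straight n).qc.annMod_image_le (h.isDisk_pull hX hXr)
    ((h.isCompact_inter_preimage_closure n).of_isClosed_subset isClosed_closure hcl)
    (hcl.trans inter_subset_left) (X := F.pull n Y) fun z hz => ⟨hz.1, hYX hz.2⟩
  rwa [h.image_pull hXr, h.image_pull (hYX.trans hXr)] at hle

theorem le_annMod_W (h : Admissible d ε η κ C F) (hd : 2 ≤ d) (hn : 1 ≤ n) :
    ENNReal.ofReal (ε / d) ≤ annMod (F.V n) (F.W n) := by
  have hle := (h.bounds n hn).1.trans ((h.polyLike n).annMod_le (by lia) (h.zero_mem_K n 1))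
  rw [ENNReal.ofReal_div_of_pos (by positivity), ENNReal.ofReal_natCast]
  exact ENNReal.div_le_of_le_mul' hle

theorem annMod_V_pull_insideEquipotential_mem_Icc (h : Admissible d ε η κ C F) (hd : 2 ≤ d)
    (hn : 1 ≤ n) : annMod (F.V n) (F.pull n (insideEquipotential d (F.c n) F.r)) ∈
      Icc (ENNReal.ofReal (ε / d)) (ENNReal.ofReal (2 * η)) := by
  have hK : F.K n ⊆ F.pull n (insideEquipotential d (F.c n) F.r) := fun z hz =>
    ⟨hz 0, Or.inl (h.filledJulia_eq n ▸ mem_image_of_mem _ hz)⟩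
  exact ⟨(h.le_annMod_W hd hn).trans (annMod_anti (h.pull_subset_W Subset.rfl)),
    (annMod_anti hK).trans (h.bounds n hn).2.2⟩

theorem dividing_mem_image_K_succ (h : Admissible d ε η κ C F) (hd : 2 ≤ d) (hs : F.Sat d n) :
    F.α n ∈ F.S n '' F.K (n + 1) := by
  obtain ⟨p', Kl', hs'⟩ := hs
  obtain ⟨p, Kl, -, hren, hK⟩ := h.renorm n
  have hsat := hren.resolve_right hs'.not_isPrimitive
  obtain ⟨z, hz, hzα⟩ := h.filledJulia_eq n ▸ hsat.1.mem_filledJulia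
  refine ⟨z, ?_, hzα⟩
  rw [hK]
  exact ⟨hz 0, hzα ▸ hsat.dividing_mem hd (h.isCompact_filledJulia n)
    (h.isPreconnected_filledJulia n) (h.zero_mem_filledJulia n) h.one_lt⟩

theorem L_subset (h : Admissible d ε η κ C F) (hc : F.CaseC d n) :
    F.L (n + 1) ⊆ insideEquipotential d (F.c n) F.r \ closure (raysAt d (F.c n) (F.α n)) :=
  (h.disks n hc).2.2.1.trans (connectedComponentIn_subset _ _)

theorem pull_E_subset (h : Admissible d ε η κ C F) (hc : F.CaseC d n) :
    F.pull (n + 1) (F.E (n + 1)) ⊆ F.pull n (F.L' (n + 1)) := by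
  intro z hz
  obtain ⟨y, hy, he⟩ := ((h.disksE n hc).2.1 hz.2).1
  rw [← (h.straight (n + 1)).qc.injOn hy.2 hz.1 he]
  exact hy.1

theorem image_K_succ_subset_bouquet (h : Admissible d ε η κ C F) (n : ℕ) :
    F.S n '' F.K (n + 1) ⊆ F.bouquet d n (n + 1) := by
  obtain ⟨p, Kl, ht, -, hK⟩ := h.renorm n
  have hV : F.K (n + 1) ⊆ F.V n := fun z hz => (hK ▸ hz : z ∈ F.pull n Kl).1
  have hdiv : 0 < F.t (n + 1) / F.t n :=
    Nat.div_pos (Nat.le_of_dvd (h.t_pos _) ⟨p, ht⟩) (h.t_pos _)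
  refine ((h.isPreconnected_K (n + 1)).image _
    ((h.straight n).qc.continuousOn.mono hV)).subset_connectedComponentIn
    ⟨0, h.zero_mem_K _, (h.straight n).zero⟩ fun w hw => ?_
  exact mem_biUnion (Finset.mem_coe.2 (Finset.mem_range.2 hdiv)) (by simpa using hw)

theorem K_subset_pull_E (h : Admissible d ε η κ C F) (hc : F.CaseC d n) :
    F.K (n + 2) ⊆ F.pull (n + 1) (F.E (n + 1)) := by
  obtain ⟨p, Kl, -, -, hK⟩ := h.renorm (n + 1)
  exact fun z hz => ⟨(hK ▸ hz : z ∈ F.pull (n + 1) Kl).1,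
    (h.disksE n hc).2.2.1 (h.image_K_succ_subset_bouquet (n + 1) (mem_image_of_mem _ hz))⟩

theorem le_annMod_pull_L_pull_E (h : Admissible d ε η κ C F) (hc : F.CaseC d n) :
    ENNReal.ofReal (1 / C) ≤ ENNReal.ofReal κ *
      annMod (F.pull n (F.L (n + 1))) (F.pull (n + 1) (F.E (n + 1))) := by
  obtain ⟨hL, -, -, hL'L, -, -, hLL', -⟩ := h.disks n hc
  calc ENNReal.ofReal (1 / C) ≤ annMod (F.L (n + 1)) (F.L' (n + 1)) := hLL'.1
    _ ≤ ENNReal.ofReal κ * annMod (F.pull n (F.L (n + 1))) (F.pull n (F.L' (n + 1))) :=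
      h.annMod_le_mul_annMod_pull hL ((h.L_subset hc).trans sdiff_subset) hL'L
    _ ≤ _ := by
      gcongr
      exact annMod_anti (h.pull_E_subset hc)

/-- The connected set `K (n + 1)` joins `0` to the preimage of the dividing fixed point `α n`, which
lies outside the pullback of `L`, whereas the preimage of `α (n + 1)` lies inside the pullback of
`E` and has norm at least `1 / d` in the chart `S (n + 1)`. -/
theorem annMod_pull_L_pull_E_le (h : Admissible d ε η κ C F) (hd : 2 ≤ d) (hε : 0 < ε)
    (hc : F.CaseC d n) : annMod (F.pull n (F.L (n + 1))) (F.pull (n + 1) (F.E (n + 1))) ≤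
      ENNReal.ofReal (max (3 * d / ε) (27 * π * κ * d ^ 2)) := by
  refine iSup_le fun A => iSup_le fun m => iSup_le fun ⟨hA, hAL, hEA⟩ =>
    ENNReal.ofReal_le_ofReal ?_
  have hm : 0 < m := hA.1
  have hd0 : (0 : ℝ) < d := by positivity
  obtain ⟨b, hbK, hb⟩ := h.dividing_mem_image_K_succ hd hc.1
  obtain ⟨a, haK, ha⟩ := h.dividing_mem_image_K_succ hd hc.2
  obtain ⟨p, Kl, hdiv, -⟩ := hc.1
  obtain ⟨p', Kl', hdiv', -⟩ := hc.2
  have hKA : F.K (n + 2) ⊆ surrounded A := (h.K_subset_pull_E hc).trans hEA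
  have hbL : b ∉ F.pull n (F.L (n + 1)) := fun hbL =>
    (h.L_subset hc hbL.2).2 (hb.symm ▸ hdiv.mem_closure_raysAt)
  have hLfull := (h.isDisk_pull (h.disks n hc).1 ((h.L_subset hc).trans sdiff_subset)).isFull
  have hδ : (d : ℝ)⁻¹ ≤ ‖F.S (n + 1) a‖ := ha ▸ hdiv'.inv_le_norm hd
  have hδR : (d : ℝ)⁻¹ + ‖F.S (n + 1) b‖ ≤ 3 := by
    have hd1 : (d : ℝ)⁻¹ ≤ 1 := inv_le_one_of_one_le₀ (mod_cast one_le_two.trans hd)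
    linarith [h.norm_S_le_two hd hbK]
  rcases (h.straight (n + 1)).qc.annMod_le_or_sq_mul_le_of_separates (h.polyLike (n + 1)).disk_dom
    (h.straight (n + 1)).zero hA (h.isPreconnected_K _) K_subset_V (h.zero_mem_K _) hbK
    (hKA (h.zero_mem_K _)) (hKA haK) (fun hbA => hbL (hAL hbA).1)
    (fun hbA => hbL (hLfull.surrounded_subset (hAL.trans sdiff_subset) hbA)) (by positivity) hδ hδR
    with hle | hle
  · refine le_max_of_le_left ?_
    have hε3 := ((h.le_annMod_W hd n.succ_pos).trans (annMod_anti K_subset_W)).trans hle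
    rw [ENNReal.ofReal_le_ofReal_iff (by positivity), div_le_div_iff₀ hd0 hm] at hε3
    rw [le_div_iff₀ hε]
    linarith
  · refine le_max_of_le_right ?_
    rw [inv_pow, inv_mul_le_iff₀ (by positivity)] at hle
    linarith

theorem annMod_hole_Del_mem_Icc (h : Admissible d ε η κ C F) (hd : 2 ≤ d) (hε : 0 < ε)
    (hn : 1 ≤ n) : annMod (F.hole d n) (F.Del d n) ∈ Icc (ENNReal.ofReal (min (ε / d) (1 / C / κ)))
      (ENNReal.ofReal (max (2 * η) (max (3 * d / ε) (27 * π * κ * d ^ 2)))) := by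
  obtain ⟨n, rfl⟩ := Nat.exists_eq_succ_of_ne_zero (Nat.one_le_iff_ne_zero.1 hn)
  by_cases hc : F.CaseC d n
  · simp only [Choices.hole, Choices.Del, if_pos hc]
    refine ⟨(ENNReal.ofReal_le_ofReal (min_le_right _ _)).trans ?_,
      (h.annMod_pull_L_pull_E_le hd hε hc).trans (ENNReal.ofReal_le_ofReal (le_max_right _ _))⟩
    rw [ENNReal.ofReal_div_of_pos (one_pos.trans_le (h.straight 0).qc.one_le)]
    exact ENNReal.div_le_of_le_mul' (h.le_annMod_pull_L_pull_E hc)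
  · simp only [Choices.hole, Choices.Del, if_neg hc]
    obtain ⟨hlo, hhi⟩ := h.annMod_V_pull_insideEquipotential_mem_Icc hd hn
    exact ⟨(ENNReal.ofReal_le_ofReal (min_le_left _ _)).trans hlo,
      hhi.trans (ENNReal.ofReal_le_ofReal (le_max_left _ _))⟩

end Admissible

theorem toReal_div_toReal_le {x y : ENNReal} {lo hi : ℝ} (hlo : 0 < lo)
    (hx : x ∈ Icc (ENNReal.ofReal lo) (ENNReal.ofReal hi))
    (hy : y ∈ Icc (ENNReal.ofReal lo) (ENNReal.ofReal hi)) : y.toReal / x.toReal ≤ hi / lo := by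
  have hhi : 0 ≤ hi :=
    (ENNReal.ofReal_pos.1 ((ENNReal.ofReal_pos.2 hlo).trans_le (hx.1.trans hx.2))).le
  exact div_le_div₀ hhi (ENNReal.toReal_le_of_le_ofReal hhi hy.2) hlo
    ((ENNReal.ofReal_le_iff_le_toReal (hx.2.trans_lt ENNReal.ofReal_lt_top).ne).1 hx.1)

end GlueSpace

theorem mainTheorem10 (d : ℕ) (hd : 2 ≤ d) (ε η κ C : ℝ) (hε : 0 < ε) (hC : 0 < C) :
    ∃ M' : ℝ, 1 ≤ M' ∧ ∀ F G : GlueSpace.Choices,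
      GlueSpace.Admissible d ε η κ C F → GlueSpace.Admissible d ε η κ C G →
      ∀ n : ℕ, 1 ≤ n →
        0 < GlueSpace.annMod (F.hole d n) (F.Del d n) ∧
        GlueSpace.annMod (F.hole d n) (F.Del d n) < ⊤ ∧
        0 < GlueSpace.annMod (G.hole d n) (G.Del d n) ∧
        GlueSpace.annMod (G.hole d n) (G.Del d n) < ⊤ ∧
        1 / M' ≤ (GlueSpace.annMod (G.hole d n) (G.Del d n)).toReal /
          (GlueSpace.annMod (F.hole d n) (F.Del d n)).toReal ∧
        (GlueSpace.annMod (G.hole d n) (G.Del d n)).toReal /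
          (GlueSpace.annMod (F.hole d n) (F.Del d n)).toReal ≤ M' := by
  set lo := min (ε / d) (1 / C / κ)
  set hi := max (2 * η) (max (3 * d / ε) (27 * Real.pi * κ * d ^ 2))
  refine ⟨max 1 (hi / lo), le_max_left _ _, fun F G hF hG n hn => ?_⟩
  have hlo : 0 < lo := lt_min (by positivity)
    (div_pos (one_div_pos.2 hC) (one_pos.trans_le (hF.straight 0).qc.one_le))
  have hx := hF.annMod_hole_Del_mem_Icc hd hε hn
  have hy := hG.annMod_hole_Del_mem_Icc hd hε hn
  have hx0 := (ENNReal.ofReal_pos.2 hlo).trans_le hx.1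
  have hy0 := (ENNReal.ofReal_pos.2 hlo).trans_le hy.1
  have hxtop := hx.2.trans_lt ENNReal.ofReal_lt_top
  have hytop := hy.2.trans_lt ENNReal.ofReal_lt_top
  refine ⟨hx0, hxtop, hy0, hytop, ?_,
    (GlueSpace.toReal_div_toReal_le hlo hx hy).trans (le_max_right _ _)⟩
  rw [one_div_le (by positivity)
    (div_pos (ENNReal.toReal_pos hy0.ne' hytop.ne) (ENNReal.toReal_pos hx0.ne' hxtop.ne)),
    one_div_div]
  exact (GlueSpace.toReal_div_toReal_le hlo hy hx).trans (le_max_right _ _)
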